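/- Let $p$ be an odd prime, $q=p^a$, $\mathbb{Q}_q$ the unramified extension of $\mathbb{Q}_p$ of degree $a$, with ring of integers $\mathbb{Z}_q$, residue field $\mathbb{F}_q$ and $p$-adic absolute value $|\cdot|$. Let $g\ge 1$ and let $Q(X,\Gamma)\in\mathbb{Z}_q[\Gamma][X]$ be monic in $X$ of degree $2g+1$, such that the reduction $\bar Q(X,0)\in\mathbb{F}_q[X]$ has no double roots in $\bar{\mathbb{F}}_q$. Put $Q'=\partial Q/\partial X$ and $r(\Gamma)=\mathrm{Res}_X(Q,Q')=\sum_i r_i\Gamma^i$. Let $\rho'$ be the largest index for which $r_{\rho'}$ is a unit of $\mathbb{Z}_q$, and let $R(\Gamma)=\sum_{i=0}^{\rho'}r_i\Gamma^i$. Let $S=\mathbb{Q}_q[\Gamma,1/R]^\dagger$ be the ring of all series $\sum_{a,b\ge 0}c_{ab}\Gamma^aR(\Gamma)^{-b}$ with $c_{ab}\in\mathbb{Q}_q$ and $|c_{ab}|\le C\lambda^{a+b}$ for some real $C$ and some $0<\lambda<1$ (as $R(0)$ is a unit, these series can be regarded as elements of $\mathbb{Q}_q[[\Gamma]]$). Equivalently,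 if $\rho'\ge 1$, $S$ consists of the series $\sum_{k\in\mathbb{Z}}b_k(\Gamma)R(\Gamma)^{-k}$ with $b_k\in\mathbb{Q}_q[\Gamma]$, $\deg b_k<\rho'$, whose coefficients tend to $0$ geometrically in $|k|$; if $\rho'=0$, it consists of the overconvergent power series in $\Gamma$. Let $T=\mathbb{Q}_q[\Gamma,1/R,X,1/\sqrt Q]^\dagger$ be the $S$-module of all formal series $$\sum_{k\in\mathbb{Z}}\sum_{i=0}^{2g}s_{ik}\frac{X^i}{\sqrt{Q}^{\,k}},\qquad s_{ik}\in S,$$ for which there are a real $C$ and $0<\lambda<1$ such that every $s_{ik}$ can be written as $\sum_{a,b\ge0}c_{ab}\Gamma^aR^{-b}$ with $|c_{ab}|\le C\lambda^{|k|+a+b}$. Let $d:T\to T\,dX$ be the $S$-linear map $\frac{\partial}{\partial X}dX$, computed termwise with $\frac{\partial}{\partial X}\sqrt{Q}^{\,-k}=-\frac k2\,Q'\sqrt{Q}^{\,-k-2}$, where numerators of degree greater than $2g$ in $X$ are divided by $Q$ with remainder. Then the $S$-module $T\,dX/dT$ is free, and the classes of $$\frac{X^i\,dX}{\sqrt Q}\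 (0\le i\le 2g-1),\qquad \frac{X^j\,dX}{Q}\ (0\le j\le 2g)$$ form a basis of it. -/

import Mathlib

open Polynomial

noncomputable section

/-! ### Overconvergent series in `Γ` and `1 / R(Γ)` -/

section Base

variable {K : Type*} [NormedField K]

theorem hasSum_coeff_mul {K : Type*} [NormedField K] [IsUltrametricDist K]
    {s s' : PowerSeries K} {a b : ℕ × ℕ → K} {E : ℕ × ℕ → PowerSeries K}
    (hE : ∀ m m', E (m + m') = E m * E m')
    (hs : ∀ n, HasSum (fun m => a m * PowerSeries.coeff n (E m)) (PowerSeries.coeff n s))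
    (hs' : ∀ n, HasSum (fun m => b m * PowerSeries.coeff n (E m)) (PowerSeries.coeff n s'))
    (n : ℕ) :
    HasSum (fun q : (ℕ × ℕ) × (ℕ × ℕ) => a q.1 * b q.2 * PowerSeries.coeff n (E (q.1 + q.2)))
      (PowerSeries.coeff n (s * s')) := by
  have hna : NonarchimedeanRing K := { IsUltrametricDist.nonarchimedeanAddGroup with }
  have h0 : ∀ i j : ℕ, HasSum (fun q : (ℕ × ℕ) × (ℕ × ℕ) =>
      (fun m => a m * PowerSeries.coeff i (E m)) q.1 *
        (fun m => b m * PowerSeries.coeff j (E m)) q.2)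
      (PowerSeries.coeff i s * PowerSeries.coeff j s') := by
    intro i j
    have h1 := hs i
    have h2 := hs' j
    generalize (fun m => a m * PowerSeries.coeff i (E m)) = f at *
    generalize (fun m => b m * PowerSeries.coeff j (E m)) = g at *
    exact HasSum.mul_of_nonarchimedean h1 h2
  rw [PowerSeries.coeff_mul]
  have h1 := hasSum_sum (s := Finset.HasAntidiagonal.antidiagonal n) fun x _ => h0 x.1 x.2
  convert h1 using 2 with q
  rw [hE, PowerSeries.coeff_mul, Finset.mul_sum]
  exact Finset.sum_congr rfl fun x _ => mul_mul_mul_comm _ _ _ _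

/-- `HasOverconvergentExpansion R C ρ s`: the power series `s ∈ K⟦Γ⟧` equals
`∑_{i, j ≥ 0} a_{ij} Γ ^ i / R(Γ) ^ j` with `‖a_{ij}‖ ≤ C * ρ ^ (i + j)`.
The sum is taken in `K⟦Γ⟧`, coefficient by coefficient. -/
def HasOverconvergentExpansion (R : K[X]) (C ρ : ℝ) (s : PowerSeries K) : Prop :=
  ∃ a : ℕ × ℕ → K, (∀ m, ‖a m‖ ≤ C * ρ ^ (m.1 + m.2)) ∧
    ∀ n : ℕ, HasSum
      (fun m : ℕ × ℕ => a m * PowerSeries.coeff n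
        ((PowerSeries.X : PowerSeries K) ^ m.1 * (R : PowerSeries K)⁻¹ ^ m.2))
      (PowerSeries.coeff n s)

namespace HasOverconvergentExpansion

variable {R : K[X]} {C C' ρ ρ' : ℝ} {s s' : PowerSeries K}

theorem nonneg (h : HasOverconvergentExpansion R C ρ s) : 0 ≤ C := by
  obtain ⟨a, ha, -⟩ := h
  simpa using (norm_nonneg _).trans (ha (0, 0))

theorem mono (h : HasOverconvergentExpansion R C ρ s) (hC : C ≤ C') (h0 : 0 ≤ ρ)
    (hρ : ρ ≤ ρ') : HasOverconvergentExpansion R C' ρ' s := by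
  have hC0 := h.nonneg
  obtain ⟨a, ha, hs⟩ := h
  have hC0' : 0 ≤ C' := hC0.trans hC
  refine ⟨a, fun m => (ha m).trans ?_, hs⟩
  gcongr

theorem zero (hC : 0 ≤ C) (h0 : 0 ≤ ρ) : HasOverconvergentExpansion R C ρ 0 :=
  ⟨0, fun m => by simpa using mul_nonneg hC (pow_nonneg h0 _), fun n => by simp [hasSum_zero]⟩

theorem add (h : HasOverconvergentExpansion R C ρ s) (h' : HasOverconvergentExpansion R C' ρ s') :
    HasOverconvergentExpansion R (C + C') ρ (s + s') := by
  obtain ⟨a, ha, hs⟩ := h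
  obtain ⟨b, hb, hs'⟩ := h'
  refine ⟨a + b, fun m => (norm_add_le _ _).trans ?_, fun n => ?_⟩
  · rw [add_mul]; exact add_le_add (ha m) (hb m)
  · simpa [add_mul] using (hs n).add (hs' n)

theorem X_pow (i : ℕ) (c : K) (h0 : 0 < ρ) :
    HasOverconvergentExpansion R (‖c‖ / ρ ^ i) ρ (PowerSeries.C c * PowerSeries.X ^ i) := by
  classical
  refine ⟨Pi.single (i, 0) c, fun m => ?_, fun n => ?_⟩
  · by_cases hm : m = (i, 0)
    · subst hm
      have : ρ ^ i ≠ 0 := by positivity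
      simp [this]
    · rw [Pi.single_eq_of_ne hm]
      simp only [norm_zero]
      positivity
  · convert hasSum_single (i, 0) ?_ using 1
    · simp [PowerSeries.coeff_C_mul]
    · intro m hm
      simp [Pi.single_eq_of_ne hm]

theorem coe_polynomial (p : K[X]) (h0 : 0 < ρ) :
    ∃ C, HasOverconvergentExpansion R C ρ (p : PowerSeries K) := by
  induction p using Polynomial.induction_on' with
  | add p q hp hq =>
    obtain ⟨C, hC⟩ := hp
    obtain ⟨C', hC'⟩ := hq
    exact ⟨C + C', by simpa using hC.add hC'⟩
  | monomial i c =>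
    refine ⟨‖c‖ / ρ ^ i, ?_⟩
    convert X_pow (R := R) i c h0 using 1
    rw [← Polynomial.C_mul_X_pow_eq_monomial]
    simp

theorem inv (h0 : 0 < ρ) :
    HasOverconvergentExpansion R (1 / ρ) ρ (R : PowerSeries K)⁻¹ := by
  classical
  refine ⟨Pi.single (0, 1) 1, fun m => ?_, fun n => ?_⟩
  · by_cases hm : m = (0, 1)
    · subst hm
      simp [h0.ne']
    · rw [Pi.single_eq_of_ne hm]
      simp only [norm_zero]
      positivity
  · convert hasSum_single (0, 1) ?_ using 1
    · simp
    · intro m hm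
      simp [Pi.single_eq_of_ne hm]

theorem mul [IsUltrametricDist K] (h : HasOverconvergentExpansion R C ρ s)
    (h' : HasOverconvergentExpansion R C' ρ s') (h0 : 0 ≤ ρ) :
    HasOverconvergentExpansion R (C * C') ρ (s * s') := by
  classical
  have hC := h.nonneg
  have hC' := h'.nonneg
  obtain ⟨a, ha, hs⟩ := h
  obtain ⟨b, hb, hs'⟩ := h'
  let F : ℕ × ℕ → Type := fun l => {q : (ℕ × ℕ) × (ℕ × ℕ) // q.1 + q.2 = l}
  have hfin : ∀ l, Finite (F l) := fun l => by
    refine Set.Finite.subset ((Set.finite_Iic l).prod (Set.finite_Iic l)) ?_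
    rintro ⟨q, q'⟩ rfl
    exact ⟨by simp, by simp⟩
  have hft : ∀ l, Fintype (F l) := fun l => Fintype.ofFinite _
  refine ⟨fun l => ∑ q : F l, a q.1.1 * b q.1.2, fun l => ?_, fun n => ?_⟩
  · refine IsUltrametricDist.norm_sum_le_of_forall_le_of_nonneg (by positivity) fun q _ => ?_
    rw [norm_mul]
    calc ‖a q.1.1‖ * ‖b q.1.2‖
        ≤ (C * ρ ^ (q.1.1.1 + q.1.1.2)) * (C' * ρ ^ (q.1.2.1 + q.1.2.2)) := by
          gcongr
          · exact ha _
          · exact hb _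
      _ = C * C' * ρ ^ (l.1 + l.2) := by
          have h1 : q.1.1.1 + q.1.2.1 = l.1 := congrArg Prod.fst q.2
          have h2 : q.1.1.2 + q.1.2.2 = l.2 := congrArg Prod.snd q.2
          rw [← h1, ← h2]
          ring
  · set E : ℕ × ℕ → PowerSeries K := fun m =>
      (PowerSeries.X : PowerSeries K) ^ m.1 * (R : PowerSeries K)⁻¹ ^ m.2 with hEdef
    have hE : ∀ m m', E (m + m') = E m * E m' := fun m m' => by
      simp only [E, Prod.fst_add, Prod.snd_add, pow_add]
      ring
    have hE1 : ∀ n, HasSum (fun m => a m * PowerSeries.coeff n (E m)) (PowerSeries.coeff n s) := hs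
    have hE2 : ∀ n, HasSum (fun m => b m * PowerSeries.coeff n (E m)) (PowerSeries.coeff n s') :=
      hs'
    clear hs hs'
    clear_value E
    have key := hasSum_coeff_mul hE hE1 hE2 n
    have key2 := (Equiv.hasSum_iff (Equiv.sigmaFiberEquiv
      (fun q : (ℕ × ℕ) × (ℕ × ℕ) => q.1 + q.2))).2 key
    refine key2.sigma fun l => ?_
    have := hasSum_fintype (fun q : F l => a q.1.1 * b q.1.2 * PowerSeries.coeff n (E l))
    rw [← Finset.sum_mul] at this
    convert this using 2 with q
    have hq : q.1.1 + q.1.2 = l := q.2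
    simp only [Function.comp, Equiv.sigmaFiberEquiv, Equiv.coe_fn_mk, hq]
    rw [hEdef]

end HasOverconvergentExpansion

theorem exists_common_rate {ρ ρ' : ℝ} (h : 0 < ρ ∧ ρ < 1) (h' : 0 < ρ' ∧ ρ' < 1) :
    0 < max ρ ρ' ∧ max ρ ρ' < 1 :=
  ⟨lt_max_of_lt_left h.1, max_lt h.2 h'.2⟩

/-- The dagger algebra `K[Γ, 1 / R(Γ)]^†`, realised inside `K⟦Γ⟧` by expansion at `Γ = 0`:
all series `∑_{i, j ≥ 0} a_{ij} Γ ^ i / R(Γ) ^ j` whose coefficients `a_{ij} ∈ K` decay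
geometrically in `i + j`. It is meant for `R` with integral coefficients whose constant and leading
coefficients are units. Expansion at `0` then loses nothing: the reduction
`k[Γ, 1 / R] → k⟦Γ⟧` over the residue field `k` is injective. If `deg R > 0`, division by powers
of `R` brings every element to the form `∑_{k ∈ ℤ} b_k(Γ) / R(Γ) ^ k` with `deg b_k < deg R` and
geometric decay in `|k|`. If `R` is constant, the elements are the overconvergent power series
`∑_{i ≥ 0} a_i Γ ^ i`. -/
def daggerAlgebra [IsUltrametricDist K] (R : K[X]) : Subalgebra K (PowerSeries K) where
  carrier := {s | ∃ C ρ : ℝ, (0 < ρ ∧ ρ < 1) ∧ HasOverconvergentExpansion R C ρ s}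
  mul_mem' := by
    rintro s s' ⟨C, ρ, hρ, h⟩ ⟨C', ρ', hρ', h'⟩
    have hm := exists_common_rate hρ hρ'
    exact ⟨_, _, hm, (h.mono le_rfl hρ.1.le (le_max_left _ _)).mul
      (h'.mono le_rfl hρ'.1.le (le_max_right _ _)) hm.1.le⟩
  add_mem' := by
    rintro s s' ⟨C, ρ, hρ, h⟩ ⟨C', ρ', hρ', h'⟩
    exact ⟨_, _, exists_common_rate hρ hρ', (h.mono le_rfl hρ.1.le (le_max_left _ _)).add
      (h'.mono le_rfl hρ'.1.le (le_max_right _ _))⟩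
  algebraMap_mem' c := by
    have h2 : (0 : ℝ) < 1 / 2 ∧ (1 / 2 : ℝ) < 1 := by norm_num
    obtain ⟨C, h⟩ := HasOverconvergentExpansion.coe_polynomial (R := R) (Polynomial.C c) h2.1
    exact ⟨C, 1 / 2, h2, by simpa using h⟩

/-- Polynomials in `Γ` as elements of `K[Γ, 1 / R(Γ)]^†`. -/
def polynomialToDagger [IsUltrametricDist K] (R : K[X]) : K[X] →+* daggerAlgebra R :=
  (Polynomial.coeToPowerSeries.ringHom (R := K)).codRestrict (daggerAlgebra R) fun p => by
    have h2 : (0 : ℝ) < 1 / 2 ∧ (1 / 2 : ℝ) < 1 := by norm_num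
    obtain ⟨C, h⟩ := HasOverconvergentExpansion.coe_polynomial (R := R) p h2.1
    exact ⟨C, 1 / 2, h2, by simpa using h⟩

/-- The ring of integers of a nonarchimedean field. -/
abbrev integerRing (K : Type*) [NormedField K] [IsUltrametricDist K] : ValuationSubring K :=
  (NormedField.valuation (K := K)).valuationSubring

end Base

/-! ### The family of hyperelliptic curves -/

/-- A family of curves `Y ^ 2 = Q(X, Γ)` over the ring of integers of `K`. The inner variable is
`Γ`, the outer one is `X`. The polynomial `Q` is monic of degree `2 * g + 1` in `X` and its
reduction at `Γ = 0` has no double roots. -/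
structure HyperellipticFamily (K : Type*) [NormedField K] [IsUltrametricDist K] where
  g : ℕ
  one_le_g : 1 ≤ g
  Q : (integerRing K)[X][X]
  monic : Q.Monic
  natDegree_eq : Q.natDegree = 2 * g + 1
  separable : ((Q.map (Polynomial.mapRingHom (IsLocalRing.residue (integerRing K)))).map
    (Polynomial.evalRingHom 0)).Separable

namespace HyperellipticFamily

variable {K : Type*} [NormedField K] [IsUltrametricDist K] (E : HyperellipticFamily K)

/-- `r(Γ) = Res_X(Q, ∂Q/∂X)`, with `Q` of degree `2 * g + 1` and `∂Q/∂X` of degree `2 * g`. -/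
def r : (integerRing K)[X] :=
  Polynomial.resultant E.Q (derivative E.Q) (2 * E.g + 1) (2 * E.g)

/-- The largest index of a coefficient of `r` that is a unit. -/
def rhoPrime : ℕ :=
  (E.r.map (IsLocalRing.residue (integerRing K))).natDegree

/-- The truncation `R(Γ) = ∑_{i ≤ ρ'} r_i Γ ^ i` of `r`. -/
def R : K[X] :=
  ∑ i ∈ Finset.range (E.rhoPrime + 1), Polynomial.C (E.r.coeff i : K) * Polynomial.X ^ i

/-- The base ring `S = K[Γ, 1 / R]^†`. -/
def S : Type _ := daggerAlgebra E.R

instance : CommRing E.S := inferInstanceAs (CommRing (daggerAlgebra E.R))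

instance : Algebra K E.S := inferInstanceAs (Algebra K (daggerAlgebra E.R))

/-- The expansion of an element of `S` at `Γ = 0`; it determines the element. -/
def expansion : E.S →ₐ[K] PowerSeries K := (daggerAlgebra E.R).val

/-- Polynomials in `Γ` with integral coefficients, as elements of `S`. -/
def ofPolynomial : (integerRing K)[X] →+* E.S :=
  (polynomialToDagger E.R).comp (Polynomial.mapRingHom (algebraMap (integerRing K) K))

/-- The polynomial `Q`, seen in `S[X]`. -/
def QS : E.S[X] :=
  E.Q.map E.ofPolynomial

theorem QS_monic : E.QS.Monic := E.monic.map _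

instance : Nontrivial E.S := inferInstanceAs (Nontrivial (daggerAlgebra E.R))

theorem QS_natDegree : E.QS.natDegree = 2 * E.g + 1 := by
  rw [QS, E.monic.natDegree_map, E.natDegree_eq]

/-- Series `∑_{k ∈ ℤ} t_k(X) / √Q ^ k` are represented by their numerators `t_k ∈ S[X]`. This is
the growth condition: for some `C` and `ρ < 1` the coefficient of `X ^ i` in `t_k` has an
expansion `∑_{a, b ≥ 0} c_{ab} Γ ^ a / R ^ b` with `‖c_{ab}‖ ≤ C * ρ ^ (|k| + a + b)`. -/
def IsOverconvergent (t : ℤ → E.S[X]) : Prop :=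
  ∃ C ρ : ℝ, (0 < ρ ∧ ρ < 1) ∧ ∀ (k : ℤ) (i : ℕ),
    HasOverconvergentExpansion E.R (C * ρ ^ k.natAbs) ρ (E.expansion ((t k).coeff i))

variable {E} in
theorem IsOverconvergent.smul {t : ℤ → E.S[X]} (ht : E.IsOverconvergent t) (s : E.S) :
    E.IsOverconvergent (fun k => s • t k) := by
  obtain ⟨C, ρ, hρ, h⟩ := ht
  obtain ⟨C', ρ', hρ', h'⟩ := s.2
  have hm := exists_common_rate hρ hρ'
  have hC : 0 ≤ C := by simpa using (h 0 0).nonneg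
  have := hρ.1
  refine ⟨C' * C, max ρ ρ', hm, fun k i => ?_⟩
  have h1 := (h'.mono le_rfl hρ'.1.le (le_max_right ρ ρ')).mul
    ((h k i).mono (C' := C * max ρ ρ' ^ k.natAbs)
      (by gcongr; exact le_max_left _ _) hρ.1.le (le_max_left ρ ρ')) hm.1.le
  rw [Polynomial.coeff_smul, smul_eq_mul, map_mul, mul_assoc]
  exact h1

variable {E} in
theorem IsOverconvergent.add {t t' : ℤ → E.S[X]} (ht : E.IsOverconvergent t)
    (ht' : E.IsOverconvergent t') : E.IsOverconvergent (t + t') := by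
  obtain ⟨C, ρ, hρ, h⟩ := ht
  obtain ⟨C', ρ', hρ', h'⟩ := ht'
  have hm := exists_common_rate hρ hρ'
  have hC : 0 ≤ C := by simpa using (h 0 0).nonneg
  have hC' : 0 ≤ C' := by simpa using (h' 0 0).nonneg
  have := hρ.1
  have := hρ'.1
  refine ⟨C + C', max ρ ρ', hm, fun k i => ?_⟩
  have h1 := ((h k i).mono (C' := C * max ρ ρ' ^ k.natAbs)
      (by gcongr; exact le_max_left _ _) hρ.1.le (le_max_left ρ ρ')).add
    ((h' k i).mono (C' := C' * max ρ ρ' ^ k.natAbs)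
      (by gcongr; exact le_max_right _ _) hρ'.1.le (le_max_right ρ ρ'))
  simpa [add_mul] using h1

theorem isOverconvergent_zero : E.IsOverconvergent 0 :=
  ⟨0, 1 / 2, by norm_num, fun k i => by
    simpa using HasOverconvergentExpansion.zero (R := E.R) le_rfl (by norm_num : (0:ℝ) ≤ 1 / 2)⟩

variable {E} in
theorem IsOverconvergent.shift {t : ℤ → E.S[X]} (ht : E.IsOverconvergent t) :
    E.IsOverconvergent (fun k => t (k - 2)) := by
  obtain ⟨C, ρ, hρ, h⟩ := ht
  have hC : 0 ≤ C := by simpa using (h 0 0).nonneg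
  have h0 := hρ.1
  refine ⟨C * (ρ ^ 2)⁻¹, ρ, hρ, fun k i => (h (k - 2) i).mono ?_ h0.le le_rfl⟩
  rw [mul_assoc]
  gcongr
  rw [inv_mul_eq_div, le_div_iff₀ (by positivity), ← pow_add]
  exact pow_le_pow_of_le_one h0.le hρ.2.le (by omega)

variable {E} in
theorem IsOverconvergent.coeff {t : ℤ → E.S[X]} (ht : E.IsOverconvergent t) (j : ℕ) (q : E.S[X])
    : E.IsOverconvergent (fun k => Polynomial.C ((t k).coeff j) * q) := by
  obtain ⟨C, ρ, hρ, h⟩ := ht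
  induction q using Polynomial.induction_on' with
  | add p q hp hq => simpa [mul_add] using! hp.add hq
  | monomial i c =>
    have h2 : E.IsOverconvergent (fun k => Polynomial.monomial i ((t k).coeff j)) := by
      refine ⟨C, ρ, hρ, fun k n => ?_⟩
      rw [Polynomial.coeff_monomial]
      split_ifs
      · exact h k j
      · exact HasOverconvergentExpansion.zero (h k j).nonneg hρ.1.le
    convert h2.smul c using 2 with k
    rw [Polynomial.C_mul_monomial, Polynomial.smul_monomial, smul_eq_mul, mul_comm]

/-- The `S`-module `T = K[Γ, 1 / R, X, 1 / √Q]^†` of all overconvergent series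
`∑_{k ∈ ℤ} t_k(X) / √Q ^ k` with `t_k ∈ S[X]` of degree at most `2 * g` in `X`. -/
def T : Submodule E.S (ℤ → E.S[X]) where
  carrier := {t | (∀ k, (t k).degree < (2 * E.g + 1 : ℕ)) ∧ E.IsOverconvergent t}
  add_mem' := fun ⟨h1, h2⟩ ⟨h3, h4⟩ =>
    ⟨fun k => (Polynomial.degree_add_le _ _).trans_lt (max_lt (h1 k) (h3 k)), h2.add h4⟩
  zero_mem' := ⟨fun k => by
    rw [Pi.zero_apply, Polynomial.degree_zero]; exact WithBot.bot_lt_coe _, E.isOverconvergent_zero⟩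
  smul_mem' := fun s _ ⟨h1, h2⟩ =>
    ⟨fun k => (Polynomial.degree_smul_le _ _).trans_lt (h1 k), h2.smul s⟩

/-- `∂/∂X` on formal series `∑_k t_k(X) / √Q ^ k`. As `∂(1 / √Q ^ k)/∂X = -(k / 2) Q' / √Q ^ (k + 2)`
and `t_k Q' = A_k Q + B_k` with `deg B_k < deg Q`, the numerator of the derivative at
`1 / √Q ^ k` is `t_k' - (k / 2) A_k - ((k - 2) / 2) B_{k - 2}`. -/
def deriv (t : ℤ → E.S[X]) (k : ℤ) : E.S[X] :=
  derivative (t k) - ((k : K) / 2) • ((t k * derivative E.QS) /ₘ E.QS)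
    - (((k : K) - 2) / 2) • ((t (k - 2) * derivative E.QS) %ₘ E.QS)

theorem add_divByMonic {A : Type*} [CommRing A] {q : A[X]} (hq : q.Monic) (f h : A[X]) :
    (f + h) /ₘ q = f /ₘ q + h /ₘ q := by
  nontriviality A
  refine (Polynomial.div_modByMonic_unique (f /ₘ q + h /ₘ q) (f %ₘ q + h %ₘ q) hq ⟨?_, ?_⟩).1
  · conv_rhs => rw [← Polynomial.modByMonic_add_div f q, ← Polynomial.modByMonic_add_div h q]
    ring
  · exact (Polynomial.degree_add_le _ _).trans_lt
      (max_lt (Polynomial.degree_modByMonic_lt _ hq) (Polynomial.degree_modByMonic_lt _ hq))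

theorem C_mul_divByMonic {A : Type*} [CommRing A] {q : A[X]} (hq : q.Monic) (c : A) (f : A[X]) :
    (Polynomial.C c * f) /ₘ q = Polynomial.C c * (f /ₘ q) := by
  nontriviality A
  refine (Polynomial.div_modByMonic_unique _ (Polynomial.C c * (f %ₘ q)) hq ⟨?_, ?_⟩).1
  · conv_rhs => rw [← Polynomial.modByMonic_add_div f q]
    ring
  · rw [← Polynomial.smul_eq_C_mul]
    exact (Polynomial.degree_smul_le _ _).trans_lt (Polynomial.degree_modByMonic_lt _ hq)

theorem deriv_add (t t' : ℤ → E.S[X]) : E.deriv (t + t') = E.deriv t + E.deriv t' := by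
  funext k
  simp only [deriv, Pi.add_apply, map_add, add_mul, add_divByMonic E.QS_monic,
    Polynomial.add_modByMonic, smul_add]
  ring

theorem deriv_smul (s : E.S) (t : ℤ → E.S[X]) : E.deriv (s • t) = s • E.deriv t := by
  funext k
  simp only [deriv, Pi.smul_apply, Polynomial.smul_eq_C_mul (a := s), mul_assoc,
    C_mul_divByMonic E.QS_monic]
  rw [← Polynomial.smul_eq_C_mul (a := s) (p := t (k - 2) * derivative E.QS),
    Polynomial.smul_modByMonic, Polynomial.smul_eq_C_mul]
  simp only [Polynomial.derivative_C_mul, mul_sub, mul_smul_comm]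

variable {E} in
theorem IsOverconvergent.sum {ι : Type*} (u : Finset ι) (f : ι → ℤ → E.S[X])
    (h : ∀ i ∈ u, E.IsOverconvergent (f i)) : E.IsOverconvergent (fun k => ∑ i ∈ u, f i k) := by
  classical
  induction u using Finset.induction_on with
  | empty => simpa using! E.isOverconvergent_zero
  | insert a u ha ih =>
    simp only [Finset.sum_insert ha]
    exact (h a (Finset.mem_insert_self _ _)).add
      (ih fun i hi => h i (Finset.mem_insert_of_mem hi))

/-- An `S`-linear operation on polynomials of degree at most `2 * g`, applied to every numerator,
preserves overconvergence. -/
theorem isOverconvergent_linear (L : E.S[X] →ₗ[E.S] E.S[X]) {t : ℤ → E.S[X]} (ht : t ∈ E.T) :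
    E.IsOverconvergent (fun k => L (t k)) := by
  have h : (fun k => L (t k)) = fun k => ∑ i ∈ Finset.range (2 * E.g + 1),
      Polynomial.C ((t k).coeff i) * L (Polynomial.X ^ i) := by
    funext k
    have hk : (t k).natDegree < 2 * E.g + 1 := by
      rcases eq_or_ne (t k) 0 with h0 | h0
      · simp [h0]
      · exact (Polynomial.natDegree_lt_iff_degree_lt h0).2 (ht.1 k)
    conv_lhs => rw [(t k).as_sum_range_C_mul_X_pow' hk]
    rw [map_sum]
    refine Finset.sum_congr rfl fun i _ => ?_
    rw [← Polynomial.smul_eq_C_mul, map_smul, Polynomial.smul_eq_C_mul]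
  rw [h]
  exact IsOverconvergent.sum _ _ fun i _ => ht.2.coeff i _

/-- The linear map that sends `p` to the quotient of `p Q'` by `Q`. -/
def mulDiv : E.S[X] →ₗ[E.S] E.S[X] where
  toFun p := (p * derivative E.QS) /ₘ E.QS
  map_add' p q := by rw [add_mul, add_divByMonic E.QS_monic]
  map_smul' s p := by
    rw [Polynomial.smul_eq_C_mul, mul_assoc, C_mul_divByMonic E.QS_monic,
      ← Polynomial.smul_eq_C_mul, RingHom.id_apply]

theorem degree_mulDiv_lt {p : E.S[X]} (hp : p.degree < (2 * E.g + 1 : ℕ)) :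
    (E.mulDiv p).degree < (2 * E.g + 1 : ℕ) := by
  have h1 : p.natDegree ≤ 2 * E.g := by
    rcases eq_or_ne p 0 with h0 | h0
    · simp [h0]
    · exact Nat.lt_succ_iff.1 ((Polynomial.natDegree_lt_iff_degree_lt h0).2 hp)
  have h2 : (derivative E.QS).natDegree ≤ 2 * E.g := by
    have := Polynomial.natDegree_derivative_le E.QS
    rwa [E.QS_natDegree] at this
  have h3 : (E.mulDiv p).natDegree < 2 * E.g + 1 := by
    change ((p * derivative E.QS) /ₘ E.QS).natDegree < _
    rw [Polynomial.natDegree_divByMonic _ E.QS_monic, E.QS_natDegree]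
    have := Polynomial.natDegree_mul_le (p := p) (q := derivative E.QS)
    omega
  exact Polynomial.degree_le_natDegree.trans_lt (by exact_mod_cast h3)

variable {E} in
/-- Multiplying the numerators by scalars of bounded norm preserves overconvergence. -/
theorem IsOverconvergent.scalar {t : ℤ → E.S[X]} (ht : E.IsOverconvergent t) (c : ℤ → K)
    {D : ℝ} (hc : ∀ k, ‖c k‖ ≤ D) : E.IsOverconvergent (fun k => c k • t k) := by
  obtain ⟨C, ρ, hρ, h⟩ := ht
  refine ⟨D * C, ρ, hρ, fun k i => ?_⟩
  have h0 := HasOverconvergentExpansion.X_pow (R := E.R) 0 (c k) hρ.1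
  have h1 := h0.mono (C' := D) (by simpa using hc k) hρ.1.le le_rfl
  have h2 := h1.mul (h k i) hρ.1.le
  rw [Polynomial.coeff_smul, map_smul, mul_assoc, PowerSeries.smul_eq_C_mul]
  simpa using h2

theorem norm_half_intCast_le (k : ℤ) : ‖(k : K) / 2‖ ≤ ‖(2 : K)⁻¹‖ := by
  rw [div_eq_mul_inv, norm_mul]
  exact mul_le_of_le_one_left (norm_nonneg _) (IsUltrametricDist.norm_intCast_le_one K k)

theorem deriv_mem {t : ℤ → E.S[X]} (ht : t ∈ E.T) : E.deriv t ∈ E.T := by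
  have hQ : E.QS.degree = (2 * E.g + 1 : ℕ) := by
    rw [Polynomial.degree_eq_natDegree E.QS_monic.ne_zero, E.QS_natDegree]
  refine ⟨fun k => ?_, ?_⟩
  · refine (Polynomial.degree_sub_le _ _).trans_lt (max_lt
      ((Polynomial.degree_sub_le _ _).trans_lt (max_lt ?_ ?_)) ?_)
    · exact Polynomial.degree_derivative_le.trans_lt (ht.1 k)
    · exact (Polynomial.degree_smul_le _ _).trans_lt (E.degree_mulDiv_lt (ht.1 k))
    · refine (Polynomial.degree_smul_le _ _).trans_lt ?_
      rw [← hQ]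
      exact Polynomial.degree_modByMonic_lt _ E.QS_monic
  · have h1 := E.isOverconvergent_linear (Polynomial.derivative (R := E.S)) ht
    have h2 := (E.isOverconvergent_linear E.mulDiv ht).scalar (fun k => -((k : K) / 2))
      (fun k => by rw [norm_neg]; exact norm_half_intCast_le k)
    have h3 := (E.isOverconvergent_linear
      ((Polynomial.modByMonicHom E.QS).comp
        (LinearMap.mulRight E.S (derivative E.QS))) ht).shift.scalar
      (fun k => -(((k - 2 : ℤ) : K) / 2))
      (fun k => by rw [norm_neg]; exact norm_half_intCast_le (k - 2))
    convert (h1.add h2).add h3 using 1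
    funext k
    simp [deriv, mulDiv, sub_eq_add_neg]

/-- The differential `d = ∂/∂X dX : T → T dX`. Here `T dX` is identified with `T`. -/
def d : E.T →ₗ[E.S] E.T where
  toFun t := ⟨E.deriv t, E.deriv_mem t.2⟩
  map_add' t t' := Subtype.ext (E.deriv_add t t')
  map_smul' s t := Subtype.ext (E.deriv_smul s t)

/-- The cohomology module `T dX / dT`. -/
abbrev Cohomology : Type _ := E.T ⧸ LinearMap.range E.d

theorem single_mem (i : Fin (2 * E.g + 1)) (k : ℤ) :
    (Pi.single k (Polynomial.X ^ (i : ℕ)) : ℤ → E.S[X]) ∈ E.T := by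
  refine ⟨fun l => ?_, 2 ^ k.natAbs, 1 / 2, by norm_num, fun l n => ?_⟩
  · rcases eq_or_ne l k with rfl | h
    · rw [Pi.single_eq_same]
      exact (Polynomial.degree_X_pow_le _).trans_lt (by exact_mod_cast i.2)
    · rw [Pi.single_eq_of_ne h, Polynomial.degree_zero]
      exact WithBot.bot_lt_coe _
  · have h0 : HasOverconvergentExpansion E.R (2 ^ k.natAbs * (1 / 2) ^ l.natAbs) (1 / 2) 0 :=
      HasOverconvergentExpansion.zero (by positivity) (by norm_num)
    rcases eq_or_ne l k with rfl | h
    · rw [Pi.single_eq_same, Polynomial.coeff_X_pow]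
      split_ifs
      · have h1 := HasOverconvergentExpansion.X_pow (R := E.R) 0 (1 : K)
          (by norm_num : (0 : ℝ) < 1 / 2)
        have h2 : (2 : ℝ) ^ l.natAbs * (1 / 2) ^ l.natAbs = 1 := by
          rw [← mul_pow]; norm_num
        rw [h2]
        simpa using h1
      · simpa using h0
    · simpa [Pi.single_eq_of_ne h] using h0

/-- The series `X ^ i / √Q ^ k`, or the form `X ^ i dX / √Q ^ k`, for `i ≤ 2 * g`. -/
def monomialForm (i : Fin (2 * E.g + 1)) (k : ℤ) : E.T :=
  ⟨Pi.single k (Polynomial.X ^ (i : ℕ)), E.single_mem i k⟩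

/-- The class in `T dX / dT` of the form `X ^ i dX / √Q ^ k`, for `i ≤ 2 * g`. -/
def cohomologyClass (i : Fin (2 * E.g + 1)) (k : ℤ) : E.Cohomology :=
  Submodule.Quotient.mk (E.monomialForm i k)

end HyperellipticFamily

end

/-! The ring `S` embeds in `K⟦Γ⟧`, and everything is computed there. The derivative of f/√Q^k splits
into a head over √Q^k and a tail over √Q^(k+2). A series is called basic if it is a combination of
the forms in the theorem.

Algebra. Each X^i dX/√Q^k is basic up to the derivative of a finite sum `τ k i` (`IsReduction`). If
k ≤ 1 is even, the form is a polynomial and is integrated outright. If k ≤ 1 is odd, the form is H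
dX/√Q with H a polynomial. Its primitive is expanded at infinity, where half-integral exponents
exclude a logarithm; the polynomial part of primitive/√Q, multiplied by √Q, has a derivative that
leaves only degrees below 2g. If k ≥ 3, a Bezout relation U Q + V Q' = r lowers the order of the
pole by two at a time.

Analysis. Sums over k converge because `τ k i` grows subexponentially: for every μ > 1 it is bounded
by C μ^|k| at all rates ρ close enough to 1 (`exists_reductions`). The arithmetic input is |2| = 1
and |1/n| ≤ n. For k ≤ 1 one uses a Gauss norm weighted in X for which division by Q costs nothing.
For k ≥ 3 the naive recursion multiplies denominators. Over the integral power series in Γ, however,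
r is a unit, and by `exists_horizontal_lift` numerators can be chosen with derivative divisible by a
high power of Q. The denominators then occur only one at a time, and the growth is linear in k
(`exists_bounded_primitive`). This primitive is not visibly overconvergent, but a recursion shows
that r^(j+1) times its j-th digit in base Q is a polynomial in Γ of degree linear in j. The size
from one argument, the degree from the other, and 1/r having norm near 1 (`exists_rate_inv`) give
the bound.

Conclusion. Summing reductions shows that the basic forms span (`exists_isBasic_sub_d`). For
independence, let dt be basic. For finite sums, comparing extreme terms gives dt = 0
(`seriesDeriv_eq_zero`). Hence the remainder of a form after reduction is well defined, and head and
tail of a single term have opposite remainders. Summing remainders over all terms of t gives dt = 0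
in general (`seriesDeriv_eq_zero_of_hasDecay`). -/

noncomputable section

set_option linter.unusedSectionVars false

namespace Polynomial

/-! ### Expansion of polynomials in base q. -/

section Digits

variable {A : Type*} [CommRing A] (q : A[X])

/-- Division by `q` as a linear map. -/
def divByMonicHom : A[X] →ₗ[A] A[X] where
  toFun p := p /ₘ q
  map_add' p p' := by
    by_cases hq : q.Monic
    · exact HyperellipticFamily.add_divByMonic hq p p'
    · simp [divByMonic_eq_of_not_monic _ hq]
  map_smul' c p := by
    by_cases hq : q.Monic
    · simp only [smul_eq_C_mul, RingHom.id_apply]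
      exact HyperellipticFamily.C_mul_divByMonic hq c p
    · simp [divByMonic_eq_of_not_monic _ hq]

@[simp] theorem divByMonicHom_apply (p : A[X]) : divByMonicHom q p = p /ₘ q := rfl

/-- The `j`-th digit of a polynomial in base `q`. -/
def digit : ℕ → A[X] →ₗ[A] A[X]
  | 0 => modByMonicHom q
  | j + 1 => (digit j).comp (divByMonicHom q)

@[simp] theorem digit_zero (F : A[X]) : digit q 0 F = F %ₘ q := rfl

@[simp] theorem digit_succ (j : ℕ) (F : A[X]) : digit q (j + 1) F = digit q j (F /ₘ q) := rfl

variable {q}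

theorem degree_digit_lt [Nontrivial A] (hq : q.Monic) (j : ℕ) (F : A[X]) :
    (digit q j F).degree < q.degree := by
  induction j generalizing F with
  | zero => exact degree_modByMonic_lt F hq
  | succ j ih => exact ih _

theorem digit_zero_of_degree_lt (hq : q.Monic) {f : A[X]} (hf : f.degree < q.degree) :
    digit q 0 f = f := by
  nontriviality A
  exact (modByMonic_eq_self_iff hq).2 hf

theorem digit_succ_of_degree_lt (hq : q.Monic) {f : A[X]} (hf : f.degree < q.degree) (j : ℕ) :
    digit q (j + 1) f = 0 := by
  nontriviality A
  rw [digit_succ, (divByMonic_eq_zero_iff hq).2 hf, map_zero]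

theorem digit_eq_zero (hq : q.Monic) {F : A[X]} {j : ℕ} (hF : F.degree < (j * q.natDegree : ℕ)) :
    digit q j F = 0 := by
  nontriviality A
  induction j generalizing F with
  | zero =>
    have : F = 0 := by
      rw [← degree_eq_bot, ← Nat.WithBot.lt_zero_iff]; simpa using hF
    simp [this]
  | succ j ih =>
    rw [digit_succ]
    by_cases h0 : F /ₘ q = 0
    · rw [h0, map_zero]
    apply ih
    have hF0 : F ≠ 0 := fun h => h0 (by rw [h, zero_divByMonic])
    rw [← natDegree_lt_iff_degree_lt h0]
    rw [← natDegree_lt_iff_degree_lt hF0] at hF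
    have hle : q.natDegree ≤ F.natDegree := by
      by_contra h
      exact h0 ((divByMonic_eq_zero_iff hq).2 (degree_lt_degree (not_le.1 h)))
    rw [natDegree_divByMonic _ hq]
    have : (j + 1) * q.natDegree = j * q.natDegree + q.natDegree := by ring
    omega

theorem digit_pow_mul (hq : q.Monic) {f : A[X]} (hf : f.degree < q.degree) (m j : ℕ) :
    digit q j (q ^ m * f) = if j = m then f else 0 := by
  induction m generalizing j with
  | zero =>
    cases j with
    | zero => simpa using! digit_zero_of_degree_lt hq hf
    | succ j => simpa using! digit_succ_of_degree_lt hq hf j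
  | succ m ih =>
    rw [pow_succ', mul_assoc]
    cases j with
    | zero => simp [self_mul_modByMonic hq]
    | succ j => rw [digit_succ, mul_divByMonic_cancel_left _ hq, ih]; simp

/-- Division by a monic polynomial commutes with base change. In particular the digits of an
integral polynomial are integral. -/
theorem map_digit {B : Type*} [CommRing B] (hq : q.Monic) (φ : A →+* B) (j : ℕ) (F : A[X]) :
    (digit q j F).map φ = digit (q.map φ) j (F.map φ) := by
  induction j generalizing F with
  | zero => exact map_modByMonic φ hq
  | succ j ih => rw [digit_succ, ih, digit_succ, map_divByMonic φ hq]

end Digits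

/-! ### Head and tail of the derivative of f/√q^c. -/

section DerivParts

variable {K : Type*} [Field K] {A : Type*} [CommRing A] [Algebra K A] (q : A[X])

/-- The numerator over `√q ^ c` of the derivative of `f / √q ^ c`. -/
def derivHead (c : K) : A[X] →ₗ[A] A[X] :=
  derivative - (c / 2) • (divByMonicHom q).comp (LinearMap.mulRight A (derivative q))

/-- The numerator over `√q ^ (c + 2)` of the derivative of `f / √q ^ c`. -/
def derivTail (c : K) : A[X] →ₗ[A] A[X] :=
  -(c / 2) • (modByMonicHom q).comp (LinearMap.mulRight A (derivative q))

theorem derivHead_apply (c : K) (f : A[X]) :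
    derivHead q c f = derivative f - (c / 2) • ((f * derivative q) /ₘ q) := rfl

theorem derivTail_apply (c : K) (f : A[X]) :
    derivTail q c f = -(c / 2) • ((f * derivative q) %ₘ q) := rfl

/-- The numerator over `√q ^ (c + 2)` of the derivative of `F / √q ^ c`, before division by `q`. -/
def derivNumerator (c : K) (F : A[X]) : A[X] :=
  derivative F * q - (c / 2) • (F * derivative q)

theorem derivNumerator_add (c : K) (F G : A[X]) :
    derivNumerator q c (F + G) = derivNumerator q c F + derivNumerator q c G := by
  simp only [derivNumerator, map_add, add_mul, smul_add]; ring

/-- Both sides are numerators of the derivative of qF/√q^c = F/√q^(c-2). -/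
theorem derivNumerator_self_mul [CharZero K] (c : K) (F : A[X]) :
    derivNumerator q c (q * F) = q * derivNumerator q (c - 2) F := by
  simp only [derivNumerator, derivative_mul, Algebra.smul_def]
  have h : algebraMap K A[X] (c / 2) = algebraMap K A[X] ((c - 2) / 2) + 1 := by
    rw [← map_one (algebraMap K A[X]), ← map_add]; congr 1; ring
  rw [h]; ring

variable {q}

theorem degree_derivative_lt_of_pos {f : A[X]} {n : ℕ} (hf : f.degree < (n + 1 : ℕ)) :
    (derivative f).degree < n := by
  rcases eq_or_ne f 0 with rfl | h0
  · simp
  rcases eq_or_ne (derivative f) 0 with h1 | h1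
  · rw [h1, degree_zero]; exact WithBot.bot_lt_coe n
  rw [← natDegree_lt_iff_degree_lt h1]
  rw [← natDegree_lt_iff_degree_lt h0] at hf
  have h2 : f.natDegree ≠ 0 := fun h => h1 (derivative_of_natDegree_zero h)
  have := natDegree_derivative_lt h2
  omega

theorem degree_mul_derivative_div_lt (hq : q.Monic) {f : A[X]} {n : ℕ} (hn : q.natDegree = n + 1)
    (hf : f.degree < (n + 1 : ℕ)) :
    ((f * derivative q) /ₘ q).degree < n := by
  nontriviality A
  by_cases h0 : (f * derivative q) /ₘ q = 0
  · rw [h0, degree_zero]; exact WithBot.bot_lt_coe n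
  have hf0 : f ≠ 0 := fun h => h0 (by rw [h, zero_mul, zero_divByMonic])
  have hle : q.natDegree ≤ (f * derivative q).natDegree := by
    by_contra h
    exact h0 ((divByMonic_eq_zero_iff hq).2 (degree_lt_degree (not_le.1 h)))
  rw [← natDegree_lt_iff_degree_lt h0, natDegree_divByMonic _ hq]
  rw [← natDegree_lt_iff_degree_lt hf0] at hf
  have h1 := natDegree_mul_le (p := f) (q := derivative q)
  have h2 := natDegree_derivative_le q
  omega

/-- Heads never reach degree 2g. The coefficient of X^(2g) in a derivative therefore comes from
tails alone, which is why X^(2g)/√q can be removed from the list of basic forms. -/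
theorem degree_derivHead_lt (hq : q.Monic) {n : ℕ} (hn : q.natDegree = n + 1) (c : K) {f : A[X]}
    (hf : f.degree < (n + 1 : ℕ)) : (derivHead q c f).degree < n := by
  rw [derivHead_apply]
  refine (degree_sub_le _ _).trans_lt (max_lt (degree_derivative_lt_of_pos hf) ?_)
  exact (degree_smul_le _ _).trans_lt (degree_mul_derivative_div_lt hq hn hf)

theorem degree_derivTail_lt [Nontrivial A] (hq : q.Monic) (c : K) (f : A[X]) :
    (derivTail q c f).degree < q.degree := by
  rw [derivTail_apply]
  exact (degree_smul_le _ _).trans_lt (degree_modByMonic_lt _ hq)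

theorem derivNumerator_modByMonic (hq : q.Monic) (c : K) (F : A[X]) :
    derivNumerator q c F %ₘ q = derivTail q c (F %ₘ q) := by
  have h1 : derivNumerator q c F %ₘ q = -(c / 2) • ((F * derivative q) %ₘ q) := by
    rw [derivNumerator, sub_modByMonic, mul_comm, self_mul_modByMonic hq, zero_sub]
    rw [← algebraMap_smul A (c / 2), smul_modByMonic, algebraMap_smul, neg_smul]
  rw [h1, derivTail_apply]
  congr 1
  apply modByMonic_eq_of_dvd_sub hq
  obtain ⟨z, hz⟩ := dvd_modByMonic_sub F q
  exact ⟨-z * derivative q, by linear_combination (-derivative q) * hz⟩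

theorem derivNumerator_divByMonic [CharZero K] (hq : q.Monic) (c : K) (F : A[X]) :
    derivNumerator q c F /ₘ q =
      derivHead q c (F %ₘ q) + derivNumerator q (c - 2) (F /ₘ q) := by
  have h0 := modByMonic_add_div F q
  set f := F %ₘ q
  set G := F /ₘ q
  have h1 : derivNumerator q c F = q * (derivative f + derivNumerator q (c - 2) G) +
      -(c / 2) • (f * derivative q) := by
    rw [← h0, derivNumerator_add, derivNumerator_self_mul, derivNumerator, neg_smul]; ring
  rw [h1, HyperellipticFamily.add_divByMonic hq, mul_divByMonic_cancel_left _ hq,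
    derivHead_apply]
  have h2 : (-(c / 2) • (f * derivative q)) /ₘ q = -(c / 2) • ((f * derivative q) /ₘ q) := by
    rw [← algebraMap_smul A (-(c / 2)), ← divByMonicHom_apply, map_smul, algebraMap_smul]; rfl
  rw [h2, neg_smul]; ring

theorem digit_zero_derivNumerator (hq : q.Monic) (c : K) (F : A[X]) :
    digit q 0 (derivNumerator q c F) = derivTail q c (digit q 0 F) :=
  derivNumerator_modByMonic hq c F

/-- Expanding F/√q^c in base q and differentiating termwise gives the expansion of the derivative:
the j-th digit sits over √q^(c-2j), and each place receives one head and one tail. -/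
theorem digit_succ_derivNumerator [CharZero K] (hq : q.Monic) (c : K) (F : A[X]) (j : ℕ) :
    digit q (j + 1) (derivNumerator q c F) =
      derivHead q (c - 2 * j) (digit q j F) + derivTail q (c - 2 * j - 2) (digit q (j + 1) F) := by
  nontriviality A
  have hdeg : ∀ (c : K) (f : A[X]), f.degree < q.degree → (derivHead q c f).degree < q.degree := by
    intro c f hf
    rcases hn : q.natDegree with _ | n
    · have hq1 : q = 1 := eq_one_of_monic_natDegree_zero hq hn
      have hf0 : f = 0 := by
        rw [hq1, degree_one] at hf
        rw [← degree_eq_bot, ← Nat.WithBot.lt_zero_iff]; exact hf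
      rw [hf0, map_zero, degree_zero, degree_eq_natDegree hq.ne_zero]
      exact WithBot.bot_lt_coe _
    · rw [degree_eq_natDegree hq.ne_zero, hn] at hf ⊢
      refine (degree_derivHead_lt hq hn c hf).trans ?_
      exact_mod_cast Nat.lt_succ_self n
  induction j generalizing F c with
  | zero =>
    rw [digit_succ, derivNumerator_divByMonic hq, map_add, digit_zero_derivNumerator hq,
      digit_zero_of_degree_lt hq (hdeg _ _ (degree_modByMonic_lt _ hq))]
    simp
  | succ j ih =>
    rw [digit_succ, derivNumerator_divByMonic hq, map_add,
      digit_succ_of_degree_lt hq (hdeg _ _ (degree_modByMonic_lt _ hq)), zero_add, ih]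
    simp only [digit_succ]
    push_cast
    ring_nf

theorem map_algebraMap_smul {B : Type*} [CommRing B] [Algebra K B] (φ : A →ₐ[K] B) (c : K)
    (f : A[X]) : (c • f).map (φ : A →+* B) = c • f.map (φ : A →+* B) := by
  ext n; simp

theorem map_derivHead {B : Type*} [CommRing B] [Algebra K B] (hq : q.Monic) (φ : A →ₐ[K] B)
    (c : K) (f : A[X]) :
    (derivHead q c f).map (φ : A →+* B) =
      derivHead (q.map (φ : A →+* B)) c (f.map (φ : A →+* B)) := by
  rw [derivHead_apply, derivHead_apply, Polynomial.map_sub, map_algebraMap_smul,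
    map_divByMonic _ hq, Polynomial.map_mul, derivative_map, derivative_map]

theorem map_derivTail {B : Type*} [CommRing B] [Algebra K B] (hq : q.Monic) (φ : A →ₐ[K] B)
    (c : K) (f : A[X]) :
    (derivTail q c f).map (φ : A →+* B) =
      derivTail (q.map (φ : A →+* B)) c (f.map (φ : A →+* B)) := by
  rw [derivTail_apply, derivTail_apply, map_algebraMap_smul,
    map_modByMonic _ hq, Polynomial.map_mul, derivative_map]

/-- `derivTail` is inverted by multiplication with an inverse of `q'` modulo `q`. -/
theorem modByMonic_mul_derivTail (hq : q.Monic) {U V : A[X]} {r : A}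
    (h : U * q + V * derivative q = C r) (c : K) {f : A[X]} (hf : f.degree < q.degree) :
    (V * derivTail q c f) %ₘ q = (-(c / 2)) • (r • f) := by
  nontriviality A
  have h1 : (V * ((f * derivative q) %ₘ q)) %ₘ q = r • f := by
    have h2 : r • f = (r • f) %ₘ q := by
      rw [smul_modByMonic, (modByMonic_eq_self_iff hq).2 hf]
    rw [h2]
    apply modByMonic_eq_of_dvd_sub hq
    obtain ⟨z, hz⟩ := dvd_modByMonic_sub (f * derivative q) q
    refine ⟨V * z - f * U, ?_⟩
    rw [smul_eq_C_mul, ← h]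
    linear_combination V * hz
  rw [derivTail_apply, mul_smul_comm, ← algebraMap_smul A (-(c / 2)), smul_modByMonic, h1,
    algebraMap_smul]

end DerivParts

/-! ### Lifts with nearly vanishing derivative, and primitives with simple denominators. -/

section HorizontalLift

variable {A : Type*} [CommRing A] {q U V : A[X]}

/-- If `q'` is invertible modulo `q`, then `X` can be corrected modulo `q` to a root of `q` modulo
any power of `q`. -/
theorem exists_root_mod_pow (h : U * q + V * derivative q = 1) (m : ℕ) :
    ∃ α : A[X], q ∣ α - X ∧ q ^ (m + 1) ∣ q.comp α := by
  induction m with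
  | zero => exact ⟨X, by simp, by simp⟩
  | succ m ih =>
    obtain ⟨α, h1, h2⟩ := ih
    have hq : q ∣ q.comp α := (dvd_pow_self q (Nat.succ_ne_zero m)).trans h2
    -- Newton correction, with V(α) in the role of 1/q'(α): the constant and linear terms combine to
    -- U(α) q(α)^2, which gains a factor q.
    set y := -(q.comp α * V.comp α) with hy
    obtain ⟨k, hk⟩ := (q.map C).binomExpansion α y
    simp only [eval_map, derivative_map] at hk
    change q.comp (α + y) = q.comp α + (derivative q).comp α * y + k * y ^ 2 at hk
    have h3 : U.comp α * q.comp α + V.comp α * (derivative q).comp α = 1 := by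
      rw [← mul_comp, ← mul_comp, ← add_comp, h, one_comp]
    refine ⟨α + y, ?_, ?_⟩
    · have : α + y - X = (α - X) + -(q.comp α * V.comp α) := by rw [hy]; ring
      rw [this]
      exact dvd_add h1 ((hq.mul_right _).neg_right)
    · have h4 : q.comp (α + y) = q.comp α * (q.comp α * (U.comp α + k * V.comp α ^ 2)) := by
        rw [hk, hy]
        linear_combination (-q.comp α) * h3
      rw [h4, pow_succ]
      exact mul_dvd_mul h2 (hq.mul_right _)

/-- Differentiating q(α) shows that q^m divides q'(α) α', and V(α) inverts q'(α) modulo q(α). -/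
theorem pow_dvd_derivative_of_root (h : U * q + V * derivative q = 1) {m : ℕ} {α : A[X]}
    (h1 : q ^ (m + 1) ∣ q.comp α) : q ^ m ∣ derivative α := by
  have h2 : q ^ m ∣ derivative (q.comp α) := by
    obtain ⟨z, hz⟩ := h1
    rw [hz, derivative_mul, derivative_pow_succ]
    refine dvd_add ?_ ?_
    · exact ((dvd_mul_left _ _).mul_right _).mul_right _
    · exact (pow_dvd_pow q (Nat.le_succ m)).mul_right _
  have h3 : U.comp α * q.comp α + V.comp α * (derivative q).comp α = 1 := by
    rw [← mul_comp, ← mul_comp, ← add_comp, h, one_comp]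
  rw [derivative_comp] at h2
  have h4 : derivative α = derivative α * U.comp α * q.comp α +
      V.comp α * (derivative α * (derivative q).comp α) := by
    linear_combination (-derivative α) * h3
  rw [h4]
  exact dvd_add (((pow_dvd_pow q (Nat.le_succ m)).trans h1).mul_left _) (h2.mul_left _)

/-- Every polynomial is congruent modulo `q` to one with derivative divisible by `q ^ m`. -/
theorem exists_horizontal_lift (h : U * q + V * derivative q = 1) (m : ℕ) (a : A[X]) :
    ∃ b : A[X], q ∣ b - a ∧ q ^ m ∣ derivative b := by
  obtain ⟨α, h1, h2⟩ := exists_root_mod_pow h m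
  refine ⟨a.comp α, ?_, ?_⟩
  · have h3 := (a.map C).sub_dvd_eval_sub α X
    simp only [eval_map] at h3
    change α - X ∣ a.comp α - a.comp X at h3
    rw [comp_X] at h3
    exact h1.trans h3
  · rw [derivative_comp]
    exact (pow_dvd_derivative_of_root h h2).mul_right _

variable {K : Type*} [Field K] [CharZero K] {B : Type*} [CommRing B] [Algebra K B]

/-- Reduction of the pole order, with control of the denominators. -/
theorem exists_primitive_of_pole (h : U * q + V * derivative q = 1) (φ : A →+* B) (e : ℕ)
    (he : e = 1 ∨ e = 2) (n : ℕ) (W : A[X]) :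
    ∃ (b : ℕ → A[X]) (G : B[X]), W.map φ = derivNumerator (q.map φ) ((2 * n + e : ℕ) - 2 : K)
      (∑ j ∈ Finset.range n, (2 / ((2 * n + e : ℕ) - 2 - 2 * j : K)) • (b j).map φ)
      + (q.map φ) ^ n * G := by
  induction n generalizing W with
  | zero => exact ⟨0, W.map φ, by simp [derivNumerator]⟩
  | succ n ih =>
    -- The numerator of the derivative of (2/c) a/√q^c is (2/c) a' q - a q'. The part with the
    -- denominator c is divisible by q^(n+2) and disappears into the error term. Hence the next
    -- numerator W₁ is again defined over `A`, and denominators never multiply.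
    obtain ⟨a, ha1, ha2⟩ := exists_horizontal_lift h (n + 1) (-(V * W))
    set c : K := ((2 * (n + 1) + e : ℕ) - 2 : K) with hc
    have hc0 : c ≠ 0 := by
      rw [hc]; push_cast
      have : (2 * ((n : K) + 1) + e - 2) = ((2 * n + e : ℕ) : K) := by push_cast; ring
      rw [this, Nat.cast_ne_zero]; omega
    have hW : q ∣ W + a * derivative q := by
      obtain ⟨z, hz⟩ := ha1
      refine ⟨W * U + derivative q * z, ?_⟩
      linear_combination (-W) * h + derivative q * hz
    obtain ⟨W₁, hW₁⟩ := hW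
    obtain ⟨z, hz⟩ := ha2
    obtain ⟨b, G, hG⟩ := ih W₁
    refine ⟨fun j => match j with | 0 => a | j + 1 => q * b j,
      G - (2 / c) • (q.map φ * z.map φ), ?_⟩
    rw [Finset.sum_range_succ']
    have h1 : ∑ k ∈ Finset.range n, (2 / (c - 2 * (k + 1 : ℕ))) • (q * b k).map φ =
        q.map φ * ∑ j ∈ Finset.range n, (2 / ((2 * n + e : ℕ) - 2 - 2 * j : K)) • (b j).map φ := by
      rw [Finset.mul_sum]
      refine Finset.sum_congr rfl fun j _ => ?_
      rw [Polynomial.map_mul, mul_smul_comm]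
      congr 2
      rw [hc]; push_cast; ring
    simp only []
    rw [h1, derivNumerator_add, derivNumerator_self_mul]
    have h2 : c - 2 = ((2 * n + e : ℕ) - 2 : K) := by rw [hc]; push_cast; ring
    rw [h2]
    have h3 : derivNumerator (q.map φ) c ((2 / (c - 2 * (0 : ℕ))) • a.map φ) =
        (2 / c) • (q.map φ * (q.map φ ^ (n + 1) * z.map φ)) - (a * derivative q).map φ := by
      rw [derivNumerator]
      have h4 : derivative (a.map φ) = q.map φ ^ (n + 1) * z.map φ := by
        rw [derivative_map, hz, Polynomial.map_mul, Polynomial.map_pow]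
      rw [Nat.cast_zero, mul_zero, sub_zero, derivative_smul, h4, smul_mul_assoc, smul_mul_assoc,
        smul_smul,
        show c / 2 * (2 / c) = 1 by field_simp, one_smul, Polynomial.map_mul,
        derivative_map, mul_comm (q.map φ)]
    rw [h3]
    have h5 : W = q * W₁ - a * derivative q := by rw [← hW₁]; ring
    rw [h5, Polynomial.map_sub, Polynomial.map_mul, hG]
    simp only [Algebra.smul_def]
    ring

end HorizontalLift

end Polynomial

/-! ### Estimates for overconvergent expansions. -/

section Expansions

variable {K : Type*} [NormedField K] [IsUltrametricDist K]

/-- The coefficients of `s` have norm at most `C`. -/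
def PowerSeries.CoeffBound (C : ℝ) (s : PowerSeries K) : Prop :=
  ∀ n, ‖PowerSeries.coeff n s‖ ≤ C

namespace PowerSeries.CoeffBound

variable {C C' : ℝ} {s s' : PowerSeries K}

theorem nonneg (h : CoeffBound C s) : 0 ≤ C := (norm_nonneg _).trans (h 0)

theorem zero (hC : 0 ≤ C) : CoeffBound C (0 : PowerSeries K) := fun n => by simpa using hC

theorem add (h : CoeffBound C s) (h' : CoeffBound C s') : CoeffBound C (s + s') := fun n => by
  rw [map_add]
  exact (IsUltrametricDist.norm_add_le_max _ _).trans (max_le (h n) (h' n))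

theorem mono (h : CoeffBound C s) (hC : C ≤ C') : CoeffBound C' s := fun n => (h n).trans hC

theorem mul (h : CoeffBound C s) (h' : CoeffBound C' s') : CoeffBound (C * C') (s * s') :=
  fun n => by
  rw [PowerSeries.coeff_mul]
  refine IsUltrametricDist.norm_sum_le_of_forall_le_of_nonneg (mul_nonneg h.nonneg h'.nonneg)
    fun x _ => ?_
  rw [norm_mul]
  exact mul_le_mul (h _) (h' _) (norm_nonneg _) h.nonneg

theorem smul (h : CoeffBound C s) (c : K) : CoeffBound (‖c‖ * C) (c • s) := fun n => by
  rw [map_smul, norm_smul]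
  exact mul_le_mul_of_nonneg_left (h n) (norm_nonneg c)

theorem sum {ι : Type*} (u : Finset ι) {f : ι → PowerSeries K} (hC : 0 ≤ C)
    (h : ∀ i ∈ u, CoeffBound C (f i)) : CoeffBound C (∑ i ∈ u, f i) := by
  classical
  induction u using Finset.induction_on with
  | empty => simpa using zero hC
  | insert a u ha ih =>
    rw [Finset.sum_insert ha]
    exact (h a (Finset.mem_insert_self _ _)).add
      (ih fun i hi => h i (Finset.mem_insert_of_mem hi))

theorem one : CoeffBound 1 (1 : PowerSeries K) := fun n => by
  rw [PowerSeries.coeff_one]; split_ifs <;> simp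

theorem X : CoeffBound 1 (PowerSeries.X : PowerSeries K) := fun n => by
  rw [PowerSeries.coeff_X]; split_ifs <;> simp

theorem pow (h : CoeffBound 1 s) (n : ℕ) : CoeffBound 1 (s ^ n) := by
  induction n with
  | zero => simpa using one
  | succ n ih => simpa [pow_succ] using ih.mul h

theorem inv (h : CoeffBound 1 s) (h0 : ‖PowerSeries.constantCoeff s‖ = 1) :
    CoeffBound 1 s⁻¹ := by
  intro n
  induction n using Nat.strong_induction_on with
  | _ n ih =>
    rw [PowerSeries.coeff_inv]
    split_ifs with hn
    · rw [norm_inv, h0, inv_one]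
    · rw [norm_mul, norm_neg, norm_inv, h0, inv_one, one_mul]
      refine IsUltrametricDist.norm_sum_le_of_forall_le_of_nonneg zero_le_one fun x _ => ?_
      split_ifs with hx
      · rw [norm_mul]
        exact mul_le_one₀ (h _) (norm_nonneg _) (ih _ hx)
      · simp

end PowerSeries.CoeffBound

namespace HasOverconvergentExpansion

variable {R : K[X]} {C C' ρ : ℝ} {s s' : PowerSeries K}

theorem add_same (h : HasOverconvergentExpansion R C ρ s)
    (h' : HasOverconvergentExpansion R C ρ s') : HasOverconvergentExpansion R C ρ (s + s') := by
  obtain ⟨a, ha, hs⟩ := h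
  obtain ⟨b, hb, hs'⟩ := h'
  refine ⟨a + b, fun m => ?_, fun n => ?_⟩
  · exact (IsUltrametricDist.norm_add_le_max _ _).trans (max_le (ha m) (hb m))
  · simpa [add_mul] using (hs n).add (hs' n)

theorem sum {ι : Type*} (u : Finset ι) {f : ι → PowerSeries K} (hC : 0 ≤ C) (h0 : 0 ≤ ρ)
    (h : ∀ i ∈ u, HasOverconvergentExpansion R C ρ (f i)) :
    HasOverconvergentExpansion R C ρ (∑ i ∈ u, f i) := by
  classical
  induction u using Finset.induction_on with
  | empty => simpa using HasOverconvergentExpansion.zero hC h0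
  | insert a u ha ih =>
    rw [Finset.sum_insert ha]
    exact (h a (Finset.mem_insert_self _ _)).add_same
      (ih fun i hi => h i (Finset.mem_insert_of_mem hi))

theorem smul (h : HasOverconvergentExpansion R C ρ s) (c : K) :
    HasOverconvergentExpansion R (‖c‖ * C) ρ (c • s) := by
  obtain ⟨a, ha, hs⟩ := h
  refine ⟨fun m => c * a m, fun m => ?_, fun n => ?_⟩
  · rw [norm_mul, mul_assoc]
    exact mul_le_mul_of_nonneg_left (ha m) (norm_nonneg c)
  · simpa [mul_assoc] using (hs n).mul_left c

theorem neg (h : HasOverconvergentExpansion R C ρ s) :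
    HasOverconvergentExpansion R C ρ (-s) := by
  simpa using h.smul (-1)

theorem sub_same (h : HasOverconvergentExpansion R C ρ s)
    (h' : HasOverconvergentExpansion R C ρ s') : HasOverconvergentExpansion R C ρ (s - s') := by
  rw [sub_eq_add_neg]; exact h.add_same h'.neg

theorem mono_const (h : HasOverconvergentExpansion R C ρ s) (hC : C ≤ C') (h0 : 0 ≤ ρ) :
    HasOverconvergentExpansion R C' ρ s := h.mono hC h0 le_rfl

theorem one (h0 : 0 < ρ) : HasOverconvergentExpansion R 1 ρ (1 : PowerSeries K) := by
  simpa using X_pow (R := R) (ρ := ρ) 0 (1 : K) h0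

theorem pow (h : HasOverconvergentExpansion R C ρ s) (h0 : 0 < ρ) (n : ℕ) :
    HasOverconvergentExpansion R (C ^ n) ρ (s ^ n) := by
  induction n with
  | zero => simpa using one h0
  | succ n ih => simpa [pow_succ] using ih.mul h h0.le

/-- At rate ρ the monomial Γ^i costs ρ^(-i). A bound on the degree and one on the coefficients thus
give a bound that is harmless as ρ tends to 1. -/
theorem coe_of_natDegree_le {p : K[X]} {n : ℕ} (hp : p.natDegree ≤ n)
    (hc : ∀ i, ‖p.coeff i‖ ≤ C) (h0 : 0 < ρ) (h1 : ρ ≤ 1) :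
    HasOverconvergentExpansion R (C * (ρ⁻¹) ^ n) ρ (p : PowerSeries K) := by
  have hC : 0 ≤ C := (norm_nonneg _).trans (hc 0)
  have hp' : (p : PowerSeries K) = ∑ i ∈ Finset.range (n + 1),
      PowerSeries.C (p.coeff i) * PowerSeries.X ^ i := by
    conv_lhs => rw [p.as_sum_range_C_mul_X_pow' (Nat.lt_succ_of_le hp)]
    rw [← Polynomial.coeToPowerSeries.ringHom_apply, map_sum]
    simp [Polynomial.coeToPowerSeries.ringHom_apply]
  rw [hp']
  refine sum _ (by positivity) h0.le fun i hi => ?_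
  refine (X_pow i (p.coeff i) h0).mono_const ?_ h0.le
  rw [div_eq_mul_inv, ← inv_pow]
  have h2 : 1 ≤ ρ⁻¹ := (one_le_inv₀ h0).2 h1
  have h3 : i ≤ n := by simpa [Nat.lt_succ_iff] using hi
  gcongr
  exact hc i

section Complete

variable [CompleteSpace K]

open scoped PowerSeries.WithPiTopology

-- Fubini for the absolutely summable double family `a i m * e m`. It is applied with `e m` a
-- coefficient of Γ^a/R^b, which is integral because R(0) is a unit.
omit [IsUltrametricDist K] in
theorem hasSum_tsum_mul {ι κ : Type*} {e : κ → K} (he : ∀ m, ‖e m‖ ≤ 1) {f : ι → K}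
    {B : ι → ℝ} {D : κ → ℝ} (hB : Summable B) (hD : Summable D) (hB0 : ∀ i, 0 ≤ B i)
    (hD0 : ∀ i, 0 ≤ D i) {a : ι → κ → K} (ha : ∀ i m, ‖a i m‖ ≤ B i * D m)
    (hs : ∀ i, HasSum (fun m => a i m * e m) (f i)) :
    Summable f ∧ HasSum (fun m => (∑' i, a i m) * e m) (∑' i, f i) := by
  have hprod : Summable fun x : ι × κ => B x.1 * D x.2 := hB.mul_of_nonneg hD hB0 hD0
  have hsum : Summable fun x : ι × κ => a x.1 x.2 * e x.2 := by
    refine Summable.of_norm_bounded hprod fun x => ?_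
    rw [norm_mul]
    exact (mul_le_of_le_one_right (norm_nonneg _) (he x.2)).trans (ha x.1 x.2)
  have hsa : ∀ m, Summable fun i => a i m := fun m =>
    Summable.of_norm_bounded (hB.mul_right (D m)) fun i => ha i m
  have h2 : HasSum f (∑' x : ι × κ, a x.1 x.2 * e x.2) :=
    HasSum.prod_fiberwise hsum.hasSum fun i => hs i
  refine ⟨h2.summable, ?_⟩
  rw [h2.tsum_eq]
  have h3 : HasSum (fun x : κ × ι => a x.2 x.1 * e x.1) (∑' x : ι × κ, a x.1 x.2 * e x.2) :=
    (Equiv.prodComm κ ι).hasSum_iff.2 hsum.hasSum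
  exact HasSum.prod_fiberwise h3 fun m => (hsa m).hasSum.mul_right _

/-- The expansions behind `HasOverconvergentExpansion` may be summed. -/
theorem tsum {ι : Type*} (hR : PowerSeries.CoeffBound 1 (R : PowerSeries K))
    (hR0 : ‖R.coeff 0‖ = 1) (h0 : 0 < ρ) (h1 : ρ < 1) {f : ι → PowerSeries K} {B : ι → ℝ}
    (hB : Summable B) (hBC : ∀ i, B i ≤ C) (hC : 0 ≤ C)
    (h : ∀ i, HasOverconvergentExpansion R (B i) ρ (f i)) :
    Summable f ∧ HasOverconvergentExpansion R C ρ (∑' i, f i) := by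
  have hE : ∀ m : ℕ × ℕ, PowerSeries.CoeffBound 1
      ((PowerSeries.X : PowerSeries K) ^ m.1 * (R : PowerSeries K)⁻¹ ^ m.2) := fun m => by
    simpa using (PowerSeries.CoeffBound.X.pow m.1).mul
      ((hR.inv (by simpa using! hR0)).pow m.2)
  choose a ha hs using h
  have hB0 : ∀ i, 0 ≤ B i := fun i => by simpa using (norm_nonneg _).trans (ha i (0, 0))
  have hgeo : Summable fun m : ℕ × ℕ => ρ ^ (m.1 + m.2) := by
    simp only [pow_add]
    have := summable_geometric_of_lt_one h0.le h1
    exact this.mul_of_nonneg this (fun _ => pow_nonneg h0.le _) (fun _ => pow_nonneg h0.le _)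
  have key := fun n => hasSum_tsum_mul (fun m => hE m n) hB hgeo hB0
    (fun _ => pow_nonneg h0.le _) ha (fun i => hs i n)
  have hsumm : Summable f :=
    (PowerSeries.WithPiTopology.summable_iff_summable_coeff K).2 fun n => (key n).1
  refine ⟨hsumm, fun m => ∑' i, a i m, fun m => ?_, fun n => ?_⟩
  · refine IsUltrametricDist.norm_tsum_le_of_forall_le_of_nonneg
      (mul_nonneg hC (pow_nonneg h0.le _)) fun i => ?_
    exact (ha i m).trans (mul_le_mul_of_nonneg_right (hBC i) (pow_nonneg h0.le _))
  · have h2 := (PowerSeries.WithPiTopology.hasSum_iff_hasSum_coeff K).1 hsumm.hasSum n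
    rw [← h2.tsum_eq]
    exact (key n).2

end Complete

end HasOverconvergentExpansion

end Expansions

/-! ### A Gauss norm giving X the weight ρ^(-D). -/

section WeightedBound

variable {K : Type*} [NormedField K] [IsUltrametricDist K]

/-- A weighted Gauss bound: the coefficient of `X ^ i` is bounded by `C * ρ ^ (D * i)`. -/
def WeightedBound (R : K[X]) (D : ℕ) (ρ C : ℝ) (F : (PowerSeries K)[X]) : Prop :=
  ∀ i, HasOverconvergentExpansion R (C * ρ ^ (D * i)) ρ (F.coeff i)

namespace WeightedBound

variable {R : K[X]} {D : ℕ} {ρ C C' : ℝ} {F G q : (PowerSeries K)[X]}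

theorem nonneg (h : WeightedBound R D ρ C F) : 0 ≤ C := by simpa using (h 0).nonneg

theorem mono (h : WeightedBound R D ρ C F) (hC : C ≤ C') (h0 : 0 ≤ ρ) :
    WeightedBound R D ρ C' F := fun i => (h i).mono_const (by gcongr) h0

theorem zero (hC : 0 ≤ C) (h0 : 0 ≤ ρ) : WeightedBound R D ρ C 0 := fun i => by
  rw [coeff_zero]; exact HasOverconvergentExpansion.zero (by positivity) h0

theorem add (h : WeightedBound R D ρ C F) (h' : WeightedBound R D ρ C G) :
    WeightedBound R D ρ C (F + G) := fun i => by rw [coeff_add]; exact (h i).add_same (h' i)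

theorem sub (h : WeightedBound R D ρ C F) (h' : WeightedBound R D ρ C G) :
    WeightedBound R D ρ C (F - G) := fun i => by rw [coeff_sub]; exact (h i).sub_same (h' i)

theorem monomial (i : ℕ) {s : PowerSeries K}
    (hs : HasOverconvergentExpansion R (C * ρ ^ (D * i)) ρ s) (hC : 0 ≤ C) (h0 : 0 ≤ ρ) :
    WeightedBound R D ρ C (Polynomial.monomial i s) := fun j => by
  rw [coeff_monomial]
  split_ifs with h
  · rw [← h]; exact hs
  · exact HasOverconvergentExpansion.zero (by positivity) h0

theorem mul (h : WeightedBound R D ρ C F) (h' : WeightedBound R D ρ C' G) (h0 : 0 ≤ ρ) :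
    WeightedBound R D ρ (C * C') (F * G) := fun i => by
  have := h.nonneg
  have := h'.nonneg
  rw [coeff_mul]
  refine HasOverconvergentExpansion.sum _ (by positivity) h0 fun x hx => ?_
  have h1 := (h x.1).mul (h' x.2) h0
  have h2 : x.1 + x.2 = i := Finset.HasAntidiagonal.mem_antidiagonal.1 hx
  convert h1 using 1
  rw [← h2, mul_add, pow_add]; ring

theorem one (h0 : 0 < ρ) : WeightedBound R D ρ 1 1 := by
  rw [← monomial_zero_one]
  exact monomial 0 (by simpa using HasOverconvergentExpansion.one h0) zero_le_one h0.le

theorem pow (h : WeightedBound R D ρ C F) (h0 : 0 < ρ) (n : ℕ) :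
    WeightedBound R D ρ (C ^ n) (F ^ n) := by
  induction n with
  | zero => simpa using one h0
  | succ n ih => simpa [pow_succ] using ih.mul h h0.le

theorem X_pow (h0 : 0 < ρ) (i : ℕ) : WeightedBound R D ρ ((ρ⁻¹) ^ (D * i)) (X ^ i) := by
  rw [← monomial_one_right_eq_X_pow]
  refine monomial i ?_ (by positivity) h0.le
  rw [← mul_pow, inv_mul_cancel₀ h0.ne', one_pow]
  exact HasOverconvergentExpansion.one h0

/-- Long division: under `hqb` the leading term of `q` dominates its other terms, so subtracting a
multiple of `q` that cancels the leading term of `F` does not increase the norm. -/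
theorem divByMonic_modByMonic (hq : q.Monic)
    (hqb : WeightedBound R D ρ ((ρ⁻¹) ^ (D * q.natDegree)) q) (h0 : 0 < ρ) (h1 : ρ ≤ 1)
    (hF : WeightedBound R D ρ C F) :
    WeightedBound R D ρ C (F /ₘ q) ∧ WeightedBound R D ρ C (F %ₘ q) := by
  have hC := hF.nonneg
  have key : ∀ n : ℕ, ∀ F : (PowerSeries K)[X], F.degree < (n : ℕ) → WeightedBound R D ρ C F →
      WeightedBound R D ρ C (F /ₘ q) ∧ WeightedBound R D ρ C (F %ₘ q) := by
    intro n
    induction n with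
    | zero =>
      intro F hdeg hF
      have : F = 0 := by
        rw [← degree_eq_bot, ← Nat.WithBot.lt_zero_iff]; simpa using hdeg
      rw [this, zero_divByMonic, zero_modByMonic]
      exact ⟨zero hC h0.le, zero hC h0.le⟩
    | succ n ih =>
      intro F hdeg hF
      by_cases hlt : F.degree < q.degree
      · rw [(divByMonic_eq_zero_iff hq).2 hlt, (modByMonic_eq_self_iff hq).2 hlt]
        exact ⟨zero hC h0.le, hF⟩
      have hF0 : F ≠ 0 := fun h => hlt (by
        rw [h, degree_zero]; exact (degree_eq_natDegree hq.ne_zero ▸ WithBot.bot_lt_coe _))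
      have hle : q.natDegree ≤ F.natDegree := natDegree_le_natDegree (not_lt.1 hlt)
      set P := Polynomial.monomial (F.natDegree - q.natDegree) F.leadingCoeff with hP
      have hPb' : HasOverconvergentExpansion R ((C * ρ ^ (D * q.natDegree)) *
          ρ ^ (D * (F.natDegree - q.natDegree))) ρ F.leadingCoeff := by
        rw [mul_assoc, ← pow_add, ← mul_add, Nat.add_sub_cancel' hle]
        exact hF _
      have hPb : WeightedBound R D ρ (C * ρ ^ (D * q.natDegree)) P :=
        monomial _ hPb' (by positivity) h0.le
      have hPC : WeightedBound R D ρ C P :=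
        hPb.mono (mul_le_of_le_one_right hC (pow_le_one₀ h0.le h1)) h0.le
      have hPq : WeightedBound R D ρ C (P * q) := by
        have := hPb.mul hqb h0.le
        rwa [mul_assoc, ← mul_pow, mul_inv_cancel₀ h0.ne', one_pow, mul_one] at this
      have hdec : F = q * P + (F - P * q) := by ring
      have hlt' : (F - P * q).degree < F.degree := by
        refine degree_sub_lt_left ?_ hF0 ?_
        · rw [hq.degree_mul, hP, degree_monomial _ (leadingCoeff_ne_zero.2 hF0),
            degree_eq_natDegree hq.ne_zero, degree_eq_natDegree hF0]
          exact_mod_cast (Nat.sub_add_cancel hle).symm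
        · rw [leadingCoeff_mul_monic hq, hP, leadingCoeff_monomial]
      have hlt'' : (F - P * q).degree < (n : ℕ) := by
        by_cases hz : F - P * q = 0
        · rw [hz, degree_zero]; exact WithBot.bot_lt_coe n
        rw [← natDegree_lt_iff_degree_lt hz]
        rw [← natDegree_lt_iff_degree_lt hF0] at hdeg
        have := natDegree_lt_natDegree hz hlt'
        omega
      have hih := ih _ hlt'' (hF.sub hPq)
      constructor
      · rw [hdec, HyperellipticFamily.add_divByMonic hq, mul_divByMonic_cancel_left _ hq]
        exact hPC.add hih.1
      · rw [hdec, add_modByMonic, self_mul_modByMonic hq, zero_add]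
        exact hih.2
  exact key _ F (degree_le_natDegree.trans_lt (by exact_mod_cast Nat.lt_succ_self _)) hF

theorem digit (hq : q.Monic) (hqb : WeightedBound R D ρ ((ρ⁻¹) ^ (D * q.natDegree)) q)
    (h0 : 0 < ρ) (h1 : ρ ≤ 1) (hF : WeightedBound R D ρ C F) (j : ℕ) :
    WeightedBound R D ρ C (Polynomial.digit q j F) := by
  induction j generalizing F with
  | zero => exact (divByMonic_modByMonic hq hqb h0 h1 hF).2
  | succ j ih => exact ih (divByMonic_modByMonic hq hqb h0 h1 hF).1

theorem coeff (hF : WeightedBound R D ρ C F) (h0 : 0 ≤ ρ) (h1 : ρ ≤ 1) (i : ℕ) :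
    HasOverconvergentExpansion R C ρ (F.coeff i) :=
  (hF i).mono_const (mul_le_of_le_one_right hF.nonneg (pow_le_one₀ h0 h1)) h0

end WeightedBound

end WeightedBound

/-! ### Primitives of polynomials in X. -/

section Primitive

namespace Polynomial

variable {K : Type*} [Field K] {A : Type*} [CommRing A] [Algebra K A]

/-- The primitive of a polynomial, without constant term. -/
def primitive (K : Type*) [Field K] {A : Type*} [CommRing A] [Algebra K A] (H : A[X]) : A[X] :=
  ∑ i ∈ H.support, monomial (i + 1) (((i + 1 : ℕ) : K)⁻¹ • H.coeff i)

theorem coeff_primitive_succ (H : A[X]) (i : ℕ) :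
    (primitive K H).coeff (i + 1) = ((i + 1 : ℕ) : K)⁻¹ • H.coeff i := by
  rw [primitive, finsetSum_coeff]
  simp only [coeff_monomial, add_left_inj, Finset.sum_ite_eq', mem_support_iff]
  split_ifs with h
  · rfl
  · rw [notMem_support_iff.1 h, smul_zero]

theorem coeff_primitive_zero (H : A[X]) : (primitive K H).coeff 0 = 0 := by
  rw [primitive, finsetSum_coeff]
  exact Finset.sum_eq_zero fun i _ => by rw [coeff_monomial, if_neg (Nat.succ_ne_zero i)]

theorem derivative_primitive [CharZero K] (H : A[X]) : derivative (primitive K H) = H := by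
  ext i
  rw [coeff_derivative, coeff_primitive_succ]
  have h : ((i : A) + 1) = algebraMap K A ((i + 1 : ℕ) : K) := by simp
  rw [h, mul_comm, ← Algebra.smul_def, smul_smul,
    mul_inv_cancel₀ (by exact_mod_cast Nat.succ_ne_zero i), one_smul]

theorem natDegree_primitive_le (H : A[X]) : (primitive K H).natDegree ≤ H.natDegree + 1 := by
  refine natDegree_sum_le_of_forall_le _ _ fun i hi => ?_
  refine (natDegree_monomial_le _).trans ?_
  have := le_natDegree_of_mem_supp i hi
  omega

end Polynomial

theorem WeightedBound.primitive {K : Type*} [NormedField K] [IsUltrametricDist K] {R : K[X]}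
    {D : ℕ} {ρ C L : ℝ} {H : (PowerSeries K)[X]} (hH : WeightedBound R D ρ C H) (h0 : 0 < ρ)
    (hL0 : 0 ≤ L) (hL : ∀ i ≤ H.natDegree, ‖((i + 1 : ℕ) : K)⁻¹‖ ≤ L) :
    WeightedBound R D ρ (L * C * (ρ⁻¹) ^ D) (Polynomial.primitive K H) := by
  have hC := hH.nonneg
  intro i
  cases i with
  | zero => rw [coeff_primitive_zero]; exact .zero (by positivity) h0.le
  | succ i =>
    rw [coeff_primitive_succ]
    have h1 : L * C * (ρ⁻¹) ^ D * ρ ^ (D * (i + 1)) = L * (C * ρ ^ (D * i)) := by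
      have : (ρ⁻¹) ^ D * ρ ^ D = 1 := by
        rw [← mul_pow, inv_mul_cancel₀ h0.ne', one_pow]
      rw [mul_add, pow_add, mul_one]
      linear_combination L * C * ρ ^ (D * i) * this
    rw [h1]
    by_cases hi : i ≤ H.natDegree
    · exact ((hH i).smul _).mono_const (by gcongr; exact hL i hi) h0.le
    · rw [coeff_eq_zero_of_natDegree_lt (not_le.1 hi), smul_zero]
      exact .zero (by positivity) h0.le

end Primitive

/-! ### Square roots of power series and primitives of H/√q at infinity. -/

section SquareRoot

/-- A power series with constant coefficient `1` over a `ℚ`-algebra has a square root. -/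
theorem PowerSeries.exists_sq_eq {K : Type*} [Field K] [CharZero K] {A : Type*} [CommRing A]
    [Algebra K A] (f : PowerSeries A) (hf : PowerSeries.constantCoeff f = 1) :
    ∃ v : PowerSeries A, PowerSeries.constantCoeff v = 1 ∧ v * v = f := by
  have hs : PowerSeries.HasSubst (f - 1) :=
    PowerSeries.HasSubst.of_constantCoeff_zero' (by simp [hf])
  set b : PowerSeries A := PowerSeries.binomialSeries A (1 / 2 : K)
  have hb : b * b = 1 + PowerSeries.X := by
    rw [← PowerSeries.binomialSeries_add, add_halves]
    simpa using PowerSeries.binomialSeries_nat (R := K) (A := A) 1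
  have hsq : b.subst (f - 1) * b.subst (f - 1) = f := by
    rw [← PowerSeries.subst_mul hs, hb, ← PowerSeries.coe_substAlgHom hs, map_add, map_one,
      PowerSeries.substAlgHom_X]
    ring
  refine ⟨b.subst (f - 1), ?_, hsq⟩
  have hb1 : b = 1 + PowerSeries.X * (PowerSeries.mk fun n => PowerSeries.coeff (n + 1) b) := by
    rw [← PowerSeries.sub_const_eq_X_mul_shift]
    simp [b]
  rw [hb1, ← PowerSeries.coe_substAlgHom hs, map_add, map_one, map_mul,
    PowerSeries.substAlgHom_X]
  simp [hf]

end SquareRoot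

section Infinity

namespace Polynomial

variable {K : Type*} [Field K] [CharZero K] {A : Type*} [CommRing A] [Algebra K A]

/-- For u = 1/X the reflection is u^M F(1/u), and X d/dX = -u d/du. -/
theorem coe_reflect_X_mul_derivative {F : A[X]} {M : ℕ} (hF : F.natDegree ≤ M) :
    (reflect M (X * derivative F) : PowerSeries A) =
      (M : PowerSeries A) * ((reflect M F : A[X]) : PowerSeries A) -
      PowerSeries.X * PowerSeries.derivative A ((reflect M F : A[X]) : PowerSeries A) := by
  ext j
  have h1 : (M : PowerSeries A) = PowerSeries.C (M : A) := by simp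
  rw [h1, map_sub, PowerSeries.coeff_C_mul, Polynomial.coeff_coe, coeff_reflect,
    Polynomial.coeff_coe, coeff_reflect]
  have h2 : PowerSeries.coeff j (PowerSeries.X * PowerSeries.derivative A
      ((reflect M F : A[X]) : PowerSeries A)) = j * F.coeff (revAt M j) := by
    cases j with
    | zero => simp
    | succ j =>
      rw [PowerSeries.coeff_succ_X_mul, PowerSeries.coeff_derivative, Polynomial.coeff_coe,
        coeff_reflect]
      push_cast; ring
  have h3 : ∀ i, (X * derivative F).coeff i = i * F.coeff i := by
    intro i
    cases i with
    | zero => simp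
    | succ i => rw [coeff_X_mul, coeff_derivative]; push_cast; ring
  rw [h2, h3]
  by_cases hj : j ≤ M
  · rw [revAt_le hj, Nat.cast_sub hj]; ring
  · rw [revAt_eq_self_of_lt (not_le.1 hj), coeff_eq_zero_of_natDegree_lt (hF.trans_lt (not_le.1 hj))]
    ring

/-- The operator `derivNumerator q (-1)` in the coordinate at infinity. -/
def derivAtInfinity (c κ : A) (Q f : PowerSeries A) : PowerSeries A :=
  PowerSeries.C κ * (f * Q) - PowerSeries.X * (PowerSeries.derivative A f * Q +
    PowerSeries.C c * (f * PowerSeries.derivative A Q))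

theorem coe_reflect_derivNumerator {q F : A[X]} {M d : ℕ} (hF : F.natDegree ≤ M)
    (hq : q.natDegree ≤ d) :
    (reflect (M + d) (X * derivNumerator q (-1 : K) F) : PowerSeries A) =
      derivAtInfinity (algebraMap K A (1 / 2)) (algebraMap K A (M + d / 2))
        ((reflect d q : A[X]) : PowerSeries A)
        ((reflect M F : A[X]) : PowerSeries A) := by
  have h1 : X * derivNumerator q (-1 : K) F = X * derivative F * q +
      C (algebraMap K A (1 / 2)) * (F * (X * derivative q)) := by
    rw [derivNumerator, Algebra.smul_def, Polynomial.algebraMap_apply]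
    have : (-1 / 2 : K) = -(1 / 2) := by ring
    rw [this, map_neg, map_neg]; ring
  have hXd : ∀ {f : A[X]} {n : ℕ}, f.natDegree ≤ n → (X * derivative f).natDegree ≤ n := by
    intro f n hf
    by_cases h0 : f.natDegree = 0
    · rw [derivative_of_natDegree_zero h0]; simp
    · have h2 := natDegree_derivative_lt h0
      have h3 := natDegree_mul_le (p := X) (q := derivative f)
      have h4 := natDegree_X_le (R := A)
      omega
  rw [h1, reflect_add, reflect_C_mul, reflect_mul _ _ (hXd hF) hq, reflect_mul _ _ hF (hXd hq)]
  simp only [Polynomial.coe_add, Polynomial.coe_mul, Polynomial.coe_C]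
  rw [coe_reflect_X_mul_derivative hF, coe_reflect_X_mul_derivative hq, derivAtInfinity]
  have h5 : PowerSeries.C (algebraMap K A (M + d / 2)) = (M : PowerSeries A) +
      PowerSeries.C (algebraMap K A (1 / 2)) * d := by
    have : (M + d / 2 : K) = M + 1 / 2 * d := by ring
    rw [this]; simp only [map_add, map_mul, map_natCast]
  rw [h5]; ring

theorem X_pow_dvd_derivAtInfinity (c κ : A) (Q : PowerSeries A) {f : PowerSeries A} {n : ℕ}
    (hf : PowerSeries.X ^ n ∣ f) : PowerSeries.X ^ n ∣ derivAtInfinity c κ Q f := by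
  obtain ⟨z, rfl⟩ := hf
  cases n with
  | zero => simp
  | succ n =>
    rw [derivAtInfinity]
    simp only [Derivation.leibniz, smul_eq_mul, PowerSeries.derivative_pow]
    refine dvd_sub ?_ ?_
    · exact Dvd.intro (PowerSeries.C κ * (z * Q)) (by ring)
    · refine Dvd.intro (PowerSeries.X * PowerSeries.derivative A z * Q + ((n : PowerSeries A) + 1) * z * Q +
        PowerSeries.X * (PowerSeries.C c * (z * PowerSeries.derivative A Q))) ?_
      simp only [Nat.add_sub_cancel, PowerSeries.derivative_X]
      push_cast
      ring

theorem derivAtInfinity_sub (c κ : A) (Q f f' : PowerSeries A) :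
    derivAtInfinity c κ Q (f - f') = derivAtInfinity c κ Q f - derivAtInfinity c κ Q f' := by
  simp only [derivAtInfinity, map_sub]; ring

/-- If v^2 is the reflection of q, then √q is v up to a half-integral power of u, and F = ψJ means
that F√q is J up to such a power. In terms of J the operator is the Euler operator κ - u d/du, which
multiplies u^m by κ - m. -/
theorem derivAtInfinity_mul {c : A} (hc : 2 * c = 1) (κ : A) {v ψ : PowerSeries A}
    (hv : v * ψ = 1) (J : PowerSeries A) :
    derivAtInfinity c κ (v * v) (ψ * J) =
      v * (PowerSeries.C κ * J - PowerSeries.X * PowerSeries.derivative A J) := by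
  have h1 : v * PowerSeries.derivative A ψ + ψ * PowerSeries.derivative A v = 0 := by
    have := congrArg (PowerSeries.derivative A) hv
    simpa [Derivation.leibniz, smul_eq_mul] using this
  have h2 : PowerSeries.C c * 2 = 1 := by
    have : (2 : PowerSeries A) = PowerSeries.C (2 : A) := (map_ofNat _ 2).symm
    rw [this, ← map_mul, mul_comm c, hc, map_one]
  simp only [derivAtInfinity, Derivation.leibniz, smul_eq_mul]
  linear_combination (PowerSeries.C κ * J * v - PowerSeries.X * PowerSeries.derivative A J * v) * hv -
    PowerSeries.X * v * J * h1 -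
    PowerSeries.X * ψ * J * v * PowerSeries.derivative A v * h2

variable (K) in
/-- The expansion at infinity of the primitive of `H / √q`, divided by `√q`. -/
def seriesAtInfinity (g e : ℕ) (ψ : PowerSeries A) (H : A[X]) : PowerSeries A :=
  PowerSeries.mk fun j => if j ≤ e - 2 * g then
    (2 / ((2 * (e - g - j) + 1 : ℕ) : K)) •
      PowerSeries.coeff j (ψ * ((reflect e H : A[X]) : PowerSeries A)) else 0

variable (K) in
/-- The polynomial part of the primitive of `H / √q`, divided by `√q`. -/
def primitiveAtInfinity (g e : ℕ) (ψ : PowerSeries A) (H : A[X]) : A[X] :=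
  reflect (e - 2 * g) (PowerSeries.trunc (e - 2 * g + 1) (ψ * seriesAtInfinity K g e ψ H))

theorem natDegree_primitiveAtInfinity_le (g e : ℕ) (ψ : PowerSeries A) (H : A[X]) :
    (primitiveAtInfinity K g e ψ H).natDegree ≤ e - 2 * g := by
  rw [natDegree_le_iff_coeff_eq_zero]
  intro N hN
  rw [primitiveAtInfinity, coeff_reflect, revAt_eq_self_of_lt hN, PowerSeries.coeff_trunc,
    if_neg (by omega)]

theorem coeff_primitiveAtInfinity {g e j : ℕ} (hj : j ≤ e - 2 * g) (ψ : PowerSeries A) (H : A[X]) :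
    (primitiveAtInfinity K g e ψ H).coeff j =
      PowerSeries.coeff (e - 2 * g - j) (ψ * seriesAtInfinity K g e ψ H) := by
  rw [primitiveAtInfinity, coeff_reflect, revAt_le hj, PowerSeries.coeff_trunc,
    if_pos (by omega)]

/-- Inverting the Euler operator coefficient by coefficient produces the primitive. Truncation after
u^(e-2g) affects only higher powers of u, which are the coefficients of X^s with s < 2g. -/
theorem coeff_derivNumerator_primitiveAtInfinity {q H : A[X]} {g e : ℕ}
    (hq : q.natDegree = 2 * g + 1) (he : 2 * g ≤ e) (hH : H.natDegree ≤ e) {v ψ : PowerSeries A}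
    (hv : v * v = ((reflect (2 * g + 1) q : A[X]) : PowerSeries A)) (hψ : v * ψ = 1)
    {s : ℕ} (hs : 2 * g ≤ s) :
    (derivNumerator q (-1 : K) (primitiveAtInfinity K g e ψ H)).coeff s = H.coeff s := by
  set M := e - 2 * g with hM
  set F := primitiveAtInfinity K g e ψ H with hFdef
  have hF : F.natDegree ≤ M := natDegree_primitiveAtInfinity_le g e ψ H
  have hrev := coe_reflect_derivNumerator (K := K) hF hq.le
  have hMd : M + (2 * g + 1) = e + 1 := by omega
  rw [hMd, ← hv] at hrev
  set J := seriesAtInfinity K g e ψ H with hJ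
  set κ := algebraMap K A (M + (2 * g + 1 : ℕ) / 2) with hκ
  set c := algebraMap K A (1 / 2) with hc
  have hc2 : 2 * c = 1 := by
    rw [hc, ← map_ofNat (algebraMap K A) 2, ← map_mul]; simp
  have hFJ : PowerSeries.X ^ (M + 1) ∣ (reflect M F : PowerSeries A) - ψ * J := by
    rw [PowerSeries.X_pow_dvd_iff]
    intro m hm
    rw [hFdef, primitiveAtInfinity, reflect_reflect, map_sub, Polynomial.coeff_coe,
      PowerSeries.coeff_trunc, if_pos hm, sub_self]
  have h1 := X_pow_dvd_derivAtInfinity c κ (v * v) hFJ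
  rw [derivAtInfinity_sub, derivAtInfinity_mul hc2 κ hψ] at h1
  have h2 : PowerSeries.X ^ (M + 1) ∣
      (PowerSeries.C κ * J - PowerSeries.X * PowerSeries.derivative A J) -
        ψ * ((reflect e H : A[X]) : PowerSeries A) := by
    rw [PowerSeries.X_pow_dvd_iff]
    intro m hm
    have h3 : PowerSeries.coeff m (PowerSeries.X * PowerSeries.derivative A J) =
        m * PowerSeries.coeff m J := by
      cases m with
      | zero => simp
      | succ m =>
        rw [PowerSeries.coeff_succ_X_mul, PowerSeries.coeff_derivative]; push_cast; ring
    have h4 : PowerSeries.coeff m J = (2 / ((2 * (e - g - m) + 1 : ℕ) : K)) •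
      PowerSeries.coeff m (ψ * ((reflect e H : A[X]) : PowerSeries A)) := by
      rw [hJ, seriesAtInfinity, PowerSeries.coeff_mk, if_pos (by omega)]
    rw [map_sub, map_sub, PowerSeries.coeff_C_mul, h3, h4, ← sub_mul]
    -- As M = e - 2g, the eigenvalue is half an odd integer. It never vanishes, so no logarithm
    -- appears.
    have h5 : κ - m = algebraMap K A (((2 * (e - g - m) + 1 : ℕ) : K) / 2) := by
      rw [hκ, ← map_natCast (algebraMap K A) m, ← map_sub]
      congr 1
      have : e - g - m = M + g - m := by omega
      rw [this]
      push_cast [Nat.cast_sub (show m ≤ M + g by omega)]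
      ring
    rw [h5, ← Algebra.smul_def, smul_smul]
    have h6 : ((2 * (e - g - m) + 1 : ℕ) : K) ≠ 0 := Nat.cast_ne_zero.2 (Nat.succ_ne_zero _)
    rw [div_mul_div_comm, mul_comm, div_self (mul_ne_zero two_ne_zero h6), one_smul, sub_self]
  have h3 : PowerSeries.X ^ (M + 1) ∣
      (reflect (e + 1) (X * derivNumerator q (-1 : K) F) : PowerSeries A) -
        ((reflect e H : A[X]) : PowerSeries A) := by
    rw [hrev]
    have h4 := dvd_add h1 (h2.mul_left v)
    convert h4 using 1
    linear_combination (reflect e H : PowerSeries A) * hψ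
  by_cases hse : s ≤ e
  · have h4 := (PowerSeries.X_pow_dvd_iff.1 h3) (e - s) (by omega)
    rw [map_sub, Polynomial.coeff_coe, Polynomial.coeff_coe, coeff_reflect, coeff_reflect,
      revAt_le (by omega), revAt_le (by omega), sub_eq_zero] at h4
    have h5 : e + 1 - (e - s) = s + 1 := by omega
    have h6 : e - (e - s) = s := by omega
    rwa [h5, h6, coeff_X_mul] at h4
  · rw [coeff_eq_zero_of_natDegree_lt (hH.trans_lt (not_le.1 hse)), derivNumerator, coeff_sub,
      coeff_smul]
    have hd1 : (F * derivative q).natDegree ≤ e := by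
      have := natDegree_mul_le (p := F) (q := derivative q)
      have := natDegree_derivative_le q
      omega
    have hd2 : (derivative F * q).natDegree ≤ e := by
      by_cases h0 : F.natDegree = 0
      · rw [derivative_of_natDegree_zero h0]; simp
      have := natDegree_mul_le (p := derivative F) (q := q)
      have := natDegree_derivative_lt h0
      omega
    rw [coeff_eq_zero_of_natDegree_lt (hd1.trans_lt (not_le.1 hse)),
      coeff_eq_zero_of_natDegree_lt (hd2.trans_lt (not_le.1 hse)), smul_zero, sub_zero]

end Polynomial

end Infinity

/-! ### Bounds for the primitive at infinity. -/

section BoundsAtInfinity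

variable {K : Type*} [NormedField K] [IsUltrametricDist K]

/-- The coefficient of `u ^ j` is bounded by `C * ρ ^ (-D * j)`, for `j ≤ M`. -/
def BoundAtInfinity (R : K[X]) (D : ℕ) (ρ : ℝ) (M : ℕ) (C : ℝ) (f : PowerSeries (PowerSeries K)) :
    Prop :=
  ∀ j ≤ M, HasOverconvergentExpansion R (C * (ρ⁻¹) ^ (D * j)) ρ (PowerSeries.coeff j f)

namespace BoundAtInfinity

variable {R : K[X]} {D M : ℕ} {ρ C C' : ℝ} {f f' v : PowerSeries (PowerSeries K)}

theorem nonneg (h : BoundAtInfinity R D ρ M C f) : 0 ≤ C := by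
  simpa using (h 0 (Nat.zero_le M)).nonneg

theorem mul (h : BoundAtInfinity R D ρ M C f) (h' : BoundAtInfinity R D ρ M C' f') (h0 : 0 ≤ ρ) :
    BoundAtInfinity R D ρ M (C * C') (f * f') := fun j hj => by
  have := h.nonneg
  have := h'.nonneg
  rw [PowerSeries.coeff_mul]
  refine HasOverconvergentExpansion.sum _ (by positivity) h0 fun x hx => ?_
  have h2 : x.1 + x.2 = j := Finset.HasAntidiagonal.mem_antidiagonal.1 hx
  have h1 := (h x.1 (by omega)).mul (h' x.2 (by omega)) h0
  convert h1 using 1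
  rw [← h2, mul_add, pow_add]; ring

/-- The coefficient of u^j in v^2 is 2 v_j plus products of earlier coefficients, so the only
denominator is the unit 2. -/
theorem sqrt (h2 : ‖(2 : K)‖ = 1) (h0 : 0 < ρ) (hv : PowerSeries.constantCoeff v = 1)
    (h : BoundAtInfinity R D ρ M 1 (v * v)) : BoundAtInfinity R D ρ M 1 v := by
  intro j
  induction j using Nat.strong_induction_on with
  | _ j ih =>
    intro hj
    rcases Nat.eq_zero_or_pos j with rfl | hj0
    · simpa [hv] using HasOverconvergentExpansion.one (R := R) h0
    have hw : v * v = 1 + (2 : K) • (v - 1) + (v - 1) * (v - 1) := by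
      have : (2 : K) • (v - 1) = 2 * (v - 1) := by
        rw [two_mul, two_smul]
      rw [this]; ring
    have h3 : PowerSeries.coeff j v = (2 : K)⁻¹ • (PowerSeries.coeff j (v * v) -
        PowerSeries.coeff j ((v - 1) * (v - 1))) := by
      have h4 : PowerSeries.coeff j (v * v) = (2 : K) • PowerSeries.coeff j v +
          PowerSeries.coeff j ((v - 1) * (v - 1)) := by
        conv_lhs => rw [hw]
        have h6 : PowerSeries.coeff j ((2 : K) • (v - 1)) =
          (2 : K) • PowerSeries.coeff j (v - 1) := rfl
        rw [map_add, map_add, h6, map_sub, PowerSeries.coeff_one, if_neg hj0.ne']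
        simp
      have h5 : (2 : K) ≠ 0 := fun h => by simp [h] at h2
      rw [h4, add_sub_cancel_right, smul_smul, inv_mul_cancel₀ h5, one_smul]
    rw [h3]
    have h4 : HasOverconvergentExpansion R (1 * (ρ⁻¹) ^ (D * j)) ρ
        (PowerSeries.coeff j ((v - 1) * (v - 1))) := by
      rw [PowerSeries.coeff_mul]
      refine HasOverconvergentExpansion.sum _ (by positivity) h0.le fun x hx => ?_
      have h5 : x.1 + x.2 = j := Finset.HasAntidiagonal.mem_antidiagonal.1 hx
      have hz : PowerSeries.coeff 0 (v - 1) = 0 := by simp [hv]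
      by_cases hx1 : x.1 = 0
      · rw [hx1, hz, zero_mul]; exact .zero (by positivity) h0.le
      by_cases hx2 : x.2 = 0
      · rw [hx2, hz, mul_zero]; exact .zero (by positivity) h0.le
      have e1 : PowerSeries.coeff x.1 (v - 1) = PowerSeries.coeff x.1 v := by
        rw [map_sub, PowerSeries.coeff_one, if_neg hx1, sub_zero]
      have e2 : PowerSeries.coeff x.2 (v - 1) = PowerSeries.coeff x.2 v := by
        rw [map_sub, PowerSeries.coeff_one, if_neg hx2, sub_zero]
      rw [e1, e2]
      have h6 := (ih x.1 (by omega) (by omega)).mul (ih x.2 (by omega) (by omega)) h0.le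
      convert h6 using 1
      rw [← h5, mul_add, pow_add]; ring
    have h5 := ((h j hj).sub_same h4).smul (2 : K)⁻¹
    rwa [norm_inv, h2, inv_one, one_mul] at h5

theorem inverse (h0 : 0 < ρ) (hv : PowerSeries.constantCoeff v = 1) (hvf : v * f = 1)
    (h : BoundAtInfinity R D ρ M 1 v) : BoundAtInfinity R D ρ M 1 f := by
  have hf : f = 1 - (v - 1) * f := by rw [sub_mul, hvf]; ring
  intro j
  induction j using Nat.strong_induction_on with
  | _ j ih =>
    intro hj
    rw [hf, map_sub]
    refine HasOverconvergentExpansion.sub_same ?_ ?_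
    · rw [PowerSeries.coeff_one]
      split_ifs with hj0
      · rw [hj0]; simpa using HasOverconvergentExpansion.one (R := R) h0
      · exact .zero (by positivity) h0.le
    · rw [PowerSeries.coeff_mul]
      refine HasOverconvergentExpansion.sum _ (by positivity) h0.le fun x hx => ?_
      have h5 : x.1 + x.2 = j := Finset.HasAntidiagonal.mem_antidiagonal.1 hx
      by_cases hx1 : x.1 = 0
      · have hz : PowerSeries.coeff 0 (v - 1) = 0 := by simp [hv]
        rw [hx1, hz, zero_mul]; exact .zero (by positivity) h0.le
      rw [map_sub, PowerSeries.coeff_one, if_neg hx1, sub_zero]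
      have h6 := (h x.1 (by omega)).mul (ih x.2 (by omega) (by omega)) h0.le
      convert h6 using 1
      rw [← h5, mul_add, pow_add]; ring

theorem reflect {H : (PowerSeries K)[X]} {e : ℕ} (hH : WeightedBound R D ρ C H)
    (h0 : 0 < ρ) (hM : M ≤ e) :
    BoundAtInfinity R D ρ M (C * ρ ^ (D * e))
      ((Polynomial.reflect e H : (PowerSeries K)[X]) : PowerSeries (PowerSeries K)) :=
  fun j hj => by
  rw [Polynomial.coeff_coe, coeff_reflect, revAt_le (hj.trans hM)]
  convert hH (e - j) using 1
  have h1 : D * e = D * (e - j) + D * j := by rw [← mul_add, Nat.sub_add_cancel (hj.trans hM)]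
  rw [h1, pow_add, mul_assoc, mul_assoc, ← mul_pow, mul_inv_cancel₀ h0.ne', one_pow, mul_one]

end BoundAtInfinity

/-- The series v and ψ = 1/v have norm 1 for the weight at infinity. The only loss is `L`, from the
odd integers divided by in the integration. -/
theorem WeightedBound.primitiveAtInfinity [CharZero K] {R : K[X]} {D g e : ℕ} {ρ C L : ℝ}
    {q H : (PowerSeries K)[X]} {v ψ : PowerSeries (PowerSeries K)} (h2 : ‖(2 : K)‖ = 1)
    (h0 : 0 < ρ) (h1 : ρ ≤ 1)
    (hqb : WeightedBound R D ρ ((ρ⁻¹) ^ (D * (2 * g + 1))) q)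
    (hH : WeightedBound R D ρ C H) (he : 2 * g ≤ e) (hL0 : 0 ≤ L)
    (hL : ∀ j ≤ e, ‖((2 * j + 1 : ℕ) : K)⁻¹‖ ≤ L) (hv1 : PowerSeries.constantCoeff v = 1)
    (hv : v * v = ((Polynomial.reflect (2 * g + 1) q : (PowerSeries K)[X]) :
      PowerSeries (PowerSeries K)))
    (hψ : v * ψ = 1) : WeightedBound R D ρ (L * C) (primitiveAtInfinity K g e ψ H) := by
  have hC := hH.nonneg
  have hq' : ∀ M, BoundAtInfinity R D ρ M 1 (v * v) := by
    intro M j hj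
    by_cases hjd : j ≤ 2 * g + 1
    · have h3 := BoundAtInfinity.reflect hqb h0 (le_refl (2 * g + 1)) j hjd
      rw [← hv] at h3
      rwa [← mul_pow, inv_mul_cancel₀ h0.ne', one_pow] at h3
    · rw [hv, Polynomial.coeff_coe, coeff_reflect, revAt_eq_self_of_lt (not_le.1 hjd)]
      have h4 : (ρ⁻¹ : ℝ) ^ (D * (2 * g + 1)) * ρ ^ (D * j) ≤ 1 * (ρ⁻¹) ^ (D * j) := by
        have h5 : (ρ⁻¹ : ℝ) ^ (D * (2 * g + 1)) ≤ (ρ⁻¹) ^ (D * j) :=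
          pow_le_pow_right₀ ((one_le_inv₀ h0).2 h1) (Nat.mul_le_mul_left D (not_le.1 hjd).le)
        calc _ ≤ (ρ⁻¹ : ℝ) ^ (D * (2 * g + 1)) * 1 := by
              gcongr; exact pow_le_one₀ h0.le h1
          _ ≤ _ := by simpa using h5
      exact (hqb j).mono_const h4 h0.le
  set M := e - 2 * g with hM
  have hψb : BoundAtInfinity R D ρ M 1 ψ :=
    (BoundAtInfinity.sqrt h2 h0 hv1 (hq' M)).inverse h0 hv1 hψ
  have hHb : BoundAtInfinity R D ρ M (1 * (C * ρ ^ (D * e))) _ :=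
    hψb.mul (BoundAtInfinity.reflect hH h0 (show M ≤ e by omega)) h0.le
  have hJ : BoundAtInfinity R D ρ M (L * (C * ρ ^ (D * e))) (seriesAtInfinity K g e ψ H) := by
    intro j hj
    rw [seriesAtInfinity, PowerSeries.coeff_mk, if_pos hj]
    refine ((hHb j hj).smul _).mono_const ?_ h0.le
    rw [one_mul, mul_assoc L, div_eq_mul_inv, norm_mul, h2, one_mul]
    gcongr
    exact hL _ (by omega)
  intro i
  by_cases hi : i ≤ M
  · rw [coeff_primitiveAtInfinity hi]
    refine ((hψb.mul hJ h0.le) (M - i) (by omega)).mono_const ?_ h0.le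
    have h3 : ρ ^ (D * e) = ρ ^ (D * (2 * g)) * ρ ^ (D * i) * ρ ^ (D * (M - i)) := by
      rw [← pow_add, ← pow_add, ← mul_add, ← mul_add]; congr 2; omega
    have h4 : ρ ^ (D * (M - i)) * (ρ⁻¹) ^ (D * (M - i)) = 1 := by
      rw [← mul_pow, mul_inv_cancel₀ h0.ne', one_pow]
    calc 1 * (L * (C * ρ ^ (D * e))) * (ρ⁻¹) ^ (D * (M - i))
        = L * C * ρ ^ (D * i) * ρ ^ (D * (2 * g)) *
          (ρ ^ (D * (M - i)) * (ρ⁻¹) ^ (D * (M - i))) := by rw [h3]; ring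
      _ ≤ L * C * ρ ^ (D * i) * 1 * 1 := by
          rw [h4]; gcongr; exact pow_le_one₀ h0.le h1
      _ = L * C * ρ ^ (D * i) := by ring
  · have h3 := natDegree_primitiveAtInfinity_le (K := K) g e ψ H
    rw [coeff_eq_zero_of_natDegree_lt (h3.trans_lt (not_le.1 hi))]
    exact .zero (by positivity) h0.le

end BoundsAtInfinity

/-! ### Reduction of single forms with a pole at infinity. -/

namespace Polynomial

section DigitSeries

variable {K : Type*} [Field K] [CharZero K] {A : Type*} [CommRing A] [Algebra K A] {q : A[X]}

variable (K) in
/-- The numerators of the derivative of `∑_k t_k / √q ^ k`. -/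
def seriesDeriv (q : A[X]) (t : ℤ → A[X]) (l : ℤ) : A[X] :=
  derivHead q (l : K) (t l) + derivTail q ((l : K) - 2) (t (l - 2))

/-- The numerators of the expansion of `F / √q ^ n` in base `q`. -/
def digitSeries (q : A[X]) (n : ℤ) (F : A[X]) (l : ℤ) : A[X] :=
  if l ≤ n ∧ 2 ∣ n - l then digit q ((n - l) / 2).toNat F else 0

theorem digitSeries_sub (n : ℤ) (F : A[X]) (j : ℕ) :
    digitSeries q n F (n - 2 * j) = digit q j F := by
  rw [digitSeries, if_pos ⟨by omega, ⟨j, by ring⟩⟩]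
  congr 2
  omega

theorem digitSeries_eq_zero {n l : ℤ} (F : A[X]) (h : ∀ j : ℕ, l ≠ n - 2 * j) :
    digitSeries q n F l = 0 := by
  rw [digitSeries, if_neg]
  rintro ⟨h1, z, hz⟩
  exact h z.toNat (by omega)

/-- Termwise differentiation of the expansion of F/√q^n agrees with differentiating first and
expanding afterwards, so primitives may be sought as single quotients. -/
theorem seriesDeriv_digitSeries (hq : q.Monic) (n : ℤ) (F : A[X]) :
    seriesDeriv K q (digitSeries q n F) =
      digitSeries q (n + 2) (derivNumerator q (n : K) F) := by
  funext l
  by_cases h : ∃ j : ℕ, l = n + 2 - 2 * j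
  · obtain ⟨j, rfl⟩ := h
    rw [digitSeries_sub, seriesDeriv]
    have h1 : n + 2 - 2 * (j : ℤ) - 2 = n - 2 * j := by ring
    rw [h1, digitSeries_sub]
    cases j with
    | zero =>
      rw [digitSeries_eq_zero F (by intro j; push_cast; omega), map_zero, zero_add,
        digit_zero_derivNumerator hq]
      congr 1; congr 1
      push_cast; ring
    | succ j =>
      have h2 : n + 2 - 2 * ((j + 1 : ℕ) : ℤ) = n - 2 * j := by push_cast; ring
      rw [h2, digitSeries_sub, digit_succ_derivNumerator hq]
      push_cast
      rfl
  · rw [not_exists] at h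
    rw [digitSeries_eq_zero _ h, seriesDeriv,
      digitSeries_eq_zero F (fun j hj => h (j + 1) (by push_cast; omega)),
      digitSeries_eq_zero F (fun j hj => h j (by omega)), map_zero, map_zero, add_zero]

theorem degree_digitSeries_lt [Nontrivial A] (hq : q.Monic) (n l : ℤ) (F : A[X]) :
    (digitSeries q n F l).degree < q.degree := by
  rw [digitSeries]
  split_ifs
  · exact degree_digit_lt hq _ _
  · rw [degree_zero, degree_eq_natDegree hq.ne_zero]; exact WithBot.bot_lt_coe _

variable (K) in
/-- `τ` is a primitive of `X ^ i / √q ^ k` up to terms `X ^ j / √q` with `j < 2 * g` and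
`X ^ j / q` with `j ≤ 2 * g`. -/
structure IsReduction (q : A[X]) (g : ℕ) (k : ℤ) (i : ℕ) (τ : ℤ → A[X]) : Prop where
  degree_lt : ∀ l, (τ l).degree < (2 * g + 1 : ℕ)
  eq_zero : ∀ l : ℤ, k.natAbs + 2 < l.natAbs → τ l = 0
  deriv_eq : ∀ l, l ≠ 1 → l ≠ 2 →
    seriesDeriv K q τ l = (Pi.single k (X ^ i) : ℤ → A[X]) l
  coeff_eq : (seriesDeriv K q τ 1).coeff (2 * g) =
    ((Pi.single k (X ^ i) : ℤ → A[X]) 1).coeff (2 * g)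

variable {g : ℕ}

/-- The form is the polynomial q^m X^i, and its reduction leaves no remainder at all. -/
theorem isReduction_primitive [Nontrivial A] (hq : q.Monic) (hg : q.natDegree = 2 * g + 1)
    (m i : ℕ) (hi : i ≤ 2 * g) :
    IsReduction K q g (-2 * m) i (digitSeries q 0 (primitive K (q ^ m * X ^ i))) := by
  have hqd : q.degree = (2 * g + 1 : ℕ) := by rw [degree_eq_natDegree hq.ne_zero, hg]
  have hXi : (X ^ i : A[X]).degree < q.degree := by
    rw [hqd]; exact (degree_X_pow_le i).trans_lt (by exact_mod_cast Nat.lt_succ_of_le hi)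
  have hderiv : seriesDeriv K q (digitSeries q 0 (primitive K (q ^ m * X ^ i))) =
      digitSeries q 2 (q ^ (m + 1) * X ^ i) := by
    rw [seriesDeriv_digitSeries hq]
    congr 1
    rw [derivNumerator, derivative_primitive]
    simp only [Int.cast_zero, zero_div, zero_smul, sub_zero]
    ring
  have heq : ∀ l, digitSeries q 2 (q ^ (m + 1) * X ^ i) l =
      (Pi.single (-2 * (m : ℤ)) (X ^ i) : ℤ → A[X]) l := by
    intro l
    by_cases h : ∃ j : ℕ, l = 2 - 2 * j
    · obtain ⟨j, rfl⟩ := h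
      rw [digitSeries_sub, digit_pow_mul hq hXi]
      by_cases hj : j = m + 1
      · subst hj
        rw [if_pos rfl]
        have : (2 - 2 * ((m + 1 : ℕ) : ℤ)) = -2 * (m : ℤ) := by push_cast; ring
        rw [this, Pi.single_eq_same]
      · rw [if_neg hj, Pi.single_eq_of_ne (by omega)]
    · rw [not_exists] at h
      rw [digitSeries_eq_zero _ h, Pi.single_eq_of_ne]
      intro hl
      exact h (m + 1) (by push_cast; omega)
  refine ⟨fun l => ?_, fun l hl => ?_, fun l _ _ => ?_, ?_⟩
  · rw [← hqd]; exact degree_digitSeries_lt hq _ _ _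
  · by_cases h : ∃ j : ℕ, l = 0 - 2 * j
    · obtain ⟨j, rfl⟩ := h
      rw [digitSeries_sub]
      apply digit_eq_zero hq
      refine degree_le_natDegree.trans_lt ?_
      have h1 := natDegree_primitive_le (K := K) (q ^ m * X ^ i)
      have h2 := natDegree_mul_le (p := q ^ m) (q := X ^ i)
      have h3 : (q ^ m).natDegree = m * (2 * g + 1) := by rw [hq.natDegree_pow, hg]
      have h4 := natDegree_X_pow_le (R := A) i
      have h5 : m + 2 ≤ j := by omega
      have h6 : (m + 2) * (2 * g + 1) ≤ j * (2 * g + 1) := Nat.mul_le_mul_right _ h5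
      have h7 : (m + 2) * (2 * g + 1) = m * (2 * g + 1) + 2 * (2 * g + 1) := by ring
      rw [hg]
      exact_mod_cast (by omega : (primitive K (q ^ m * X ^ i)).natDegree < j * (2 * g + 1))
    · exact digitSeries_eq_zero _ (not_exists.1 h)
  · rw [hderiv, heq]
  · rw [hderiv, heq]

/-- The form is q^m X^i/√q. The derivative of F√q matches it in degrees at least 2g, so the
difference `Z` has degree below 2g. It is a single digit, over √q, and is basic. -/
theorem isReduction_primitiveAtInfinity [Nontrivial A] (hq : q.Monic)
    (hg : q.natDegree = 2 * g + 1) (m i : ℕ) (hi : i ≤ 2 * g) {v ψ : PowerSeries A}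
    (hv : v * v = ((reflect (2 * g + 1) q : A[X]) : PowerSeries A)) (hψ : v * ψ = 1) :
    IsReduction K q g (1 - 2 * m) i (digitSeries q (-1)
      (primitiveAtInfinity K g (m * (2 * g + 1) + 2 * g) ψ (q ^ m * X ^ i))) := by
  set e := m * (2 * g + 1) + 2 * g with he
  have hqd : q.degree = (2 * g + 1 : ℕ) := by rw [degree_eq_natDegree hq.ne_zero, hg]
  have hXi : (X ^ i : A[X]).degree < q.degree := by
    rw [hqd]; exact (degree_X_pow_le i).trans_lt (by exact_mod_cast Nat.lt_succ_of_le hi)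
  have hH : (q ^ m * X ^ i).natDegree ≤ e := by
    have h2 := natDegree_mul_le (p := q ^ m) (q := X ^ i)
    have h3 : (q ^ m).natDegree = m * (2 * g + 1) := by rw [hq.natDegree_pow, hg]
    have h4 := natDegree_X_pow_le (R := A) i
    omega
  set F := primitiveAtInfinity K g e ψ (q ^ m * X ^ i) with hF
  set Z := derivNumerator q (-1 : K) F - q ^ m * X ^ i with hZ
  have hZ0 : ∀ s, 2 * g ≤ s → Z.coeff s = 0 := fun s hs => by
    rw [hZ, coeff_sub, hF, coeff_derivNumerator_primitiveAtInfinity hg (by omega) hH hv hψ hs,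
      sub_self]
  have hZd : Z.degree < q.degree := by
    rw [hqd, degree_lt_iff_coeff_zero]
    exact fun s hs => hZ0 s (by omega)
  have hN : derivNumerator q (-1 : K) F = q ^ m * X ^ i + Z := by rw [hZ]; ring
  have hderiv : seriesDeriv K q (digitSeries q (-1) F) =
      digitSeries q 1 (q ^ m * X ^ i + Z) := by
    rw [seriesDeriv_digitSeries hq, ← hN]
    push_cast
    rfl
  have hdig : ∀ j : ℕ, digit q j (q ^ m * X ^ i + Z) =
      (Pi.single (1 - 2 * (m : ℤ)) (X ^ i) : ℤ → A[X]) (1 - 2 * j) +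
        if j = 0 then Z else 0 := by
    intro j
    rw [map_add, digit_pow_mul hq hXi]
    congr 1
    · by_cases hj : j = m
      · rw [hj, if_pos rfl, Pi.single_eq_same]
      · rw [if_neg hj, Pi.single_eq_of_ne (by omega)]
    · cases j with
      | zero => rw [digit_zero_of_degree_lt hq hZd, if_pos rfl]
      | succ j => rw [digit_succ_of_degree_lt hq hZd, if_neg (Nat.succ_ne_zero j)]
  refine ⟨fun l => ?_, fun l hl => ?_, fun l hl1 _ => ?_, ?_⟩
  · rw [← hqd]; exact degree_digitSeries_lt hq _ _ _
  · by_cases h : ∃ j : ℕ, l = -1 - 2 * j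
    · obtain ⟨j, rfl⟩ := h
      rw [digitSeries_sub]
      apply digit_eq_zero hq
      refine degree_le_natDegree.trans_lt ?_
      have h1 : F.natDegree ≤ e - 2 * g := natDegree_primitiveAtInfinity_le g e ψ _
      have h5 : m + 1 ≤ j := by omega
      have h6 : (m + 1) * (2 * g + 1) ≤ j * (2 * g + 1) := Nat.mul_le_mul_right _ h5
      have h7 : (m + 1) * (2 * g + 1) = m * (2 * g + 1) + (2 * g + 1) := by ring
      rw [hg]
      exact_mod_cast (by omega : F.natDegree < j * (2 * g + 1))
    · exact digitSeries_eq_zero _ (not_exists.1 h)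
  · rw [hderiv]
    by_cases h : ∃ j : ℕ, l = 1 - 2 * j
    · obtain ⟨j, rfl⟩ := h
      rw [digitSeries_sub, hdig, if_neg (by rintro rfl; simp at hl1), add_zero]
    · rw [not_exists] at h
      rw [digitSeries_eq_zero _ h, Pi.single_eq_of_ne (h m)]
  · rw [hderiv]
    have h1 := digitSeries_sub (q := q) 1 (q ^ m * X ^ i + Z) 0
    have h2 := hdig 0
    simp only [Nat.cast_zero, mul_zero, sub_zero, if_true] at h1 h2
    rw [h1, h2, coeff_add, hZ0 _ le_rfl, add_zero]

end DigitSeries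

section Bounds

variable {K : Type*} [NormedField K] [IsUltrametricDist K] [CharZero K]
  {q : (PowerSeries K)[X]} {g : ℕ}

theorem digitSeries_bound {R : K[X]} {D : ℕ} {ρ C : ℝ} {F : (PowerSeries K)[X]} (hq : q.Monic)
    (hqb : WeightedBound R D ρ ((ρ⁻¹) ^ (D * q.natDegree)) q) (h0 : 0 < ρ) (h1 : ρ ≤ 1)
    (hF : WeightedBound R D ρ C F) (n l : ℤ) (i : ℕ) :
    HasOverconvergentExpansion R C ρ ((digitSeries q n F l).coeff i) := by
  rw [digitSeries]
  split_ifs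
  · exact (WeightedBound.digit hq hqb h0 h1 hF _).coeff h0.le h1 i
  · rw [coeff_zero]; exact .zero hF.nonneg h0.le

/-- Reduction of forms with a pole at infinity, with bounds. -/
theorem exists_reduction_of_le_one (hq : q.Monic) (hg : q.natDegree = 2 * g + 1)
    (h2 : ‖(2 : K)‖ = 1) (hinv : ∀ n : ℕ, n ≠ 0 → ‖(n : K)⁻¹‖ ≤ n) {k : ℤ} (hk : k ≤ 1) {i : ℕ}
    (hi : i ≤ 2 * g) :
    ∃ τ, IsReduction K q g k i τ ∧ ∀ (R : K[X]) (D : ℕ) (ρ : ℝ), 0 < ρ → ρ ≤ 1 →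
      WeightedBound R D ρ ((ρ⁻¹) ^ (D * (2 * g + 1))) q → ∀ l n,
      HasOverconvergentExpansion R ((4 * (2 * g + 1) * (k.natAbs + 1) : ℕ) *
        (ρ⁻¹) ^ (4 * (2 * g + 1) * D * (k.natAbs + 1))) ρ ((τ l).coeff n) := by
  have hWB : ∀ (m : ℕ) (R : K[X]) (D : ℕ) (ρ : ℝ), 0 < ρ → ρ ≤ 1 →
      WeightedBound R D ρ ((ρ⁻¹) ^ (D * (2 * g + 1))) q →
      WeightedBound R D ρ ((ρ⁻¹) ^ (D * ((2 * g + 1) * (m + 1)))) (q ^ m * X ^ i) := by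
    intro m R D ρ h0 h1 hqb
    refine ((hqb.pow h0 m).mul (WeightedBound.X_pow h0 i) h0.le).mono ?_ h0.le
    rw [← pow_mul, ← pow_add]
    refine pow_le_pow_right₀ ((one_le_inv₀ h0).2 h1) ?_
    have : D * i ≤ D * (2 * g + 1) := Nat.mul_le_mul_left _ (by omega)
    calc _ ≤ D * (2 * g + 1) * m + D * (2 * g + 1) := by omega
      _ = _ := by ring
  rcases Int.even_or_odd' k with ⟨z, rfl | rfl⟩
  · obtain ⟨m, rfl⟩ : ∃ m : ℕ, z = -m := ⟨(-z).toNat, by omega⟩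
    have hk' : 2 * -(m : ℤ) = -2 * m := by ring
    rw [hk']
    refine ⟨_, isReduction_primitive hq hg m i hi, fun R D ρ h0 h1 hqb l n => ?_⟩
    have hna : (-2 * (m : ℤ)).natAbs = 2 * m := by omega
    rw [hna]
    have hdeg : (q ^ m * X ^ i).natDegree + 1 ≤ (2 * g + 1) * (m + 1) := by
      have h2 := natDegree_mul_le (p := q ^ m) (q := X ^ i)
      have h3 : (q ^ m).natDegree = m * (2 * g + 1) := by rw [hq.natDegree_pow, hg]
      have h4 := natDegree_X_pow_le (R := PowerSeries K) i
      have : (2 * g + 1) * (m + 1) = m * (2 * g + 1) + (2 * g + 1) := by ring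
      omega
    have hF := (hWB m R D ρ h0 h1 hqb).primitive (L := ((2 * g + 1) * (m + 1) : ℕ)) h0
      (Nat.cast_nonneg _) (fun j hj => (hinv _ (Nat.succ_ne_zero j)).trans
        (by exact_mod_cast (by omega : j + 1 ≤ (2 * g + 1) * (m + 1))))
    refine (digitSeries_bound hq (by rwa [hg]) h0 h1 hF _ _ _).mono_const ?_ h0.le
    rw [mul_assoc, ← pow_add]
    have hρ : 1 ≤ ρ⁻¹ := (one_le_inv₀ h0).2 h1
    gcongr ?_ * ?_
    · exact_mod_cast (by nlinarith : (2 * g + 1) * (m + 1) ≤ 4 * (2 * g + 1) * (2 * m + 1))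
    · refine pow_le_pow_right₀ hρ ?_
      have h5 : (2 * g + 1) * (m + 1) + 1 ≤ 4 * (2 * g + 1) * (2 * m + 1) := by nlinarith
      calc _ = D * ((2 * g + 1) * (m + 1) + 1) := by ring
        _ ≤ D * (4 * (2 * g + 1) * (2 * m + 1)) := Nat.mul_le_mul_left _ h5
        _ = _ := by ring
  · obtain ⟨m, rfl⟩ : ∃ m : ℕ, z = -m := ⟨(-z).toNat, by omega⟩
    have hk' : 2 * -(m : ℤ) + 1 = 1 - 2 * m := by ring
    rw [hk']
    have hcc : PowerSeries.constantCoeff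
        ((reflect (2 * g + 1) q : (PowerSeries K)[X]) : PowerSeries (PowerSeries K)) = 1 := by
      rw [Polynomial.constantCoeff_coe, coeff_reflect, revAt_le (Nat.zero_le _), Nat.sub_zero,
        ← hg, coeff_natDegree, hq.leadingCoeff]
    obtain ⟨v, hv1, hv⟩ := PowerSeries.exists_sq_eq (K := K) _ hcc
    obtain ⟨ψ, hψ⟩ : ∃ ψ, v * ψ = 1 := by
      have : IsUnit v := PowerSeries.isUnit_iff_constantCoeff.2 (by rw [hv1]; exact isUnit_one)
      exact this.exists_right_inv
    refine ⟨_, isReduction_primitiveAtInfinity hq hg m i hi hv hψ,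
      fun R D ρ h0 h1 hqb l n => ?_⟩
    have hna : m ≤ (1 - 2 * (m : ℤ)).natAbs := by omega
    set N := (1 - 2 * (m : ℤ)).natAbs
    -- The denominators are the odd numbers 2j+1 with j ≤ e; `L` is a crude common bound, linear in
    -- |k|.
    have hF := WeightedBound.primitiveAtInfinity (e := m * (2 * g + 1) + 2 * g)
      (L := (4 * (2 * g + 1) * (N + 1) : ℕ)) h2 h0 h1 hqb (hWB m R D ρ h0 h1 hqb) (by omega) (Nat.cast_nonneg _)
      (fun j hj => (hinv _ (Nat.succ_ne_zero _)).trans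
        (by
          have h6 : m * (2 * g + 1) ≤ N * (2 * g + 1) := Nat.mul_le_mul_right _ hna
          have h7 : 4 * (2 * g + 1) * (N + 1) = 4 * (N * (2 * g + 1)) + 4 * (2 * g + 1) := by ring
          exact_mod_cast (by omega : 2 * j + 1 ≤ 4 * (2 * g + 1) * (N + 1)))) hv1 hv hψ
    refine (digitSeries_bound hq (by rwa [hg]) h0 h1 hF _ _ _).mono_const ?_ h0.le
    have hρ : 1 ≤ ρ⁻¹ := (one_le_inv₀ h0).2 h1
    gcongr ?_ * ?_
    refine pow_le_pow_right₀ hρ ?_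
    have h5 : (2 * g + 1) * (m + 1) ≤ 4 * (2 * g + 1) * (N + 1) := by nlinarith
    calc _ = D * ((2 * g + 1) * (m + 1)) := by ring
      _ ≤ D * (4 * (2 * g + 1) * (N + 1)) := Nat.mul_le_mul_left _ h5
      _ = _ := by ring

end Bounds

end Polynomial

namespace Polynomial

/-! ### Degrees in Γ, and reduction of poles along q = 0. -/

section InnerDegree

variable {K : Type*} [Field K]

/-- All coefficients of `F` have degree at most `n` in the inner variable. -/
def InnerDegreeLE (n : ℕ) (F : K[X][X]) : Prop := ∀ i, (F.coeff i).natDegree ≤ n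

namespace InnerDegreeLE

variable {n m : ℕ} {F G : K[X][X]}

theorem mono (h : InnerDegreeLE n F) (hnm : n ≤ m) : InnerDegreeLE m F :=
  fun i => (h i).trans hnm

theorem add (h : InnerDegreeLE n F) (h' : InnerDegreeLE n G) : InnerDegreeLE n (F + G) :=
  fun i => by rw [coeff_add]; exact natDegree_add_le_of_degree_le (h i) (h' i)

theorem smul (h : InnerDegreeLE n F) (c : K) : InnerDegreeLE n (c • F) :=
  fun i => by rw [coeff_smul]; exact (natDegree_smul_le c _).trans (h i)

theorem X_pow (i : ℕ) : InnerDegreeLE n (X ^ i : K[X][X]) := fun j => by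
  rw [coeff_X_pow]; split_ifs <;> simp

end InnerDegreeLE

theorem exists_innerDegreeLE (F : K[X][X]) : ∃ n, InnerDegreeLE n F := by
  refine ⟨F.support.sup fun i => (F.coeff i).natDegree, fun i => ?_⟩
  by_cases hi : i ∈ F.support
  · exact Finset.le_sup (f := fun i => (F.coeff i).natDegree) hi
  · rw [notMem_support_iff.1 hi]; simp

/-- On polynomials of degree below d in X, a K[Γ]-linear map is given by finitely many polynomials
in Γ, and their largest degree is the growth. -/
theorem exists_innerDegreeLE_map (T : K[X][X] →ₗ[K[X]] K[X][X]) (d : ℕ) :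
    ∃ c, ∀ (n : ℕ) (f : K[X][X]), f.degree < (d : ℕ) → InnerDegreeLE n f → InnerDegreeLE (n + c) (T f) := by
  choose e he using fun i : ℕ => exists_innerDegreeLE (T (X ^ i))
  refine ⟨(Finset.range d).sup e, fun n f hf hn j => ?_⟩
  have hf' : f = ∑ i ∈ Finset.range d, f.coeff i • (X : K[X][X]) ^ i := by
    by_cases h0 : f = 0
    · simp [h0]
    conv_lhs => rw [f.as_sum_range_C_mul_X_pow' ((natDegree_lt_iff_degree_lt h0).2 hf)]
    simp only [smul_eq_C_mul]
  rw [hf', map_sum, finsetSum_coeff]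
  refine natDegree_sum_le_of_forall_le _ _ fun i hi => ?_
  rw [map_smul, coeff_smul, smul_eq_mul]
  refine natDegree_mul_le.trans (add_le_add (hn i) ((he i j).trans ?_))
  exact Finset.le_sup hi

end InnerDegree

section Pole

variable {K : Type*} [Field K] [CharZero K] {A : Type*} [CommRing A] [Algebra K A]
  {q U V : A[X]} {r : A} {g : ℕ}

theorem digit_pow_mul_of_lt (hq : q.Monic) {n j : ℕ} (hj : j < n) (G : A[X]) :
    digit q j (q ^ n * G) = 0 := by
  induction n generalizing j with
  | zero => omega
  | succ n ih =>
    rw [pow_succ', mul_assoc]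
    cases j with
    | zero => rw [digit_zero, self_mul_modByMonic hq]
    | succ j => rw [digit_succ, mul_divByMonic_cancel_left _ hq, ih (by omega)]

/-- The degree of F in X is not controlled, so its expansion is cut off below √q. Numerators over
√q^l with l ≥ 3 are unaffected. The error q^n G contributes only at l ≤ 2, and over √q the cut
leaves a head alone, which has degree below 2g. -/
theorem isReduction_of_pole [Nontrivial A] (hq : q.Monic) (hg : q.natDegree = 2 * g + 1)
    {n e i : ℕ} (hn : 1 ≤ n) (he : e = 1 ∨ e = 2) (hi : i ≤ 2 * g) {F G : A[X]}
    (hF : X ^ i = derivNumerator q ((2 * n + e : ℕ) - 2 : K) F + q ^ n * G) :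
    IsReduction K q g (2 * n + e : ℕ) i
      (fun l => if 1 ≤ l then digitSeries q ((2 * n + e : ℕ) - 2 : ℤ) F l else 0) := by
  set k : ℕ := 2 * n + e with hk
  have hqd : q.degree = (2 * g + 1 : ℕ) := by rw [degree_eq_natDegree hq.ne_zero, hg]
  have hXi : (X ^ i : A[X]).degree < q.degree := by
    rw [hqd]; exact (degree_X_pow_le i).trans_lt (by exact_mod_cast Nat.lt_succ_of_le hi)
  have hderiv : seriesDeriv K q (digitSeries q ((k : ℤ) - 2) F) =
      digitSeries q k (X ^ i - q ^ n * G) := by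
    rw [seriesDeriv_digitSeries hq, sub_add_cancel]
    congr 1
    rw [hF]; push_cast; ring
  refine ⟨fun l => ?_, fun l hl => ?_, fun l hl1 hl2 => ?_, ?_⟩
  · split_ifs
    · rw [← hqd]; exact degree_digitSeries_lt hq _ _ _
    · rw [degree_zero]; exact WithBot.bot_lt_coe _
  · split_ifs with h
    · exact digitSeries_eq_zero _ fun j => by omega
    · rfl
  · by_cases hl : 3 ≤ l
    · have h1 := congrFun hderiv l
      rw [seriesDeriv] at h1 ⊢
      rw [if_pos (by omega), if_pos (by omega), h1]
      by_cases h : ∃ j : ℕ, l = k - 2 * j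
      · obtain ⟨j, rfl⟩ := h
        rw [digitSeries_sub, map_sub, digit_pow_mul_of_lt hq (by omega), sub_zero]
        have h2 := digit_pow_mul hq hXi 0 j
        rw [pow_zero, one_mul] at h2
        rw [h2]
        by_cases hj : j = 0
        · subst hj; simp
        · rw [if_neg hj, Pi.single_eq_of_ne (by omega)]
      · rw [not_exists] at h
        rw [digitSeries_eq_zero _ h, Pi.single_eq_of_ne]
        intro hl'
        exact h 0 (by simpa using hl')
    · rw [seriesDeriv, if_neg (by omega), if_neg (by omega), map_zero, map_zero, add_zero,
        Pi.single_eq_of_ne (by omega)]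
  · have h1 : ((Pi.single (k : ℤ) (X ^ i) : ℤ → A[X]) 1) = 0 :=
      Pi.single_eq_of_ne (by omega) _
    rw [h1, seriesDeriv, if_pos le_rfl, if_neg (by norm_num), map_zero, add_zero, coeff_zero]
    apply coeff_eq_zero_of_degree_lt
    refine degree_derivHead_lt hq hg _ ?_
    have := degree_digitSeries_lt hq ((k : ℤ) - 2) 1 F
    rwa [hqd] at this

/-- The digits of a primitive satisfy a recursion, which can be solved with denominators that are
powers of `r`. -/
theorem smul_digit_eq (hq : q.Monic) (h : U * q + V * derivative q = C r) (c : K)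
    (F : A[X]) (j : ℕ) (hc : c - 2 * (j + 1 : ℕ) ≠ 0)
    (hz : digit q (j + 1) (derivNumerator q c F) = 0) :
    r • digit q (j + 1) F = (2 / (c - 2 * (j + 1 : ℕ))) •
      ((V * derivHead q (c - 2 * j) (digit q j F)) %ₘ q) := by
  nontriviality A
  have h1 := modByMonic_mul_derivTail hq h (c - 2 * (j + 1 : ℕ)) (degree_digit_lt hq (j + 1) F)
  rw [digit_succ_derivNumerator hq] at hz
  have h2 : c - 2 * j - 2 = c - 2 * (j + 1 : ℕ) := by push_cast; ring
  rw [h2] at hz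
  rw [eq_neg_of_add_eq_zero_right hz, mul_neg, neg_modByMonic, neg_smul, neg_inj] at h1
  rw [h1, smul_smul, div_mul_div_comm, mul_comm, div_self (mul_ne_zero hc two_ne_zero), one_smul]

theorem smul_digit_zero_eq (hq : q.Monic) (h : U * q + V * derivative q = C r) {c : K} (hc : c ≠ 0)
    (F : A[X]) : r • digit q 0 F = (-(2 / c)) •
      ((V * digit q 0 (derivNumerator q c F)) %ₘ q) := by
  nontriviality A
  have h1 := modByMonic_mul_derivTail hq h c (degree_digit_lt hq 0 F)
  rw [digit_zero_derivNumerator hq, h1, smul_smul, neg_mul_neg, div_mul_div_comm, mul_comm,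
    div_self (mul_ne_zero hc two_ne_zero), one_smul]

end Pole

/-! ### Bounds for the reduction of poles of order at least three. -/

section PoleBounds

variable {K : Type*} [NormedField K] [IsUltrametricDist K]

/-- Polynomials with integral coefficients as power series over the field. -/
def integralToPowerSeries (K : Type*) [NormedField K] [IsUltrametricDist K] :
    (integerRing K)[X] →+* PowerSeries K :=
  (Polynomial.coeToPowerSeries.ringHom (R := K)).comp
    (mapRingHom (algebraMap (integerRing K) K))

theorem norm_integer_le_one (x : integerRing K) : ‖(x : K)‖ ≤ 1 := x.2

theorem coeffBound_map_integer (s : PowerSeries (integerRing K)) :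
    PowerSeries.CoeffBound 1 (PowerSeries.map (algebraMap (integerRing K) K) s) := fun n => by
  rw [PowerSeries.coeff_map]; exact norm_integer_le_one _

theorem integralToPowerSeries_eq (f : (integerRing K)[X]) :
    integralToPowerSeries K f =
      PowerSeries.map (algebraMap (integerRing K) K) (f : PowerSeries (integerRing K)) := by
  ext n
  simp [integralToPowerSeries]

theorem coeffBound_integral (f : (integerRing K)[X]) :
    PowerSeries.CoeffBound 1 (integralToPowerSeries K f) := by
  rw [integralToPowerSeries_eq]; exact coeffBound_map_integer _

variable [CharZero K] {g : ℕ}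

/-- Existence of primitives with controlled denominators, over power series. -/
theorem exists_bounded_primitive {Q U V : (integerRing K)[X][X]} {r : (integerRing K)[X]}
    (hQ : Q.Monic) (h : U * Q + V * derivative Q = C r) (hr : IsUnit (r.coeff 0))
    (h2 : ‖(2 : K)‖ = 1) (hinv : ∀ n : ℕ, n ≠ 0 → ‖(n : K)⁻¹‖ ≤ n) {n e i : ℕ}
    (he : e = 1 ∨ e = 2) :
    ∃ F G : (PowerSeries K)[X], X ^ i =
      derivNumerator (Q.map (integralToPowerSeries K)) ((2 * n + e : ℕ) - 2 : K) F +
        (Q.map (integralToPowerSeries K)) ^ n * G ∧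
      ∀ j l, PowerSeries.CoeffBound (2 * n + e : ℕ)
        ((digit (Q.map (integralToPowerSeries K)) j F).coeff l) := by
  set ι : (integerRing K)[X] →+* PowerSeries (integerRing K) :=
    Polynomial.coeToPowerSeries.ringHom with hι
  set κ : PowerSeries (integerRing K) →+* PowerSeries K :=
    PowerSeries.map (algebraMap (integerRing K) K) with hκ
  have hcomp : integralToPowerSeries K = κ.comp ι := by
    exact RingHom.ext integralToPowerSeries_eq
  -- Over integral power series in Γ the resultant is invertible, so the Bezout relation can be
  -- normalised to 1 without leaving the integral ring.
  have hu : IsUnit (ι r) := by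
    rw [PowerSeries.isUnit_iff_constantCoeff]
    simpa [hι] using! hr
  obtain ⟨s, hs⟩ := hu.exists_left_inv
  have h1 : (C s * U.map ι) * Q.map ι + (C s * V.map ι) * derivative (Q.map ι) = 1 := by
    have h2 := congrArg (Polynomial.map ι) h
    rw [Polynomial.map_add, Polynomial.map_mul, Polynomial.map_mul, map_C,
      ← derivative_map] at h2
    have h3 : C s * C (ι r) = (1 : (PowerSeries (integerRing K))[X]) := by
      rw [← C_mul, hs, C_1]
    linear_combination C s * h2 + h3
  obtain ⟨b, G, hG⟩ := exists_primitive_of_pole (K := K) h1 κ e he n (X ^ i)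
  have hQm : Q.map (integralToPowerSeries K) = (Q.map ι).map κ := by
    rw [Polynomial.map_map, hcomp]
  rw [hQm]
  refine ⟨_, G, by simpa using hG, fun j l => ?_⟩
  rw [map_sum, finsetSum_coeff]
  refine PowerSeries.CoeffBound.sum _ (Nat.cast_nonneg _) fun x hx => ?_
  have hx' : x < n := Finset.mem_range.1 hx
  rw [← algebraMap_smul (PowerSeries K), map_smul, algebraMap_smul, coeff_smul,
    ← map_digit (hQ.map ι), coeff_map]
  refine ((coeffBound_map_integer _).smul _).mono ?_
  rw [mul_one]
  -- The denominator of the summand is y = 2(n-1-x) + e, which is positive since x < n; its inverse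
  -- has norm at most y.
  obtain ⟨y, hy⟩ : ∃ y : ℕ, 2 * n + e = 2 + 2 * x + y := ⟨2 * n + e - 2 - 2 * x, by omega⟩
  have h4 : (((2 * n + e : ℕ) : K) - 2 - 2 * x) = (y : K) := by rw [hy]; push_cast; ring
  push_cast at h4
  rw [h4, div_eq_mul_inv, norm_mul, h2, one_mul]
  refine (hinv y (by omega)).trans ?_
  exact_mod_cast (by omega : y ≤ 2 * n + e)

/-- Reduction of forms with a pole of order at least `3` in `√q`, with bounds. -/
theorem exists_reduction_of_three_le {Q U V : (integerRing K)[X][X]} {r : (integerRing K)[X]}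
    (hQ : Q.Monic) (hg : Q.natDegree = 2 * g + 1) (h : U * Q + V * derivative Q = C r)
    (hr : IsUnit (r.coeff 0)) (h2 : ‖(2 : K)‖ = 1)
    (hinv : ∀ n : ℕ, n ≠ 0 → ‖(n : K)⁻¹‖ ≤ n) :
    ∃ c : ℕ, ∀ k : ℕ, 3 ≤ k → ∀ i ≤ 2 * g,
      ∃ τ, IsReduction K (Q.map (integralToPowerSeries K)) g k i τ ∧
      ∀ (R : K[X]) (ρ θ : ℝ), 0 < ρ → ρ ≤ 1 → 1 ≤ θ →
      HasOverconvergentExpansion R θ ρ (integralToPowerSeries K r)⁻¹ → ∀ l n,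
      HasOverconvergentExpansion R (k * ((ρ⁻¹) ^ (c * k) * θ ^ k)) ρ ((τ l).coeff n) := by
  set φ : K[X] →ₐ[K] PowerSeries K := Polynomial.coeToPowerSeries.algHom K with hφ
  set ι : (integerRing K)[X] →+* K[X] := mapRingHom (algebraMap (integerRing K) K) with hι
  have hφ' : ∀ f : K[X], φ f = (f : PowerSeries K) := fun f => by
    simp [hφ, Polynomial.coeToPowerSeries.algHom_apply]
  have hcomp : integralToPowerSeries K = (φ : K[X] →+* PowerSeries K).comp ι := by
    refine RingHom.ext fun f => ?_
    simp only [integralToPowerSeries, RingHom.comp_apply,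
      RingHom.coe_coe, hφ', Polynomial.coeToPowerSeries.ringHom_apply]
    rfl
  set q := Q.map (integralToPowerSeries K) with hq
  set qP := Q.map ι with hqP
  have hqPm : qP.Monic := hQ.map ι
  have hqm : q.Monic := hQ.map _
  have hqPq : qP.map (φ : K[X] →+* PowerSeries K) = q := by rw [hqP, Polynomial.map_map, hcomp.symm]
  have hqPn : qP.natDegree = 2 * g + 1 := by rw [hqP, hQ.natDegree_map, hg]
  have hqn : q.natDegree = 2 * g + 1 := by rw [hq, hQ.natDegree_map, hg]
  have hqPd : qP.degree = (2 * g + 1 : ℕ) := by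
    rw [degree_eq_natDegree hqPm.ne_zero, hqPn]
  set VP := V.map ι with hVP
  have hVPV : VP.map (φ : K[X] →+* PowerSeries K) = V.map (integralToPowerSeries K) := by
    rw [hVP, Polynomial.map_map, hcomp.symm]
  have hB : U.map (integralToPowerSeries K) * q + V.map (integralToPowerSeries K) * derivative q =
      C (integralToPowerSeries K r) := by
    have h3 := congrArg (Polynomial.map (integralToPowerSeries K)) h
    rwa [Polynomial.map_add, Polynomial.map_mul, Polynomial.map_mul, map_C,
      ← derivative_map] at h3
  set rs := integralToPowerSeries K r with hrs
  have hrs0 : PowerSeries.constantCoeff rs ≠ 0 := by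
    rw [hrs, integralToPowerSeries_eq]
    have : algebraMap (integerRing K) K (r.coeff 0) ≠ 0 := (hr.map _).ne_zero
    rwa [← PowerSeries.coeff_zero_eq_constantCoeff_apply, PowerSeries.coeff_map,
      Polynomial.coeff_coe]
  obtain ⟨c₁, hc₁⟩ := exists_innerDegreeLE_map ((modByMonicHom qP).comp
    (LinearMap.mulLeft K[X] VP)) (2 * g + 1)
  obtain ⟨c₂, hc₂⟩ := exists_innerDegreeLE_map (derivHead qP (0 : K)) (2 * g + 1)
  obtain ⟨c₃, hc₃⟩ := exists_innerDegreeLE_map ((divByMonicHom qP).comp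
    (LinearMap.mulRight K[X] (derivative qP))) (2 * g + 1)
  set c := c₁ + c₂ + c₃ with hc
  have hmod : ∀ (n : ℕ) (f : K[X][X]), f.degree < (2 * g + 1 : ℕ) → InnerDegreeLE n f →
      InnerDegreeLE (n + c₁) ((VP * f) %ₘ qP) := hc₁
  -- The scalar a multiplies only one of two fixed linear maps, so the growth of the degree is
  -- independent of a.
  have hhead : ∀ (a : K) (n : ℕ) (f : K[X][X]), f.degree < (2 * g + 1 : ℕ) → InnerDegreeLE n f →
      InnerDegreeLE (n + c₂ + c₃) (derivHead qP a f) := by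
    intro a n f hf hn
    have h3 : derivHead qP a f = derivHead qP (0 : K) f +
        (-(a / 2)) • ((f * derivative qP) /ₘ qP) := by
      rw [derivHead_apply, derivHead_apply, zero_div, zero_smul, sub_zero, neg_smul,
        sub_eq_add_neg]
    rw [h3]
    exact ((hc₂ n f hf hn).mono (by omega)).add (((hc₃ n f hf hn).mono (by omega)).smul _)
  refine ⟨c, fun k hk i hi => ?_⟩
  obtain ⟨n, e, hn, he, hke⟩ : ∃ n e, 1 ≤ n ∧ (e = 1 ∨ e = 2) ∧ k = 2 * n + e := by
    rcases Nat.even_or_odd' k with ⟨z, hz | hz⟩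
    · exact ⟨z - 1, 2, by omega, Or.inr rfl, by omega⟩
    · exact ⟨z, 1, by omega, Or.inl rfl, by omega⟩
  obtain ⟨F, G, hF, hFb⟩ := exists_bounded_primitive (i := i) hQ h hr h2 hinv (n := n) he
  rw [← hke] at hF hFb
  rw [← hq] at hF hFb
  have hXi : (X ^ i : (PowerSeries K)[X]).degree < q.degree := by
    rw [degree_eq_natDegree hqm.ne_zero, hqn]
    exact (degree_X_pow_le i).trans_lt (by exact_mod_cast Nat.lt_succ_of_le hi)
  have hNF : derivNumerator q ((k : K) - 2) F = X ^ i - q ^ n * G := by rw [hF]; ring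
  have hcast : ∀ j : ℕ, j < n → (k : K) - 2 - 2 * j ≠ 0 := by
    intro j hj
    obtain ⟨y, hy⟩ : ∃ y : ℕ, k = 2 + 2 * j + y := ⟨k - 2 - 2 * j, by omega⟩
    have h4 : ((k : K) - 2 - 2 * j) = (y : K) := by rw [hy]; push_cast; ring
    rw [h4, Nat.cast_ne_zero]; omega
  -- For j < n the error q^n G has no j-th digit, so each digit is determined by the previous one up
  -- to a division by r. This controls the degree in Γ of r^(j+1) times the digit, but not its size.
  have hrec : ∀ j, j < n → ∃ u : K[X][X], InnerDegreeLE (c * (j + 1)) u ∧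
      u.degree < (2 * g + 1 : ℕ) ∧
      u.map (φ : K[X] →+* PowerSeries K) = rs ^ (j + 1) • digit q j F := by
    intro j
    induction j with
    | zero =>
      intro hj
      have h3 := smul_digit_zero_eq hqm hB (by simpa using hcast 0 hj) F
      rw [hNF, map_sub, digit_pow_mul_of_lt hqm hj, sub_zero, digit_zero_of_degree_lt hqm hXi] at h3
      refine ⟨(-(2 / ((k : K) - 2))) • ((VP * X ^ i) %ₘ qP), ?_, ?_, ?_⟩
      · refine InnerDegreeLE.smul ((hmod 0 (X ^ i) ?_ (InnerDegreeLE.X_pow i)).mono (by omega)) _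
        exact (degree_X_pow_le i).trans_lt (by exact_mod_cast Nat.lt_succ_of_le hi)
      · refine (degree_smul_le _ _).trans_lt ?_
        rw [← hqPd]; exact degree_modByMonic_lt _ hqPm
      · rw [map_algebraMap_smul, map_modByMonic _ hqPm, hqPq, Polynomial.map_mul, hVPV,
          Polynomial.map_pow, map_X, zero_add, pow_one, h3]
    | succ j ih =>
      intro hj
      obtain ⟨u, hu1, hu2, hu3⟩ := ih (by omega)
      have hz : digit q (j + 1) (derivNumerator q ((k : K) - 2) F) = 0 := by
        rw [hNF, map_sub, digit_pow_mul_of_lt hqm hj, sub_zero, digit_succ_of_degree_lt hqm hXi]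
      have h3 := smul_digit_eq hqm hB ((k : K) - 2) F j (hcast _ hj) hz
      refine ⟨(2 / ((k : K) - 2 - 2 * (j + 1 : ℕ))) •
        ((VP * derivHead qP ((k : K) - 2 - 2 * j) u) %ₘ qP), ?_, ?_, ?_⟩
      · have h5 : (derivHead qP ((k : K) - 2 - 2 * j) u).degree < (2 * g + 1 : ℕ) :=
          (degree_derivHead_lt hqPm hqPn _ hu2).trans (by exact_mod_cast Nat.lt_succ_self _)
        refine InnerDegreeLE.smul ((hmod _ _ h5 (hhead _ _ _ hu2 hu1)).mono ?_) _
        rw [mul_add c (j + 1) 1]; omega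
      · refine (degree_smul_le _ _).trans_lt ?_
        rw [← hqPd]; exact degree_modByMonic_lt _ hqPm
      · rw [map_algebraMap_smul, map_modByMonic _ hqPm, hqPq, Polynomial.map_mul, hVPV,
          map_derivHead hqPm, hqPq, hu3, map_smul, mul_smul_comm, smul_modByMonic,
          pow_succ _ (j + 1), mul_smul, h3, smul_comm]
  have hred : IsReduction K q g k i
      (fun l => if 1 ≤ l then digitSeries q ((k : ℤ) - 2) F l else 0) := by
    rw [hke] at hF ⊢
    exact isReduction_of_pole hqm hqn hn he hi hF
  refine ⟨_, hred, ?_⟩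
  · intro R ρ θ h0 h1 hθ hrinv l m
    have hρ : 1 ≤ ρ⁻¹ := (one_le_inv₀ h0).2 h1
    have hzero : HasOverconvergentExpansion R (k * ((ρ⁻¹) ^ (c * k) * θ ^ k)) ρ
        ((0 : (PowerSeries K)[X]).coeff m) := by
      rw [coeff_zero]; exact .zero (by positivity) h0.le
    split_ifs with hl
    swap
    · exact hzero
    by_cases hj : ∃ j : ℕ, l = (k : ℤ) - 2 - 2 * j
    swap
    · rw [digitSeries_eq_zero _ (not_exists.1 hj)]; exact hzero
    obtain ⟨j, rfl⟩ := hj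
    rw [digitSeries_sub]
    have hjn : j < n := by omega
    obtain ⟨u, hu1, -, hu3⟩ := hrec j hjn
    have h5 : φ (u.coeff m) = rs ^ (j + 1) * (digit q j F).coeff m := by
      have := congrArg (fun f => f.coeff m) hu3
      simpa [coeff_smul] using this
    have h6 : (digit q j F).coeff m = φ (u.coeff m) * rs⁻¹ ^ (j + 1) := by
      rw [h5, mul_right_comm, ← mul_pow, PowerSeries.mul_inv_cancel _ hrs0, one_pow, one_mul]
    -- The size comes from the other description: r is integral, and the digits of F are bounded by
    -- k through `hFb`.
    have h7 : PowerSeries.CoeffBound (k : ℝ) (φ (u.coeff m)) := by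
      rw [h5]
      simpa using ((coeffBound_integral r).pow (j + 1)).mul (hFb j m)
    rw [h6]
    have h8 : HasOverconvergentExpansion R (k * (ρ⁻¹) ^ (c * (j + 1))) ρ (φ (u.coeff m)) := by
      rw [hφ']
      refine HasOverconvergentExpansion.coe_of_natDegree_le (hu1 m) (fun s => ?_) h0 h1
      have := h7 s
      rwa [hφ', Polynomial.coeff_coe] at this
    refine (h8.mul (hrinv.pow h0 (j + 1)) h0.le).mono_const ?_ h0.le
    rw [mul_assoc]
    have hjk : j + 1 ≤ k := by omega
    gcongr

end PoleBounds

end Polynomial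

/-! ### Norms of integers and units. -/

section Norms

theorem charZero_of_padicAlgebra (p : ℕ) [Fact p.Prime] (K : Type*) [NormedField K]
    [NormedAlgebra ℚ_[p] K] : CharZero K :=
  charZero_of_injective_algebraMap (algebraMap ℚ_[p] K).injective

theorem norm_natCast_padic (p : ℕ) [Fact p.Prime] (K : Type*) [NormedField K]
    [NormedAlgebra ℚ_[p] K] (n : ℕ) : ‖(n : K)‖ = ‖(n : ℚ_[p])‖ := by
  rw [← map_natCast (algebraMap ℚ_[p] K) n, norm_algebraMap']

theorem norm_two_eq_one {p : ℕ} [Fact p.Prime] (hp : p ≠ 2) (K : Type*) [NormedField K]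
    [NormedAlgebra ℚ_[p] K] : ‖(2 : K)‖ = 1 := by
  have h := norm_natCast_padic p K 2
  rw [Nat.cast_ofNat] at h
  rw [h]
  refine Padic.norm_natCast_eq_one_iff.2 ?_
  exact (Nat.coprime_primes Fact.out Nat.prime_two).2 hp

/-- The norm of 1/n is the exact power of p dividing n. -/
theorem norm_inv_natCast_le (p : ℕ) [Fact p.Prime] (K : Type*) [NormedField K]
    [NormedAlgebra ℚ_[p] K] {n : ℕ} (hn : n ≠ 0) : ‖(n : K)⁻¹‖ ≤ n := by
  rw [norm_inv, norm_natCast_padic p, Padic.norm_eq_zpow_neg_valuation (by exact_mod_cast hn),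
    Padic.valuation_natCast, zpow_neg, inv_inv, zpow_natCast]
  exact_mod_cast Nat.le_of_dvd (Nat.pos_of_ne_zero hn) pow_padicValNat_dvd

variable {K : Type*} [NormedField K] [IsUltrametricDist K]

theorem isUnit_integer_iff (x : integerRing K) : IsUnit x ↔ ‖(x : K)‖ = 1 := by
  constructor
  · rintro ⟨u, rfl⟩
    have h1 : ((u : integerRing K) : K) * ((u⁻¹ : (integerRing K)ˣ) : integerRing K) = 1 := by
      rw [← MulMemClass.coe_mul, Units.mul_inv, OneMemClass.coe_one]
    have h2 := norm_integer_le_one (u : integerRing K)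
    have h3 := norm_integer_le_one ((u⁻¹ : (integerRing K)ˣ) : integerRing K)
    have h4 := congrArg norm h1
    rw [norm_mul, norm_one] at h4
    nlinarith [norm_nonneg ((u : integerRing K) : K)]
  · intro h
    have h0 : (x : K) ≠ 0 := fun h0 => by simp [h0] at h
    refine IsUnit.of_mul_eq_one ⟨(x : K)⁻¹, ?_⟩ (Subtype.ext (mul_inv_cancel₀ h0))
    change ‖(x : K)⁻¹‖ ≤ 1
    rw [norm_inv, h, inv_one]

theorem norm_lt_one_of_residue_eq_zero {x : integerRing K}
    (hx : IsLocalRing.residue (integerRing K) x = 0) : ‖(x : K)‖ < 1 := by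
  rw [IsLocalRing.residue_eq_zero_iff, IsLocalRing.mem_maximalIdeal, mem_nonunits_iff,
    isUnit_integer_iff] at hx
  exact lt_of_le_of_ne (norm_integer_le_one x) hx

end Norms

/-! ### Overconvergence of 1/r in terms of 1/R. -/

section PerturbedInverse

variable {K : Type*} [NormedField K] [IsUltrametricDist K] [CompleteSpace K]

theorem exists_one_lt_pow_le {ν : ℝ} (hν : 1 < ν) (n : ℕ) : ∃ x : ℝ, 1 < x ∧ x ^ (n + 1) = ν := by
  refine ⟨ν ^ (((n + 1 : ℕ) : ℝ)⁻¹), ?_, Real.rpow_inv_natCast_pow (by linarith) n.succ_ne_zero⟩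
  exact Real.one_lt_rpow hν (by positivity)

open scoped PowerSeries.WithPiTopology in
/-- The inverse of a small perturbation of `R` is overconvergent, with norm close to `1`. -/
theorem exists_rate_inv {R r : K[X]} (hR : ∀ i, ‖R.coeff i‖ ≤ 1) (hR0 : ‖R.coeff 0‖ = 1) {δ : ℝ}
    (hδ : δ < 1) (hr : ∀ i, ‖(r - R).coeff i‖ ≤ δ) {θ : ℝ} (hθ : 1 < θ) :
    ∃ ρ₁ : ℝ, 0 < ρ₁ ∧ ρ₁ < 1 ∧ ∀ ρ, ρ₁ ≤ ρ → ρ < 1 →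
      ρ⁻¹ ≤ θ ∧ HasOverconvergentExpansion R θ ρ (r : PowerSeries K)⁻¹ := by
  have hδ0 : 0 ≤ δ := (norm_nonneg _).trans (hr 0)
  set n := (r - R).natDegree with hn
  -- The second bound ensures νδ < 1. With x the (n+1)-st root of ν, every ρ ≥ 1/x satisfies
  -- ρ^(-(n+1)) ≤ ν: n factors pay for the degree of r - R and one for 1/R.
  set ν := min θ (2 / (1 + δ)) with hν
  have hν1 : 1 < ν := lt_min hθ (by rw [lt_div_iff₀ (by linarith)]; linarith)
  have hνδ : ν * δ < 1 := by
    calc ν * δ ≤ 2 / (1 + δ) * δ := by gcongr; exact min_le_right _ _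
      _ < 1 := by rw [div_mul_eq_mul_div, div_lt_one (by linarith)]; linarith
  obtain ⟨x, hx1, hx⟩ := exists_one_lt_pow_le hν1 n
  have hx0 : 0 < x := by linarith
  refine ⟨x⁻¹, by positivity, inv_lt_one_of_one_lt₀ hx1, fun ρ hρ1 hρ2 => ?_⟩
  have h0 : 0 < ρ := lt_of_lt_of_le (by positivity) hρ1
  have hρx : ρ⁻¹ ≤ x := inv_le_of_inv_le₀ hx0 hρ1
  have hρ1' : 1 ≤ ρ⁻¹ := (one_le_inv₀ h0).2 hρ2.le
  have hpow : (ρ⁻¹) ^ (n + 1) ≤ ν := by rw [← hx]; gcongr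
  have hρθ : ρ⁻¹ ≤ θ := by
    calc ρ⁻¹ = (ρ⁻¹) ^ 1 := (pow_one _).symm
      _ ≤ (ρ⁻¹) ^ (n + 1) := pow_le_pow_right₀ hρ1' (by omega)
      _ ≤ θ := hpow.trans (min_le_left _ _)
  refine ⟨hρθ, ?_⟩
  set Rs := (R : PowerSeries K) with hRs
  have hRs0 : PowerSeries.constantCoeff Rs ≠ 0 := by
    intro h
    have : R.coeff 0 = 0 := by simpa [hRs] using! h
    simp [this] at hR0
  -- Here r = R(1 - y) with y of norm below 1, so 1/r is 1/R times a geometric series of norm at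
  -- most 1.
  set y := -((r - R : K[X]) : PowerSeries K) * Rs⁻¹ with hy
  have hyb : HasOverconvergentExpansion R (ν * δ) ρ y := by
    have h1 := HasOverconvergentExpansion.coe_of_natDegree_le (R := R) (le_refl n) hr h0 hρ2.le
    refine (h1.neg.mul (HasOverconvergentExpansion.inv h0) h0.le).mono_const ?_ h0.le
    calc δ * (ρ⁻¹) ^ n * (1 / ρ) = (ρ⁻¹) ^ (n + 1) * δ := by rw [pow_succ, one_div]; ring
      _ ≤ ν * δ := by gcongr
  have hB0 : 0 ≤ ν * δ := by positivity
  have hRb : PowerSeries.CoeffBound 1 Rs := fun i => by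
    rw [hRs, Polynomial.coeff_coe]; exact hR i
  obtain ⟨hs, hG⟩ := HasOverconvergentExpansion.tsum hRb hR0 h0 hρ2 (C := 1)
    (summable_geometric_of_lt_one hB0 hνδ) (fun i => pow_le_one₀ hB0 hνδ.le) zero_le_one
    (fun i : ℕ => hyb.pow h0 i)
  have h1 := hs.one_sub_mul_tsum_pow
  have h2 : (r : PowerSeries K) = Rs * (1 - y) := by
    rw [hy]
    have h3 : Rs * Rs⁻¹ = 1 := PowerSeries.mul_inv_cancel _ hRs0
    rw [Polynomial.coe_sub]
    linear_combination (-(r : PowerSeries K) + Rs) * h3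
  have h3 : (r : PowerSeries K)⁻¹ = Rs⁻¹ * ∑' i : ℕ, y ^ i := by
    have h5 : (r : PowerSeries K) * (Rs⁻¹ * ∑' i : ℕ, y ^ i) = 1 := by
      have h6 : Rs * Rs⁻¹ = 1 := PowerSeries.mul_inv_cancel _ hRs0
      rw [h2]
      linear_combination Rs * Rs⁻¹ * h1 + h6
    have h4 : PowerSeries.constantCoeff (r : PowerSeries K) ≠ 0 := by
      intro h
      have := congrArg PowerSeries.constantCoeff h5
      rw [map_mul, h, zero_mul, map_one] at this
      exact zero_ne_one this
    rw [PowerSeries.inv_eq_iff_mul_eq_one h4, mul_comm]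
    exact h5
  rw [h3]
  refine ((HasOverconvergentExpansion.inv h0).mul hG h0.le).mono_const ?_ h0.le
  rw [mul_one, one_div]; exact hρθ

end PerturbedInverse

/-! ### The resultant and the polynomial Q of the family. -/

namespace HyperellipticFamily

variable {K : Type*} [NormedField K] [IsUltrametricDist K] (E : HyperellipticFamily K)

/-- Resultants commute with specialisation: the residue of r(0) is the resultant of the reduction of
Q(X, 0) and its derivative, nonzero by separability. -/
theorem isUnit_coeff_zero_r : IsUnit (E.r.coeff 0) := by
  set k := IsLocalRing.ResidueField (integerRing K)
  set ψ : (integerRing K)[X] →+* k :=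
    (Polynomial.evalRingHom (0 : k)).comp
      (Polynomial.mapRingHom (IsLocalRing.residue (integerRing K))) with hψ
  have h1 : ψ E.r = IsLocalRing.residue (integerRing K) (E.r.coeff 0) := by
    rw [hψ, RingHom.comp_apply, coe_mapRingHom, coe_evalRingHom, ← coeff_zero_eq_eval_zero,
      coeff_map]
  set f := E.Q.map ψ with hf
  have hfm : f.Monic := E.monic.map ψ
  have hfd : f.natDegree = 2 * E.g + 1 := by rw [hf, E.monic.natDegree_map, E.natDegree_eq]
  have hsep : f.Separable := by
    have := E.separable
    rwa [Polynomial.map_map] at this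
  have hr : ψ E.r = resultant f (derivative f) (2 * E.g + 1) (2 * E.g) := by
    rw [HyperellipticFamily.r, ← resultant_map_map, derivative_map]
  have hne : ψ E.r ≠ 0 := by
    have hd : (derivative f).natDegree ≤ 2 * E.g := by
      have := natDegree_derivative_le f
      omega
    -- In the residue field 2g+1 may vanish, so the derivative can have degree below the formal
    -- degree 2g. Padding by e multiplies the resultant by a power of the leading coefficient of f,
    -- which is 1.
    obtain ⟨e, he⟩ := Nat.exists_eq_add_of_le hd
    have h3 := resultant_add_right_deg f (derivative f) f.natDegree (derivative f).natDegree e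
      le_rfl
    rw [← he, coeff_natDegree, hfm.leadingCoeff, one_pow, one_mul, hfd] at h3
    rw [hr, h3, ← hfd]
    exact resultant_ne_zero f (derivative f) hsep
  rw [h1, Ne, IsLocalRing.residue_eq_zero_iff, IsLocalRing.mem_maximalIdeal, mem_nonunits_iff,
    not_not] at hne
  exact hne

theorem exists_bezout : ∃ U V : (integerRing K)[X][X],
    U * E.Q + V * derivative E.Q = C E.r := by
  obtain ⟨U, V, -, -, h⟩ := exists_mul_add_mul_eq_C_resultant (m := 2 * E.g + 1) (n := 2 * E.g)
    E.Q (derivative E.Q) E.natDegree_eq.le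
    (by have := natDegree_derivative_le E.Q; rw [E.natDegree_eq] at this; exact this)
    (Or.inl (by omega))
  exact ⟨U, V, by rw [mul_comm U, mul_comm V]; exact h⟩

theorem coeff_R (i : ℕ) : E.R.coeff i = if i ≤ E.rhoPrime then (E.r.coeff i : K) else 0 := by
  rw [HyperellipticFamily.R, finsetSum_coeff]
  simp only [coeff_C_mul, coeff_X_pow, mul_ite, mul_one, mul_zero]
  rw [Finset.sum_ite_eq]
  simp

theorem norm_coeff_R_le (i : ℕ) : ‖E.R.coeff i‖ ≤ 1 := by
  rw [coeff_R]
  split_ifs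
  · exact norm_integer_le_one _
  · simp

theorem norm_coeff_zero_R : ‖E.R.coeff 0‖ = 1 := by
  rw [coeff_R, if_pos (Nat.zero_le _)]
  exact (isUnit_integer_iff _).1 E.isUnit_coeff_zero_r

/-- The coefficients of r beyond ρ' are nonunits, and there are finitely many nonzero ones, so their
norms have a maximum below 1. -/
theorem exists_norm_coeff_sub_R_le : ∃ δ < (1 : ℝ), ∀ i,
    ‖(E.r.map (algebraMap (integerRing K) K) - E.R).coeff i‖ ≤ δ := by
  set h := E.r.map (algebraMap (integerRing K) K) - E.R with hh
  have hlt : ∀ i, ‖h.coeff i‖ < 1 := by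
    intro i
    rw [hh, coeff_sub, coeff_map, coeff_R]
    split_ifs with hi
    · have : algebraMap (integerRing K) K (E.r.coeff i) - (E.r.coeff i : K) = 0 := sub_self _
      rw [this, norm_zero]; exact zero_lt_one
    · rw [sub_zero]
      apply norm_lt_one_of_residue_eq_zero
      rw [← coeff_map]
      exact coeff_eq_zero_of_natDegree_lt (not_le.1 hi)
  have hne : (Finset.range (h.natDegree + 1)).Nonempty := ⟨0, by simp⟩
  refine ⟨(Finset.range (h.natDegree + 1)).sup' hne fun i => ‖h.coeff i‖, ?_, fun i => ?_⟩
  · rw [Finset.sup'_lt_iff]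
    exact fun i _ => hlt i
  · by_cases hi : i ≤ h.natDegree
    · exact Finset.le_sup' (f := fun i => ‖h.coeff i‖) (by simpa using Nat.lt_succ_of_le hi)
    · rw [coeff_eq_zero_of_natDegree_lt (not_le.1 hi), norm_zero]
      exact (norm_nonneg _).trans
        (Finset.le_sup' (f := fun i => ‖h.coeff i‖) (b := 0) (by simp))

/-- The polynomial `Q` over the ring of power series in `Γ`. -/
def QPS : (PowerSeries K)[X] := E.Q.map (integralToPowerSeries K)

theorem QPS_monic : E.QPS.Monic := E.monic.map _

theorem QPS_natDegree : E.QPS.natDegree = 2 * E.g + 1 := by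
  rw [QPS, E.monic.natDegree_map, E.natDegree_eq]

theorem map_expansion_QS : E.QS.map (E.expansion : E.S →+* PowerSeries K) = E.QPS := by
  rw [QS, Polynomial.map_map, QPS]
  rfl

/-- Take D to be the largest degree in Γ of a coefficient of Q. Such a coefficient costs at most
ρ^(-D), and X^i with i ≤ 2g has weight smaller than that of X^(2g+1) by at least this factor. -/
theorem exists_weightedBound_QPS : ∃ D : ℕ, ∀ ρ : ℝ, 0 < ρ → ρ ≤ 1 →
    WeightedBound E.R D ρ ((ρ⁻¹) ^ (D * (2 * E.g + 1))) E.QPS := by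
  refine ⟨E.Q.support.sup fun i => (E.Q.coeff i).natDegree, fun ρ h0 h1 i => ?_⟩
  set D := E.Q.support.sup fun i => (E.Q.coeff i).natDegree with hD
  have hρ : 1 ≤ ρ⁻¹ := (one_le_inv₀ h0).2 h1
  rw [QPS, coeff_map]
  rcases lt_trichotomy i (2 * E.g + 1) with hi | rfl | hi
  · have hdeg : ((E.Q.coeff i).map (algebraMap (integerRing K) K)).natDegree ≤ D := by
      refine natDegree_map_le.trans ?_
      by_cases hs : i ∈ E.Q.support
      · exact Finset.le_sup (f := fun i => (E.Q.coeff i).natDegree) hs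
      · rw [notMem_support_iff.1 hs]; simp
    have h2 := HasOverconvergentExpansion.coe_of_natDegree_le (R := E.R) hdeg (C := 1)
      (fun j => by rw [coeff_map]; exact norm_integer_le_one _) h0 h1
    refine h2.mono_const ?_ h0.le
    have h3 : D * (2 * E.g + 1) = D * (2 * E.g + 1 - i) + D * i := by
      rw [← mul_add]; congr 1; omega
    rw [h3, pow_add, mul_assoc, ← mul_pow, inv_mul_cancel₀ h0.ne', one_pow, mul_one, one_mul]
    refine pow_le_pow_right₀ hρ ?_
    exact Nat.le_mul_of_pos_right _ (by omega)
  · have h2 : E.Q.coeff (2 * E.g + 1) = 1 := by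
      rw [← E.natDegree_eq, coeff_natDegree, E.monic.leadingCoeff]
    rw [h2, map_one, ← mul_pow, inv_mul_cancel₀ h0.ne', one_pow]
    exact .one h0
  · rw [coeff_eq_zero_of_natDegree_lt (by rw [E.natDegree_eq]; exact hi), map_zero]
    exact .zero (by positivity) h0.le

end HyperellipticFamily

/-! ### Independence modulo derivatives of finite sums. -/

section FiniteIndependence

variable {K : Type*} [Field K] [CharZero K] {A : Type*} [CommRing A] [Algebra K A] {q : A[X]}
  {g : ℕ}

theorem coeff_mul_derivative_divByMonic (hq : q.Monic) (hg : q.natDegree = 2 * g + 1) {f : A[X]}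
    {e : ℕ} (he : f.natDegree ≤ e + 1) :
    ((f * derivative q) /ₘ q).coeff e = f.coeff (e + 1) * (2 * g + 1 : ℕ) := by
  nontriviality A
  have hq' : (derivative q).natDegree ≤ 2 * g := by
    have := natDegree_derivative_le q
    omega
  have hG : ((f * derivative q) /ₘ q).natDegree ≤ e := by
    rw [natDegree_divByMonic _ hq, hg]
    have := natDegree_mul_le (p := f) (q := derivative q)
    omega
  have h1 := congrArg (fun p : A[X] => p.coeff (2 * g + 1 + e))
    (modByMonic_add_div (f * derivative q) q)
  simp only [coeff_add] at h1
  have h2 : ((f * derivative q) %ₘ q).coeff (2 * g + 1 + e) = 0 := by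
    refine coeff_eq_zero_of_degree_lt ((degree_modByMonic_lt _ hq).trans_le ?_)
    rw [degree_eq_natDegree hq.ne_zero, hg]
    exact_mod_cast Nat.le_add_right _ _
  rw [h2, zero_add, coeff_mul_add_eq_of_natDegree_le hg.le hG,
    show 2 * g + 1 + e = e + 1 + 2 * g by ring, coeff_mul_add_eq_of_natDegree_le he hq', ← hg,
    coeff_natDegree, hq.leadingCoeff, one_mul] at h1
  rw [h1, coeff_derivative, ← hg, hg, ← hg, coeff_natDegree, hq.leadingCoeff, hg]
  push_cast
  ring

theorem coeff_derivHead (hq : q.Monic) (hg : q.natDegree = 2 * g + 1) (c : K) {f : A[X]}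
    {e : ℕ} (he : f.natDegree ≤ e + 1) :
    (derivHead q c f).coeff e = ((e + 1 : ℕ) - c / 2 * (2 * g + 1 : ℕ) : K) • f.coeff (e + 1) := by
  rw [derivHead_apply, coeff_sub, coeff_smul, coeff_mul_derivative_divByMonic hq hg he,
    coeff_derivative, sub_smul, mul_smul, Nat.cast_smul_eq_nsmul, Nat.cast_smul_eq_nsmul, nsmul_eq_mul,
    nsmul_eq_mul]
  push_cast
  rw [mul_comm (f.coeff (e + 1)), mul_comm (f.coeff (e + 1))]

/-- The head multiplies a leading coefficient in degree e+1 by e + 1 - k(2g+1)/2, which is positive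
for k < 0. -/
theorem natDegree_eq_zero_of_derivHead_eq_zero [Nontrivial A] (hq : q.Monic)
    (hg : q.natDegree = 2 * g + 1) {k : ℤ} (hk : k < 0) {f : A[X]}
    (hf : derivHead q (k : K) f = 0) : f.natDegree = 0 := by
  by_contra h
  obtain ⟨e, he⟩ := Nat.exists_eq_succ_of_ne_zero h
  have h1 := coeff_derivHead hq hg (k : K) he.le
  have hne : ((e + 1 : ℕ) - (k : K) / 2 * (2 * g + 1 : ℕ) : K) ≠ 0 := by
    intro h0
    have h2 : ((2 * ((e + 1 : ℕ) : ℤ) - k * (2 * g + 1 : ℕ) : ℤ) : K) = 0 := by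
      push_cast at h0 ⊢
      linear_combination 2 * h0
    rw [Int.cast_eq_zero] at h2
    have h3 : k * ((2 * g + 1 : ℕ) : ℤ) ≤ 0 :=
      mul_nonpos_of_nonpos_of_nonneg hk.le (by positivity)
    push_cast at h2 h3
    linarith [Int.natCast_nonneg e]
  rw [hf, coeff_zero] at h1
  have h2 := (smul_eq_zero_iff_eq (Units.mk0 _ hne)).1 h1.symm
  have h3 : f.leadingCoeff = 0 := by rw [leadingCoeff, he]; exact h2
  rw [leadingCoeff_eq_zero] at h3
  simp [h3] at h

/-- A constant times q' already has degree at most 2g, so no reduction modulo q occurs. -/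
theorem coeff_derivTail_C [Nontrivial A] (hq : q.Monic) (hg : q.natDegree = 2 * g + 1) (c : K)
    (a : A) :
    (derivTail q c (C a)).coeff (2 * g) = (-(c / 2) * (2 * g + 1 : ℕ) : K) • a := by
  have h1 : (C a * derivative q) %ₘ q = C a * derivative q := by
    refine (modByMonic_eq_self_iff hq).2 ?_
    rw [← smul_eq_C_mul]
    exact (degree_smul_le _ _).trans_lt (degree_derivative_lt hq.ne_zero)
  rw [derivTail_apply, h1, coeff_smul, coeff_C_mul, coeff_derivative, ← hg, coeff_natDegree,
    hq.leadingCoeff, mul_smul, Nat.cast_smul_eq_nsmul, nsmul_eq_mul, hg]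
  push_cast
  rw [one_mul, mul_comm a]

/-- Forms `X ^ i / √q` with `i < 2 * g` and `X ^ j / q` with `j ≤ 2 * g` are independent modulo
derivatives of finite sums. -/
theorem seriesDeriv_eq_zero [IsDomain A] (hq : q.Monic) (hg : q.natDegree = 2 * g + 1)
    {U V : A[X]} {r : A} (h : U * q + V * derivative q = C r) (hr : r ≠ 0) {t : ℤ → A[X]}
    (ht : ∀ l, (t l).degree < (2 * g + 1 : ℕ)) {N : ℕ} (hN : ∀ l : ℤ, N < l.natAbs → t l = 0)
    (h0 : ∀ l, l ≠ 1 → l ≠ 2 → seriesDeriv K q t l = 0)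
    (h1 : (seriesDeriv K q t 1).coeff (2 * g) = 0) : seriesDeriv K q t = 0 := by
  have hqd : q.degree = (2 * g + 1 : ℕ) := by rw [degree_eq_natDegree hq.ne_zero, hg]
  have hcancel : ∀ {c : K} {x : A}, c ≠ 0 → c • x = 0 → x = 0 := fun hc hx =>
    (smul_eq_zero_iff_eq (Units.mk0 _ hc)).1 hx
  -- Descend from the highest pole. Over √q^(k+2) only the tail of `t k` remains, and V recovers `t
  -- k` from it up to the factor -(k/2) r.
  have hpos : ∀ n : ℕ, ∀ k : ℤ, 1 ≤ k → (N : ℤ) < k + n → t k = 0 := by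
    intro n
    induction n with
    | zero => exact fun k hk hn => hN k (by omega)
    | succ n ih =>
      intro k hk hn
      have h2 := h0 (k + 2) (by omega) (by omega)
      rw [seriesDeriv, ih (k + 2) (by omega) (by omega), map_zero, zero_add,
        show k + 2 - 2 = k by ring, show ((k + 2 : ℤ) : K) - 2 = k by push_cast; ring] at h2
      have h3 := modByMonic_mul_derivTail hq h (k : K) ((ht k).trans_eq hqd.symm)
      rw [h2, mul_zero, zero_modByMonic] at h3
      ext i
      have h4 := congrArg (fun p : A[X] => p.coeff i) h3.symm
      simp only [coeff_smul, coeff_zero] at h4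
      have hk0 : -((k : K) / 2) ≠ 0 := by
        have : (k : K) ≠ 0 := by exact_mod_cast (by omega : k ≠ 0)
        simpa using this
      exact (mul_eq_zero.1 (hcancel hk0 h4)).resolve_left hr
  -- Ascend from the most negative index. The head of `t k` vanishes, so `t k` is a constant; the
  -- coefficient of X^(2g) over √q^(k+2) then kills it. Since k ≠ 0, this place is not the
  -- unrestricted one over q.
  have hneg : ∀ n : ℕ, ∀ k : ℤ, k < 0 → k + N < n → t k = 0 := by
    intro n
    induction n with
    | zero => exact fun k hk hn => hN k (by omega)
    | succ n ih =>
      intro k hk hn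
      have h2 := h0 k (by omega) (by omega)
      rw [seriesDeriv, ih (k - 2) (by omega) (by omega), map_zero, add_zero] at h2
      have h3 := eq_C_of_natDegree_eq_zero
        (natDegree_eq_zero_of_derivHead_eq_zero (K := K) hq hg hk h2)
      have h4 : (seriesDeriv K q t (k + 2)).coeff (2 * g) = 0 := by
        by_cases hk1 : k + 2 = 1
        · rw [hk1]; exact h1
        · rw [h0 _ hk1 (by omega), coeff_zero]
      rw [seriesDeriv, coeff_add, coeff_eq_zero_of_degree_lt (degree_derivHead_lt hq hg _ (ht _)),
        zero_add, show k + 2 - 2 = k by ring, show ((k + 2 : ℤ) : K) - 2 = k by push_cast; ring,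
        h3, coeff_derivTail_C hq hg] at h4
      have hk0 : -((k : K) / 2) * (2 * g + 1 : ℕ) ≠ 0 := by
        have h5 : (k : K) ≠ 0 := by exact_mod_cast (by omega : k ≠ 0)
        have h6 : ((2 * g + 1 : ℕ) : K) ≠ 0 := by exact_mod_cast (by omega : 2 * g + 1 ≠ 0)
        exact mul_ne_zero (by simpa using h5) h6
      rw [h3, hcancel hk0 h4, C_0]
  -- Only `t 0` is left, and it may be a nonzero constant. Its tail has the factor 0, so the
  -- derivative vanishes even if `t` does not.
  have hp : ∀ k : ℤ, 1 ≤ k → t k = 0 := fun k hk => hpos N k hk (by omega)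
  have hn : ∀ k : ℤ, k < 0 → t k = 0 := fun k hk => hneg N k hk (by omega)
  funext l
  rw [Pi.zero_apply]
  by_cases hl1 : l = 1
  · rw [hl1, seriesDeriv, hp 1 le_rfl, hn (1 - 2) (by norm_num), map_zero, map_zero, add_zero]
  by_cases hl2 : l = 2
  · rw [hl2, seriesDeriv, hp 2 (by norm_num), map_zero, zero_add, derivTail_apply]
    simp
  exact h0 l hl1 hl2

theorem seriesDeriv_add (t t' : ℤ → A[X]) :
    seriesDeriv K q (t + t') = seriesDeriv K q t + seriesDeriv K q t' := by
  funext l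
  simp only [seriesDeriv, Pi.add_apply, map_add]
  ring

theorem seriesDeriv_sub (t t' : ℤ → A[X]) :
    seriesDeriv K q (t - t') = seriesDeriv K q t - seriesDeriv K q t' := by
  funext l
  simp only [seriesDeriv, Pi.sub_apply, map_sub]
  ring

theorem seriesDeriv_single (k : ℤ) (f : A[X]) :
    seriesDeriv K q (Pi.single k f) =
      Pi.single k (derivHead q (k : K) f) + Pi.single (k + 2) (derivTail q (k : K) f) := by
  funext l
  simp only [seriesDeriv, Pi.add_apply]
  congr 1
  · rcases eq_or_ne l k with rfl | hl
    · simp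
    · simp [Pi.single_eq_of_ne hl]
  · rcases eq_or_ne l (k + 2) with rfl | hl
    · rw [Pi.single_eq_same, show k + 2 - 2 = k by ring, Pi.single_eq_same,
        show ((k + 2 : ℤ) : K) - 2 = k by push_cast; ring]
    · rw [Pi.single_eq_of_ne hl, Pi.single_eq_of_ne (by omega), map_zero]

end FiniteIndependence

/-! ### Uniform bounds for all reductions. -/

section Reductions

variable {K : Type*} [NormedField K] [IsUltrametricDist K]

/-- Bernoulli's inequality; it absorbs the linear growth of the denominators into an exponential
with base close to 1. -/
theorem natCast_add_one_le_mul_pow {θ : ℝ} (hθ : 1 < θ) (n : ℕ) :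
    (n : ℝ) + 1 ≤ (1 / (θ - 1) + 1) * θ ^ n := by
  have h0 : 0 < θ - 1 := by linarith
  have h1 := one_add_mul_sub_le_pow (a := θ) (by linarith) n
  have h2 : (n : ℝ) ≤ 1 / (θ - 1) * θ ^ n := by
    rw [div_mul_eq_mul_div, one_mul, le_div_iff₀ h0]
    linarith
  have h3 : 1 ≤ θ ^ n := one_le_pow₀ hθ.le
  linarith

theorem isReduction_two (q : (PowerSeries K)[X]) (g i : ℕ) :
    IsReduction K q g 2 i (0 : ℤ → (PowerSeries K)[X]) where
  degree_lt l := by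
    rw [Pi.zero_apply, degree_zero]; exact WithBot.bot_lt_coe _
  eq_zero _ _ := rfl
  deriv_eq l _ h2 := by
    rw [Pi.single_eq_of_ne h2, seriesDeriv, Pi.zero_apply, Pi.zero_apply, map_zero, map_zero,
      add_zero]
  coeff_eq := by
    rw [Pi.single_eq_of_ne (by norm_num), seriesDeriv, Pi.zero_apply, Pi.zero_apply, map_zero,
      map_zero, add_zero]

namespace HyperellipticFamily

variable (E : HyperellipticFamily K)

/-- The same `τ` must serve every μ; only the constant and the admissible rates depend on μ. This
lets the growth be matched to an arbitrary given decay later. -/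
theorem exists_reductions [CharZero K] [CompleteSpace K] (h2 : ‖(2 : K)‖ = 1)
    (hinv : ∀ n : ℕ, n ≠ 0 → ‖(n : K)⁻¹‖ ≤ n) :
    ∃ τ : ℤ → ℕ → ℤ → (PowerSeries K)[X],
      (∀ k, ∀ i ≤ 2 * E.g, IsReduction K E.QPS E.g k i (τ k i)) ∧
      ∀ μ : ℝ, 1 < μ → ∃ C ρ₁ : ℝ, 0 ≤ C ∧ 0 < ρ₁ ∧ ρ₁ < 1 ∧ ∀ ρ, ρ₁ ≤ ρ → ρ < 1 →
        ∀ k, ∀ i ≤ 2 * E.g, ∀ l n,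
        HasOverconvergentExpansion E.R (C * μ ^ k.natAbs) ρ ((τ k i l).coeff n) := by
  obtain ⟨U, V, hUV⟩ := E.exists_bezout
  obtain ⟨c, hc⟩ := exists_reduction_of_three_le E.monic E.natDegree_eq hUV E.isUnit_coeff_zero_r
    h2 hinv
  obtain ⟨D, hD⟩ := E.exists_weightedBound_QPS
  obtain ⟨δ, hδ, hδR⟩ := E.exists_norm_coeff_sub_R_le
  set m := 4 * (2 * E.g + 1) * D with hm
  set b := 4 * (2 * E.g + 1) with hb
  have key : ∀ (k : ℤ) (i : ℕ), ∃ τ : ℤ → (PowerSeries K)[X], i ≤ 2 * E.g →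
      IsReduction K E.QPS E.g k i τ ∧ ∀ (ρ θ : ℝ), 0 < ρ → ρ ≤ 1 → 1 < θ → ρ⁻¹ ≤ θ →
      HasOverconvergentExpansion E.R θ ρ (integralToPowerSeries K E.r)⁻¹ → ∀ l n,
      HasOverconvergentExpansion E.R (b * (k.natAbs + 1) * θ ^ ((m + c + 1) * (k.natAbs + 1))) ρ
        ((τ l).coeff n) := by
    intro k i
    by_cases hi : i ≤ 2 * E.g
    swap
    · exact ⟨0, fun h => (hi h).elim⟩
    rcases (by omega : k ≤ 1 ∨ k = 2 ∨ 3 ≤ k) with hk | rfl | hk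
    · obtain ⟨τ, hτ, hb'⟩ := exists_reduction_of_le_one E.QPS_monic E.QPS_natDegree h2 hinv hk hi
      refine ⟨τ, fun _ => ⟨hτ, fun ρ θ h0 h1 hθ hρθ hr l n => ?_⟩⟩
      refine (hb' E.R D ρ h0 h1 (hD ρ h0 h1) l n).mono_const ?_ h0.le
      push_cast
      rw [← hm]
      have h3 : (ρ⁻¹) ^ (m * (k.natAbs + 1)) ≤ θ ^ ((m + c + 1) * (k.natAbs + 1)) :=
        (pow_le_pow_left₀ (by positivity) hρθ _).trans
          (pow_le_pow_right₀ hθ.le (Nat.mul_le_mul_right _ (by omega)))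
      rw [hb]
      push_cast
      exact mul_le_mul_of_nonneg_left h3 (by positivity)
    · refine ⟨0, fun _ => ⟨isReduction_two _ _ _, fun ρ θ h0 h1 hθ hρθ hr l n => ?_⟩⟩
      rw [Pi.zero_apply, coeff_zero]
      exact .zero (by positivity) h0.le
    · lift k to ℕ using by omega
      obtain ⟨τ, hτ, hb'⟩ := hc k (by omega) i hi
      refine ⟨τ, fun _ => ⟨hτ, fun ρ θ h0 h1 hθ hρθ hr l n => ?_⟩⟩
      refine (hb' E.R ρ θ h0 h1 hθ.le hr l n).mono_const ?_ h0.le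
      have h3 : (ρ⁻¹) ^ (c * k) * θ ^ k ≤ θ ^ ((m + c + 1) * (k + 1)) := by
        calc (ρ⁻¹) ^ (c * k) * θ ^ k ≤ θ ^ (c * k) * θ ^ k := by gcongr
          _ = θ ^ ((c + 1) * k) := by rw [← pow_add]; congr 1; ring
          _ ≤ _ := pow_le_pow_right₀ hθ.le (Nat.mul_le_mul (by omega) (by omega))
      have h4 : (k : ℝ) ≤ b * (k + 1) := by
        have : (1 : ℝ) ≤ b := by exact_mod_cast (by omega : 1 ≤ b)
        nlinarith [(Nat.cast_nonneg k : (0 : ℝ) ≤ k)]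
      rw [Int.natAbs_natCast]
      exact mul_le_mul h4 h3 (by positivity) (by positivity)
  choose τ hτ using key
  refine ⟨τ, fun k i hi => (hτ k i hi).1, fun μ hμ => ?_⟩
  -- Per unit of |k|, m + c + 1 factors θ pay for the powers of 1/ρ and of 1/r, and one more for the
  -- linear factor |k| + 1.
  obtain ⟨θ, hθ, hθμ⟩ := exists_one_lt_pow_le hμ (m + c + 1)
  obtain ⟨ρ₁, hρ0, hρ1, hρ⟩ := exists_rate_inv E.norm_coeff_R_le E.norm_coeff_zero_R hδ hδR hθ
  have hθ0 : 0 < θ - 1 := by linarith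
  refine ⟨b * ((1 / (θ - 1) + 1) * θ ^ (m + c + 1)), ρ₁, by positivity, hρ0, hρ1,
    fun ρ hρρ hρl k i hi l n => ?_⟩
  obtain ⟨h3, h4⟩ := hρ ρ hρρ hρl
  have h0 : 0 < ρ := hρ0.trans_le hρρ
  refine ((hτ k i hi).2 ρ θ h0 hρl.le hθ h3 h4 l n).mono_const ?_ h0.le
  calc (b : ℝ) * (k.natAbs + 1) * θ ^ ((m + c + 1) * (k.natAbs + 1))
      ≤ b * ((1 / (θ - 1) + 1) * θ ^ k.natAbs) * θ ^ ((m + c + 1) * (k.natAbs + 1)) := by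
        gcongr
        exact natCast_add_one_le_mul_pow hθ _
    _ = b * ((1 / (θ - 1) + 1) * θ ^ (m + c + 1)) * (θ ^ (m + c + 1 + 1)) ^ k.natAbs := by
        rw [← pow_mul]
        ring
    _ = _ := by rw [hθμ]

end HyperellipticFamily

end Reductions

/-! ### Coefficientwise convergence of sums of polynomials. -/

section CoeffSums

variable {A : Type*} [CommRing A] [TopologicalSpace A] [IsTopologicalRing A] {ι : Type*}

/-- Coefficientwise convergence of sums of polynomials. -/
def Polynomial.HasCoeffSum (F : ι → A[X]) (f : A[X]) : Prop :=
  ∀ n, HasSum (fun i => (F i).coeff n) (f.coeff n)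

namespace Polynomial.HasCoeffSum

variable {F G : ι → A[X]} {f f' : A[X]}

theorem add (h : HasCoeffSum F f) (h' : HasCoeffSum G f') : HasCoeffSum (F + G) (f + f') :=
  fun n => by simpa using (h n).add (h' n)

theorem sub (h : HasCoeffSum F f) (h' : HasCoeffSum G f') : HasCoeffSum (F - G) (f - f') :=
  fun n => by simpa using (h n).sub (h' n)

theorem neg (h : HasCoeffSum F f) : HasCoeffSum (-F) (-f) :=
  fun n => by simpa using (h n).neg

theorem unique [T2Space A] (h : HasCoeffSum F f) (h' : HasCoeffSum F f') : f = f' :=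
  Polynomial.ext fun n => (h n).unique (h' n)

theorem single [DecidableEq ι] (t : ι → A[X]) (l : ι) :
    HasCoeffSum (fun k => (Pi.single k (t k) : ι → A[X]) l) (t l) := fun n => by
  have h := hasSum_single (f := fun k => ((Pi.single k (t k) : ι → A[X]) l).coeff n) l
    (fun k hk => by rw [Pi.single_eq_of_ne hk.symm, coeff_zero])
  rwa [Pi.single_eq_same] at h

/-- With degrees bounded by N, a linear map is a finite matrix on coefficients and so commutes with
coefficientwise sums. -/
theorem map (h : HasCoeffSum F f) (T : A[X] →ₗ[A] A[X]) {N : ℕ} (hF : ∀ i, (F i).degree < N)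
    (hf : f.degree < N) : HasCoeffSum (fun i => T (F i)) (T f) := by
  have key : ∀ p : A[X], p.degree < N → ∀ n,
      (T p).coeff n = ∑ m ∈ Finset.range N, p.coeff m * (T (X ^ m)).coeff n := by
    intro p hp n
    have hpN : p = ∑ m ∈ Finset.range N, C (p.coeff m) * X ^ m := by
      ext j
      simp only [finsetSum_coeff, coeff_C_mul, coeff_X_pow, mul_ite, mul_one, mul_zero,
        Finset.sum_ite_eq, Finset.mem_range]
      split_ifs with hj
      · rfl
      · exact coeff_eq_zero_of_degree_lt (hp.trans_le (by exact_mod_cast not_lt.1 hj))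
    conv_lhs => rw [hpN]
    simp only [map_sum, ← smul_eq_C_mul, map_smul, finsetSum_coeff, coeff_smul, smul_eq_mul]
  intro n
  simp only [key _ hf, key _ (hF _)]
  exact hasSum_sum fun m _ => (h m).mul_right _

end Polynomial.HasCoeffSum

end CoeffSums

/-! ### Summing the reductions of a series with geometric decay. -/

section Decay

variable {K : Type*} [NormedField K] [IsUltrametricDist K]

/-- The growth condition on the numerators of `∑_k t_k / √q ^ k`, over `K⟦Γ⟧`. -/
def HasDecay (R : K[X]) (t : ℤ → (PowerSeries K)[X]) : Prop :=
  ∃ C ρ : ℝ, (0 < ρ ∧ ρ < 1) ∧ ∀ (k : ℤ) (i : ℕ),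
    HasOverconvergentExpansion R (C * ρ ^ k.natAbs) ρ ((t k).coeff i)

/-- The combination of the `τ k i` with coefficients those of `f`. -/
def reductionOf (g : ℕ) (τ : ℤ → ℕ → ℤ → (PowerSeries K)[X]) (k : ℤ) (f : (PowerSeries K)[X]) :
    ℤ → (PowerSeries K)[X] :=
  fun l => ∑ i ∈ Finset.range (2 * g + 1), f.coeff i • τ k i l

theorem eq_sum_smul_X_pow {A : Type*} [CommRing A] {f : A[X]} {n : ℕ} (hf : f.degree < n) :
    f = ∑ i ∈ Finset.range n, f.coeff i • X ^ i := by
  ext j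
  simp only [finsetSum_coeff, coeff_smul, coeff_X_pow, smul_eq_mul, mul_ite, mul_one, mul_zero,
    Finset.sum_ite_eq, Finset.mem_range]
  split_ifs with hj
  · rfl
  · exact coeff_eq_zero_of_degree_lt (hf.trans_le (by exact_mod_cast not_lt.1 hj))

section ReductionOf

variable {q : (PowerSeries K)[X]} {g : ℕ} {τ : ℤ → ℕ → ℤ → (PowerSeries K)[X]}

theorem degree_reductionOf_lt (hτ : ∀ k, ∀ i ≤ 2 * g, IsReduction K q g k i (τ k i)) (k : ℤ)
    (f : (PowerSeries K)[X]) (l : ℤ) :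
    (reductionOf g τ k f l).degree < (2 * g + 1 : ℕ) := by
  rw [reductionOf, ← mem_degreeLT]
  refine Submodule.sum_mem _ fun i hi => Submodule.smul_mem _ _ ?_
  rw [mem_degreeLT]
  exact (hτ k i (by simpa [Nat.lt_succ_iff] using hi)).degree_lt l

theorem reductionOf_eq_zero (hτ : ∀ k, ∀ i ≤ 2 * g, IsReduction K q g k i (τ k i)) {k l : ℤ}
    (f : (PowerSeries K)[X]) (hl : k.natAbs + 2 < l.natAbs) : reductionOf g τ k f l = 0 := by
  refine Finset.sum_eq_zero fun i hi => ?_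
  rw [(hτ k i (by simpa [Nat.lt_succ_iff] using hi)).eq_zero l hl, smul_zero]

theorem seriesDeriv_reductionOf (k l : ℤ) (f : (PowerSeries K)[X]) :
    seriesDeriv K q (reductionOf g τ k f) l =
      ∑ i ∈ Finset.range (2 * g + 1), f.coeff i • seriesDeriv K q (τ k i) l := by
  simp only [seriesDeriv, reductionOf, map_sum, map_smul, smul_add, Finset.sum_add_distrib]

theorem single_eq_sum {k : ℤ} {f : (PowerSeries K)[X]} (hf : f.degree < (2 * g + 1 : ℕ)) (l : ℤ) :
    (Pi.single k f : ℤ → (PowerSeries K)[X]) l = ∑ i ∈ Finset.range (2 * g + 1),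
      f.coeff i • (Pi.single k (X ^ i) : ℤ → (PowerSeries K)[X]) l := by
  rcases eq_or_ne l k with rfl | hl
  · simp only [Pi.single_eq_same]
    exact eq_sum_smul_X_pow hf
  · simp [Pi.single_eq_of_ne hl]

theorem seriesDeriv_reductionOf_eq (hτ : ∀ k, ∀ i ≤ 2 * g, IsReduction K q g k i (τ k i)) {k : ℤ}
    {f : (PowerSeries K)[X]} (hf : f.degree < (2 * g + 1 : ℕ)) {l : ℤ} (h1 : l ≠ 1) (h2 : l ≠ 2) :
    seriesDeriv K q (reductionOf g τ k f) l = (Pi.single k f : ℤ → (PowerSeries K)[X]) l := by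
  rw [seriesDeriv_reductionOf, single_eq_sum hf]
  refine Finset.sum_congr rfl fun i hi => ?_
  rw [(hτ k i (by simpa [Nat.lt_succ_iff] using hi)).deriv_eq l h1 h2]

theorem coeff_seriesDeriv_reductionOf
    (hτ : ∀ k, ∀ i ≤ 2 * g, IsReduction K q g k i (τ k i)) {k : ℤ}
    {f : (PowerSeries K)[X]} (hf : f.degree < (2 * g + 1 : ℕ)) :
    (seriesDeriv K q (reductionOf g τ k f) 1).coeff (2 * g) =
      ((Pi.single k f : ℤ → (PowerSeries K)[X]) 1).coeff (2 * g) := by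
  rw [seriesDeriv_reductionOf, single_eq_sum hf, finsetSum_coeff, finsetSum_coeff]
  refine Finset.sum_congr rfl fun i hi => ?_
  rw [coeff_smul, coeff_smul, (hτ k i (by simpa [Nat.lt_succ_iff] using hi)).coeff_eq]

end ReductionOf

open scoped PowerSeries.WithPiTopology in
/-- Sums of reductions of the terms of a series with geometric decay. -/
theorem exists_sum_reductionOf [CompleteSpace K] {R : K[X]} (hR : ∀ i, ‖R.coeff i‖ ≤ 1)
    (hR0 : ‖R.coeff 0‖ = 1) {q : (PowerSeries K)[X]} {g : ℕ}
    {τ : ℤ → ℕ → ℤ → (PowerSeries K)[X]}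
    (hτ : ∀ k, ∀ i ≤ 2 * g, IsReduction K q g k i (τ k i))
    (hbound : ∀ μ : ℝ, 1 < μ → ∃ C ρ₁ : ℝ, 0 ≤ C ∧ 0 < ρ₁ ∧ ρ₁ < 1 ∧ ∀ ρ, ρ₁ ≤ ρ → ρ < 1 →
        ∀ k, ∀ i ≤ 2 * g, ∀ l n,
        HasOverconvergentExpansion R (C * μ ^ k.natAbs) ρ ((τ k i l).coeff n))
    {f : ℤ → (PowerSeries K)[X]} (hf : HasDecay R f) :
    ∃ u : ℤ → (PowerSeries K)[X], (∀ l, (u l).degree < (2 * g + 1 : ℕ)) ∧ HasDecay R u ∧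
      ∀ l, HasCoeffSum (fun k => reductionOf g τ k (f k) l) (u l) := by
  obtain ⟨C₀, ρ₀, ⟨h0, h1⟩, hf⟩ := hf
  have hC₀ : 0 ≤ C₀ := by simpa using (hf 0 0).nonneg
  -- With μ^2 = 1/ρ₀, decay ρ₀^|k| against growth μ^|k| leaves μ^(-|k|).
  obtain ⟨μ, hμ, hμ2⟩ := exists_one_lt_pow_le ((one_lt_inv₀ h0).2 h1) 1
  obtain ⟨C, ρ₁, hC, hρ0, hρ1, hb⟩ := hbound μ hμ
  have hμ0 : 0 < μ := by linarith
  have hμi : μ⁻¹ < 1 := inv_lt_one_of_one_lt₀ hμ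
  set ρ := max ρ₀ ρ₁ with hρ
  have hρ' : 0 < ρ ∧ ρ < 1 := exists_common_rate ⟨h0, h1⟩ ⟨hρ0, hρ1⟩
  have hμρ : ρ₀ * μ = μ⁻¹ := by
    have h3 : ρ₀ * μ ^ (1 + 1) = 1 := by rw [hμ2, mul_inv_cancel₀ h0.ne']
    refine eq_inv_of_mul_eq_one_left ?_
    linear_combination h3
  have hterm : ∀ k l n, HasOverconvergentExpansion R
      (if k.natAbs + 2 < l.natAbs then 0 else C₀ * C * (μ⁻¹) ^ k.natAbs) ρ
      ((reductionOf g τ k (f k) l).coeff n) := by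
    intro k l n
    split_ifs with hl
    · rw [reductionOf_eq_zero hτ _ hl, coeff_zero]
      exact .zero le_rfl hρ'.1.le
    · rw [reductionOf, finsetSum_coeff]
      refine .sum _ (by positivity) hρ'.1.le fun i hi => ?_
      rw [coeff_smul, smul_eq_mul]
      refine (((hf k i).mono le_rfl h0.le (le_max_left _ _)).mul
        (hb ρ (le_max_right _ _) hρ'.2 k i (by simpa [Nat.lt_succ_iff] using hi) l n)
        hρ'.1.le).mono_const (le_of_eq ?_) hρ'.1.le
      rw [← hμρ]
      ring
  have hgeo : Summable fun k : ℤ => (μ⁻¹) ^ k.natAbs := by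
    have h4 := summable_geometric_of_lt_one (by positivity : 0 ≤ μ⁻¹) hμi
    exact Summable.of_nat_of_neg (by simpa using h4) (by simpa using h4)
  have hRb : PowerSeries.CoeffBound 1 (R : PowerSeries K) := fun i => by
    rw [Polynomial.coeff_coe]; exact hR i
  have hsum : ∀ l n, Summable (fun k => (reductionOf g τ k (f k) l).coeff n) ∧
      HasOverconvergentExpansion R (C₀ * C * μ ^ 2 * (μ⁻¹) ^ l.natAbs) ρ
        (∑' k, (reductionOf g τ k (f k) l).coeff n) := by
    intro l n
    refine HasOverconvergentExpansion.tsum hRb hR0 hρ'.1 hρ'.2 ?_ (fun k => ?_) (by positivity)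
      fun k => hterm k l n
    · refine Summable.of_nonneg_of_le (fun k => ?_) (fun k => ?_) (hgeo.mul_left (C₀ * C))
      · split_ifs <;> positivity
      · split_ifs
        · positivity
        · exact le_rfl
    · split_ifs with hl
      · positivity
      · rw [mul_assoc _ (μ ^ 2)]
        refine mul_le_mul_of_nonneg_left ?_ (by positivity)
        -- Only k with |l| ≤ |k| + 2 contribute at the index l, so decay in k becomes decay in l.
        calc (μ⁻¹) ^ k.natAbs = μ ^ 2 * (μ⁻¹) ^ (k.natAbs + 2) := by
              rw [pow_add, inv_pow _ 2]; field_simp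
          _ ≤ μ ^ 2 * (μ⁻¹) ^ l.natAbs := by
              refine mul_le_mul_of_nonneg_left ?_ (by positivity)
              exact pow_le_pow_of_le_one (by positivity) hμi.le (by omega)
  set u : ℤ → (PowerSeries K)[X] := fun l => ∑ n ∈ Finset.range (2 * g + 1),
    monomial n (∑' k, (reductionOf g τ k (f k) l).coeff n) with hu
  have hcoeff : ∀ l n, (u l).coeff n = ∑' k, (reductionOf g τ k (f k) l).coeff n := by
    intro l n
    simp only [hu, finsetSum_coeff, coeff_monomial, Finset.sum_ite_eq', Finset.mem_range]
    split_ifs with hn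
    · rfl
    · have : ∀ k, (reductionOf g τ k (f k) l).coeff n = 0 := fun k =>
        coeff_eq_zero_of_degree_lt ((degree_reductionOf_lt hτ k (f k) l).trans_le
          (by exact_mod_cast not_lt.1 hn))
      simp [this]
  refine ⟨u, fun l => ?_, ⟨C₀ * C * μ ^ 2, max ρ μ⁻¹, ?_, fun l n => ?_⟩, fun l n => ?_⟩
  · rw [← mem_degreeLT]
    refine Submodule.sum_mem _ fun n hn => ?_
    rw [mem_degreeLT]
    exact (degree_monomial_le _ _).trans_lt (by exact_mod_cast Finset.mem_range.1 hn)
  · exact exists_common_rate hρ' ⟨by positivity, hμi⟩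
  · rw [hcoeff]
    refine (hsum l n).2.mono ?_ hρ'.1.le (le_max_left _ _)
    gcongr
    exact le_max_right _ _
  · rw [hcoeff]
    exact (hsum l n).1.hasSum

end Decay

/-! ### Independence modulo derivatives of infinite series. -/

section Independence

variable {K : Type*} [NormedField K] [IsUltrametricDist K] [CharZero K]
  {q : (PowerSeries K)[X]} {g : ℕ} {τ : ℤ → ℕ → ℤ → (PowerSeries K)[X]}

/-- The difference of the form `f / √q ^ k` and the derivative of its reduction. -/
def remainder (q : (PowerSeries K)[X]) (g : ℕ) (τ : ℤ → ℕ → ℤ → (PowerSeries K)[X]) (k : ℤ)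
    (f : (PowerSeries K)[X]) : ℤ → (PowerSeries K)[X] :=
  Pi.single k f - seriesDeriv K q (reductionOf g τ k f)

theorem reductionOf_add (k : ℤ) (f f' : (PowerSeries K)[X]) :
    reductionOf g τ k (f + f') = reductionOf g τ k f + reductionOf g τ k f' := by
  funext l
  simp only [reductionOf, Pi.add_apply, coeff_add, add_smul, Finset.sum_add_distrib]

theorem remainder_add (k : ℤ) (f f' : (PowerSeries K)[X]) :
    remainder q g τ k (f + f') = remainder q g τ k f + remainder q g τ k f' := by
  rw [remainder, reductionOf_add, seriesDeriv_add, Pi.single_add, remainder, remainder]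
  abel

variable (hq : q.Monic) (hg : q.natDegree = 2 * g + 1) {U V : (PowerSeries K)[X]}
  {r : PowerSeries K} (h : U * q + V * derivative q = C r) (hr : r ≠ 0)
  (hτ : ∀ k, ∀ i ≤ 2 * g, IsReduction K q g k i (τ k i))

include hq hg h hr hτ

/-- The sum is the derivative of the finite sum `v`. Remainders are basic, so finite independence
makes it zero. -/
theorem remainder_derivHead_add (k : ℤ) {f : (PowerSeries K)[X]}
    (hf : f.degree < (2 * g + 1 : ℕ)) :
    remainder q g τ k (derivHead q (k : K) f) +
      remainder q g τ (k + 2) (derivTail q (k : K) f) = 0 := by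
  have hqd : q.degree = (2 * g + 1 : ℕ) := by rw [degree_eq_natDegree hq.ne_zero, hg]
  have hH : (derivHead q (k : K) f).degree < (2 * g + 1 : ℕ) :=
    (degree_derivHead_lt hq hg _ hf).trans (by exact_mod_cast Nat.lt_succ_self _)
  have hT : (derivTail q (k : K) f).degree < (2 * g + 1 : ℕ) :=
    (degree_derivTail_lt hq _ f).trans_eq hqd
  set v := Pi.single k f - reductionOf g τ k (derivHead q (k : K) f) -
    reductionOf g τ (k + 2) (derivTail q (k : K) f) with hv
  have hdv : seriesDeriv K q v = remainder q g τ k (derivHead q (k : K) f) +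
      remainder q g τ (k + 2) (derivTail q (k : K) f) := by
    rw [hv, seriesDeriv_sub, seriesDeriv_sub, seriesDeriv_single, remainder, remainder]
    abel
  rw [← hdv]
  refine seriesDeriv_eq_zero hq hg h hr (N := k.natAbs + 4) (fun l => ?_) (fun l hl => ?_)
    (fun l h1 h2 => ?_) ?_
  · refine (degree_sub_le _ _).trans_lt (max_lt ((degree_sub_le _ _).trans_lt (max_lt ?_ ?_)) ?_)
    · rcases eq_or_ne l k with rfl | hl
      · rwa [Pi.single_eq_same]
      · rw [Pi.single_eq_of_ne hl, degree_zero]; exact WithBot.bot_lt_coe _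
    · exact degree_reductionOf_lt hτ _ _ _
    · exact degree_reductionOf_lt hτ _ _ _
  · rw [hv, Pi.sub_apply, Pi.sub_apply, Pi.single_eq_of_ne (by rintro rfl; omega),
      reductionOf_eq_zero hτ _ (by omega), reductionOf_eq_zero hτ _ (by omega)]
    simp
  · rw [hdv, Pi.add_apply, remainder, remainder, Pi.sub_apply, Pi.sub_apply,
      seriesDeriv_reductionOf_eq hτ hH h1 h2, seriesDeriv_reductionOf_eq hτ hT h1 h2]
    simp
  · rw [hdv, Pi.add_apply, remainder, remainder, Pi.sub_apply, Pi.sub_apply, coeff_add, coeff_sub,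
      coeff_sub, coeff_seriesDeriv_reductionOf hτ hH, coeff_seriesDeriv_reductionOf hτ hT]
    simp

/-- For a basic form the derivative of its reduction is itself basic, hence zero by finite
independence. -/
theorem remainder_eq_single {k : ℤ} {f : (PowerSeries K)[X]} (hf : f.degree < (2 * g + 1 : ℕ))
    (h0 : k ≠ 1 → k ≠ 2 → f = 0)
    (h1 : ((Pi.single k f : ℤ → (PowerSeries K)[X]) 1).coeff (2 * g) = 0) :
    remainder q g τ k f = Pi.single k f := by
  rw [remainder, sub_eq_self]
  refine seriesDeriv_eq_zero hq hg h hr (N := k.natAbs + 2)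
    (fun l => degree_reductionOf_lt hτ _ _ _) (fun l hl => reductionOf_eq_zero hτ _ hl)
    (fun l hl1 hl2 => ?_) ?_
  · rw [seriesDeriv_reductionOf_eq hτ hf hl1 hl2]
    rcases eq_or_ne l k with rfl | hl
    · rw [Pi.single_eq_same, h0 hl1 hl2]
    · rw [Pi.single_eq_of_ne hl]
  · rw [coeff_seriesDeriv_reductionOf hτ hf, h1]

omit [CharZero K] hq hg h hr hτ in
open scoped PowerSeries.WithPiTopology in
theorem hasCoeffSum_seriesDeriv {f : ℤ → ℤ → (PowerSeries K)[X]}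
    {u : ℤ → (PowerSeries K)[X]} (hf : ∀ k l, (f k l).degree < (2 * g + 1 : ℕ))
    (hu : ∀ l, (u l).degree < (2 * g + 1 : ℕ)) (h : ∀ l, HasCoeffSum (fun k => f k l) (u l))
    (l : ℤ) : HasCoeffSum (fun k => seriesDeriv K q (f k) l) (seriesDeriv K q u l) :=
  ((h l).map (derivHead q (l : K)) (fun k => hf k l) (hu l)).add
    ((h (l - 2)).map (derivTail q ((l : K) - 2)) (fun k => hf k (l - 2)) (hu (l - 2)))

open scoped PowerSeries.WithPiTopology in
/-- Forms `X ^ i / √q` with `i < 2 * g` and `X ^ j / q` with `j ≤ 2 * g` are independent modulo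
derivatives of series with geometric decay. -/
theorem seriesDeriv_eq_zero_of_hasDecay [CompleteSpace K] {R : K[X]}
    (hR : ∀ i, ‖R.coeff i‖ ≤ 1) (hR0 : ‖R.coeff 0‖ = 1)
    (hbound : ∀ μ : ℝ, 1 < μ → ∃ C ρ₁ : ℝ, 0 ≤ C ∧ 0 < ρ₁ ∧ ρ₁ < 1 ∧ ∀ ρ, ρ₁ ≤ ρ → ρ < 1 →
        ∀ k, ∀ i ≤ 2 * g, ∀ l n,
        HasOverconvergentExpansion R (C * μ ^ k.natAbs) ρ ((τ k i l).coeff n))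
    {t : ℤ → (PowerSeries K)[X]} (ht : ∀ l, (t l).degree < (2 * g + 1 : ℕ))
    (hH : HasDecay R fun k => derivHead q (k : K) (t k))
    (h0 : ∀ l, l ≠ 1 → l ≠ 2 → seriesDeriv K q t l = 0)
    (h1 : (seriesDeriv K q t 1).coeff (2 * g) = 0) : seriesDeriv K q t = 0 := by
  have hqd : q.degree = (2 * g + 1 : ℕ) := by rw [degree_eq_natDegree hq.ne_zero, hg]
  have hHd : ∀ k : ℤ, (derivHead q (k : K) (t k)).degree < (2 * g + 1 : ℕ) := fun k =>
    (degree_derivHead_lt hq hg _ (ht k)).trans (by exact_mod_cast Nat.lt_succ_self _)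
  have hTd : ∀ k : ℤ, (derivTail q ((k : K) - 2) (t (k - 2))).degree < (2 * g + 1 : ℕ) := fun k =>
    (degree_derivTail_lt hq _ _).trans_eq hqd
  obtain ⟨u, hu, -, hsum⟩ := exists_sum_reductionOf hR hR0 hτ hbound hH
  funext l
  have hs : HasCoeffSum (fun k => remainder q g τ k (derivHead q (k : K) (t k)) l) _ :=
    (HasCoeffSum.single _ l).sub (hasCoeffSum_seriesDeriv
      (fun k => degree_reductionOf_lt hτ k _) hu hsum l)
  set s := derivHead q (l : K) (t l) - seriesDeriv K q u l
  have h2 : HasCoeffSum (fun k : ℤ => remainder q g τ k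
      (derivTail q ((k : K) - 2) (t (k - 2))) l) (-s) := by
    intro n
    -- Shifting the index by 2 pairs the tail of `t k` with its head, whose remainder is the
    -- negative. The tails thus sum to -s without a separate convergence argument.
    rw [← (Equiv.addRight (2 : ℤ)).hasSum_iff]
    convert hs.neg n using 2 with k
    have h3 := congrFun (remainder_derivHead_add hq hg h hr hτ k (ht k)) l
    rw [Pi.add_apply, Pi.zero_apply, add_comm] at h3
    simp only [Function.comp_apply, Equiv.coe_addRight, Pi.neg_apply]
    rw [show k + 2 - 2 = k by ring, show ((k + 2 : ℤ) : K) - 2 = k by push_cast; ring,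
      eq_neg_of_add_eq_zero_left h3]
  have h3 : HasCoeffSum (fun k => (Pi.single k (seriesDeriv K q t k) : ℤ → (PowerSeries K)[X]) l)
      (s + -s) := by
    -- Head and tail at the same place add up to the numerator of dt, which is basic and so is its
    -- own remainder. Hence dt = s - s.
    convert hs.add h2 using 1
    funext k
    rw [Pi.add_apply, ← Pi.add_apply (remainder q g τ k _), ← remainder_add]
    change _ = remainder q g τ k (seriesDeriv K q t k) l
    have hd : (seriesDeriv K q t k).degree < (2 * g + 1 : ℕ) :=
      (degree_add_le _ _).trans_lt (max_lt (hHd k) (hTd k))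
    rw [remainder_eq_single hq hg h hr hτ hd (h0 k)]
    rcases eq_or_ne k 1 with rfl | hk
    · rw [Pi.single_eq_same, h1]
    · rw [Pi.single_eq_of_ne hk.symm, coeff_zero]
  rw [(HasCoeffSum.single (seriesDeriv K q t) l).unique h3, add_neg_cancel, Pi.zero_apply]

end Independence

/-! ### Transfer from `K⟦Γ⟧` to `S`, and the basis. -/

namespace HyperellipticFamily

variable {K : Type*} [NormedField K] [IsUltrametricDist K] (E : HyperellipticFamily K)

theorem expansion_injective : Function.Injective E.expansion := Subtype.val_injective

theorem map_expansion_injective :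
    Function.Injective (Polynomial.map (E.expansion : E.S →+* PowerSeries K)) :=
  Polynomial.map_injective _ E.expansion_injective

theorem deriv_eq_seriesDeriv (t : ℤ → E.S[X]) : E.deriv t = seriesDeriv K E.QS t := by
  funext l
  rw [deriv, seriesDeriv, derivHead_apply, derivTail_apply, neg_smul, sub_eq_add_neg]

theorem map_expansion_seriesDeriv (t : ℤ → E.S[X]) (l : ℤ) :
    (seriesDeriv K E.QS t l).map (E.expansion : E.S →+* PowerSeries K) =
      seriesDeriv K E.QPS (fun l => (t l).map (E.expansion : E.S →+* PowerSeries K)) l := by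
  rw [seriesDeriv, Polynomial.map_add, map_derivHead E.QS_monic, map_derivTail E.QS_monic,
    map_expansion_QS, seriesDeriv]

theorem degree_map_expansion (p : E.S[X]) :
    (p.map (E.expansion : E.S →+* PowerSeries K)).degree = p.degree :=
  degree_map_eq_of_injective E.expansion_injective p

variable {E} in
theorem IsOverconvergent.hasDecay {t : ℤ → E.S[X]} (ht : E.IsOverconvergent t) :
    HasDecay E.R fun l => (t l).map (E.expansion : E.S →+* PowerSeries K) := by
  obtain ⟨C, ρ, hρ, h⟩ := ht
  exact ⟨C, ρ, hρ, fun k i => by rw [coeff_map]; exact h k i⟩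

/-- Sums formed in `K⟦Γ⟧` return to `T` because the decay condition contains an overconvergent
expansion of each coefficient. -/
theorem exists_map_expansion_eq {u : ℤ → (PowerSeries K)[X]}
    (hd : ∀ l, (u l).degree < (2 * E.g + 1 : ℕ)) (hu : HasDecay E.R u) :
    ∃ t ∈ E.T, ∀ l, (t l).map (E.expansion : E.S →+* PowerSeries K) = u l := by
  obtain ⟨C, ρ, hρ, h⟩ := hu
  have h1 : ∀ l, ∃ p : E.S[X], p.map (E.expansion : E.S →+* PowerSeries K) = u l := by
    intro l
    rw [← mem_lifts, lifts_iff_coeff_lifts]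
    intro n
    exact ⟨⟨(u l).coeff n, _, ρ, hρ, h l n⟩, rfl⟩
  choose t ht using h1
  refine ⟨t, ⟨fun l => ?_, C, ρ, hρ, fun k i => ?_⟩, ht⟩
  · rw [← E.degree_map_expansion, ht]
    exact hd l
  · have h2 := h k i
    rw [← ht, coeff_map] at h2
    exact h2

/-- This is the decay under which the remainders of the heads can be summed; the scalars k/2 stay
bounded because integers have norm at most 1. -/
theorem isOverconvergent_derivHead {t : ℤ → E.S[X]} (ht : t ∈ E.T) :
    E.IsOverconvergent fun k => derivHead E.QS (k : K) (t k) := by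
  have h1 := E.isOverconvergent_linear (Polynomial.derivative (R := E.S)) ht
  have h2 := (E.isOverconvergent_linear E.mulDiv ht).scalar (fun k => -((k : K) / 2))
    (fun k => by rw [norm_neg]; exact norm_half_intCast_le k)
  convert h1.add h2 using 1
  funext k
  rw [derivHead_apply, Pi.add_apply, neg_smul, sub_eq_add_neg]
  rfl

theorem exists_bezout_QPS : ∃ (U V : (PowerSeries K)[X]) (r : PowerSeries K),
    U * E.QPS + V * derivative E.QPS = C r ∧ r ≠ 0 := by
  obtain ⟨U, V, h⟩ := E.exists_bezout
  refine ⟨U.map (integralToPowerSeries K), V.map (integralToPowerSeries K),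
    integralToPowerSeries K E.r, ?_, fun h0 => ?_⟩
  · rw [QPS, derivative_map, ← Polynomial.map_mul, ← Polynomial.map_mul, ← Polynomial.map_add, h,
      map_C]
  · have h1 := (isUnit_integer_iff _).1 E.isUnit_coeff_zero_r
    have h2 : PowerSeries.coeff 0 (integralToPowerSeries K E.r) = (E.r.coeff 0 : K) := by
      change PowerSeries.coeff 0 ((E.r.map (algebraMap (integerRing K) K) : K[X]) :
        PowerSeries K) = _
      rw [Polynomial.coeff_coe, coeff_map]
      rfl
    rw [h0, map_zero] at h2
    rw [← h2, norm_zero] at h1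
    exact zero_ne_one h1

/-- A series supported at `1 / √Q` and `1 / Q`, with numerators of degrees less than `2 * g` and
at most `2 * g`. -/
def IsBasic (w : E.T) : Prop :=
  (∀ l, l ≠ 1 → l ≠ 2 → (w : ℤ → E.S[X]) l = 0) ∧ ((w : ℤ → E.S[X]) 1).coeff (2 * E.g) = 0

section

variable [CharZero K] [CompleteSpace K] (h2 : ‖(2 : K)‖ = 1)
  (hinv : ∀ n : ℕ, n ≠ 0 → ‖(n : K)⁻¹‖ ≤ n)

include h2 hinv

theorem eq_zero_of_isBasic_d {t : E.T} (h : E.IsBasic (E.d t)) : E.d t = 0 := by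
  obtain ⟨τ, hτ, hb⟩ := E.exists_reductions h2 hinv
  obtain ⟨U, V, r, hUV, hr⟩ := E.exists_bezout_QPS
  have hd : ∀ l, (E.d t : ℤ → E.S[X]) l = seriesDeriv K E.QS t l :=
    congrFun (E.deriv_eq_seriesDeriv t)
  have hdecay := (E.isOverconvergent_derivHead t.2).hasDecay
  simp only [map_derivHead E.QS_monic, map_expansion_QS] at hdecay
  have key := seriesDeriv_eq_zero_of_hasDecay E.QPS_monic E.QPS_natDegree hUV hr hτ
    E.norm_coeff_R_le E.norm_coeff_zero_R hb
    (t := fun l => ((t : ℤ → E.S[X]) l).map (E.expansion : E.S →+* PowerSeries K))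
    (fun l => by rw [degree_map_expansion]; exact t.2.1 l) hdecay
    (fun l hl1 hl2 => by
      rw [← map_expansion_seriesDeriv, ← hd, h.1 l hl1 hl2, Polynomial.map_zero])
    (by rw [← map_expansion_seriesDeriv, ← hd, coeff_map, h.2, map_zero])
  refine Subtype.ext (funext fun l => E.map_expansion_injective ?_)
  rw [hd, map_expansion_seriesDeriv, key]
  exact (Polynomial.map_zero _).symm

-- Take t to be the sum of the reductions of the terms of w. Differentiation commutes with the sum,
-- so dt agrees with w wherever each reduction agrees with its own term.
open scoped PowerSeries.WithPiTopology in
theorem exists_isBasic_sub_d (w : E.T) : ∃ t : E.T, E.IsBasic (w - E.d t) := by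
  obtain ⟨τ, hτ, hb⟩ := E.exists_reductions h2 hinv
  have hwd : ∀ l, (((w : ℤ → E.S[X]) l).map (E.expansion : E.S →+* PowerSeries K)).degree <
      (2 * E.g + 1 : ℕ) := fun l => by rw [degree_map_expansion]; exact w.2.1 l
  obtain ⟨u, hu, hud, hsum⟩ := exists_sum_reductionOf E.norm_coeff_R_le E.norm_coeff_zero_R hτ hb
    w.2.2.hasDecay
  obtain ⟨t, ht, htu⟩ := E.exists_map_expansion_eq hu hud
  have hd : ∀ l, ((E.d ⟨t, ht⟩ : ℤ → E.S[X]) l).map (E.expansion : E.S →+* PowerSeries K) =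
      seriesDeriv K E.QPS u l := fun l => by
    rw [← funext htu, ← map_expansion_seriesDeriv]
    exact congrArg _ (congrFun (E.deriv_eq_seriesDeriv t) l)
  have hs := hasCoeffSum_seriesDeriv (q := E.QPS) (fun k => degree_reductionOf_lt hτ k _) hu hsum
  refine ⟨⟨t, ht⟩, fun l hl1 hl2 => ?_, ?_⟩
  · refine sub_eq_zero.2 (E.map_expansion_injective ?_)
    rw [hd]
    have h3 := hs l
    simp only [seriesDeriv_reductionOf_eq hτ (hwd _) hl1 hl2] at h3
    exact (Polynomial.HasCoeffSum.single _ l).unique h3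
  · refine (coeff_sub _ _ _).trans (sub_eq_zero.2 (E.expansion_injective ?_))
    have h3 := hs 1 (2 * E.g)
    simp only [coeff_seriesDeriv_reductionOf hτ (hwd _)] at h3
    have h4 := (Polynomial.HasCoeffSum.single (fun l => ((w : ℤ → E.S[X]) l).map
      (E.expansion : E.S →+* PowerSeries K)) 1 (2 * E.g)).unique h3
    rw [coeff_map, ← hd, coeff_map] at h4
    exact h4

end

/-- The forms `X ^ i dX / √Q` for `i < 2 * g` and `X ^ j dX / Q` for `j ≤ 2 * g`. -/
def basicForm : Fin (2 * E.g) ⊕ Fin (2 * E.g + 1) → E.T :=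
  Sum.elim (fun i => E.monomialForm i.castSucc 1) (fun j => E.monomialForm j 2)

theorem coe_sum_smul_basicForm (c : Fin (2 * E.g) ⊕ Fin (2 * E.g + 1) → E.S) (l : ℤ) :
    ((∑ x, c x • E.basicForm x : E.T) : ℤ → E.S[X]) l =
      (Pi.single 1 (∑ i : Fin (2 * E.g), c (Sum.inl i) • X ^ (i : ℕ)) : ℤ → E.S[X]) l +
      (Pi.single 2 (∑ j : Fin (2 * E.g + 1), c (Sum.inr j) • X ^ (j : ℕ)) : ℤ → E.S[X]) l := by
  rw [Fintype.sum_sum_type, Submodule.coe_add, Pi.add_apply, Submodule.coe_sum, Submodule.coe_sum,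
    Finset.sum_apply, Finset.sum_apply]
  have key : ∀ (k : ℤ) (n : ℕ) (a : Fin n → E.S) (p : Fin n → E.S[X]),
      ∑ i, (a i • (Pi.single k (p i) : ℤ → E.S[X])) l =
        (Pi.single k (∑ i, a i • p i) : ℤ → E.S[X]) l := by
    intro k n a p
    rcases eq_or_ne l k with rfl | hl
    · simp
    · simp [Pi.single_eq_of_ne hl]
  exact congrArg₂ _ (key 1 _ _ _) (key 2 _ _ _)

theorem coeff_sum_smul_X_pow {A : Type*} [CommRing A] {n : ℕ} (a : Fin n → A) (i : Fin n) :
    (∑ i, a i • (X : A[X]) ^ (i : ℕ)).coeff i = a i := by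
  simp [finsetSum_coeff, coeff_X_pow, Fin.val_inj]

theorem isBasic_sum_smul_basicForm (c : Fin (2 * E.g) ⊕ Fin (2 * E.g + 1) → E.S) :
    E.IsBasic (∑ x, c x • E.basicForm x) := by
  refine ⟨fun l h1 h2 => ?_, ?_⟩
  · rw [coe_sum_smul_basicForm, Pi.single_eq_of_ne h1, Pi.single_eq_of_ne h2, add_zero]
  · rw [coe_sum_smul_basicForm, Pi.single_eq_same, Pi.single_eq_of_ne (by norm_num), add_zero,
      finsetSum_coeff]
    refine Finset.sum_eq_zero fun i _ => ?_
    rw [coeff_smul, coeff_X_pow, if_neg i.2.ne', smul_zero]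

theorem eq_sum_smul_basicForm_of_isBasic {w : E.T} (hw : E.IsBasic w) :
    ∃ c : Fin (2 * E.g) ⊕ Fin (2 * E.g + 1) → E.S, w = ∑ x, c x • E.basicForm x := by
  refine ⟨Sum.elim (fun i => ((w : ℤ → E.S[X]) 1).coeff i)
    (fun j => ((w : ℤ → E.S[X]) 2).coeff j), Subtype.ext (funext fun l => ?_)⟩
  rw [coe_sum_smul_basicForm]
  simp only [Sum.elim_inl, Sum.elim_inr]
  by_cases h1 : l = 1
  · subst h1
    rw [Pi.single_eq_same, Pi.single_eq_of_ne (by norm_num), add_zero,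
      Fin.sum_univ_eq_sum_range (fun i => ((w : ℤ → E.S[X]) 1).coeff i • (X : E.S[X]) ^ i)]
    conv_lhs => rw [eq_sum_smul_X_pow (w.2.1 1), Finset.sum_range_succ, hw.2, zero_smul, add_zero]
  by_cases h2 : l = 2
  · subst h2
    rw [Pi.single_eq_same, Pi.single_eq_of_ne (by norm_num), zero_add,
      Fin.sum_univ_eq_sum_range (fun i => ((w : ℤ → E.S[X]) 2).coeff i • (X : E.S[X]) ^ i)]
    exact eq_sum_smul_X_pow (w.2.1 2)
  rw [hw.1 l h1 h2, Pi.single_eq_of_ne h1, Pi.single_eq_of_ne h2, add_zero]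

theorem eq_zero_of_sum_smul_basicForm {c : Fin (2 * E.g) ⊕ Fin (2 * E.g + 1) → E.S}
    (hc : ∑ x, c x • E.basicForm x = 0) (x : Fin (2 * E.g) ⊕ Fin (2 * E.g + 1)) : c x = 0 := by
  have h : ∀ l, _ = (0 : E.S[X]) := fun l =>
    (E.coe_sum_smul_basicForm c l).symm.trans (congrFun (congrArg Subtype.val hc) l)
  rcases x with i | j
  · have h1 := h 1
    rw [Pi.single_eq_same, Pi.single_eq_of_ne (by norm_num), add_zero] at h1
    rw [← coeff_sum_smul_X_pow (fun i => c (Sum.inl i)) i, h1, coeff_zero]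
  · have h1 := h 2
    rw [Pi.single_eq_same, Pi.single_eq_of_ne (by norm_num), zero_add] at h1
    rw [← coeff_sum_smul_X_pow (fun j => c (Sum.inr j)) j, h1, coeff_zero]

theorem exists_basis_cohomology [CharZero K] [CompleteSpace K] (h2 : ‖(2 : K)‖ = 1)
    (hinv : ∀ n : ℕ, n ≠ 0 → ‖(n : K)⁻¹‖ ≤ n) :
    ∃ B : Module.Basis (Fin (2 * E.g) ⊕ Fin (2 * E.g + 1)) E.S E.Cohomology,
      ∀ x, B x = Submodule.Quotient.mk (E.basicForm x) := by
  have hsum : ∀ c : Fin (2 * E.g) ⊕ Fin (2 * E.g + 1) → E.S,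
      ∑ x, c x • (Submodule.Quotient.mk (E.basicForm x) : E.Cohomology) =
        Submodule.Quotient.mk (∑ x, c x • E.basicForm x) := fun c => by
    rw [← Submodule.mkQ_apply, map_sum]
    simp only [map_smul, Submodule.mkQ_apply]
  refine ⟨Module.Basis.mk (v := fun x => Submodule.Quotient.mk (E.basicForm x)) ?_ ?_,
    fun x => Module.Basis.mk_apply _ _ x⟩
  · rw [Fintype.linearIndependent_iff]
    intro c hc
    rw [hsum, Submodule.Quotient.mk_eq_zero] at hc
    obtain ⟨t, ht⟩ := hc
    have hb := E.isBasic_sum_smul_basicForm c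
    rw [← ht] at hb
    exact E.eq_zero_of_sum_smul_basicForm (ht.symm.trans (E.eq_zero_of_isBasic_d h2 hinv hb))
  · rintro x -
    obtain ⟨w, rfl⟩ := Submodule.Quotient.mk_surjective _ x
    obtain ⟨t, ht⟩ := E.exists_isBasic_sub_d h2 hinv w
    obtain ⟨c, hc⟩ := E.eq_sum_smul_basicForm_of_isBasic ht
    have h3 : (Submodule.Quotient.mk w : E.Cohomology) =
        Submodule.Quotient.mk (∑ x, c x • E.basicForm x) := by
      rw [← hc, Submodule.Quotient.eq, sub_sub_cancel]
      exact ⟨t, rfl⟩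
    rw [h3, ← hsum]
    exact Submodule.sum_mem _ fun x _ =>
      Submodule.smul_mem _ _ (Submodule.subset_span ⟨x, rfl⟩)

end HyperellipticFamily

end

/-- `K` is the unramified extension `ℚ_q` of `ℚ_p`, for an odd prime `p`. The `S`-module `T dX / dT`
is free, and the classes of `X ^ i dX / √Q` for `i < 2 * g` together with those of `X ^ j dX / Q`
for `j ≤ 2 * g` form a basis. -/
theorem mainTheorem3 {p : ℕ} [Fact p.Prime] (hp : p ≠ 2)
    {K : Type*} [NormedField K] [IsUltrametricDist K] [NormedAlgebra ℚ_[p] K]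
    [FiniteDimensional ℚ_[p] K] (hK : ∀ x : K, x ≠ 0 → ∃ n : ℤ, ‖x‖ = (p : ℝ) ^ n)
    (E : HyperellipticFamily K) :
    ∃ B : Module.Basis (Fin (2 * E.g) ⊕ Fin (2 * E.g + 1)) E.S E.Cohomology,
      (∀ i : Fin (2 * E.g), B (Sum.inl i) = E.cohomologyClass i.castSucc 1) ∧
      (∀ j : Fin (2 * E.g + 1), B (Sum.inr j) = E.cohomologyClass j 2) := by
  have : CharZero K := charZero_of_padicAlgebra p K
  have : CompleteSpace K := FiniteDimensional.complete ℚ_[p] K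
  obtain ⟨B, hB⟩ := E.exists_basis_cohomology (norm_two_eq_one hp K)
    fun _ hn => norm_inv_natCast_le p K hn
  exact ⟨B, fun i => hB (Sum.inl i), fun j => hB (Sum.inr j)⟩
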